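/- Let $n\ge 0$ and let $Q_1,\dots,Q_n$ be the standard self-adjoint operators on $(\mathbb C^2)^{\otimes n}$ with $Q_iQ_j+Q_jQ_i=2\delta_{ij}I$, namely $Q_j=U\otimes\cdots\otimes U\otimes Q\otimes I\otimes\cdots\otimes I$ with $Q=\begin{pmatrix}0&1\\1&0\end{pmatrix}$ in slot $j$ and $U=\begin{pmatrix}1&0\\0&-1\end{pmatrix}$. Let $\mathfrak C$ be the (Clifford) algebra they generate over $\mathbb C$, with basis $Q^\alpha=Q_1^{\alpha_1}\cdots Q_n^{\alpha_n}$, $\alpha\in\{0,1\}^n$, and let $\tau=2^{-n}\operatorname{tr}$ be the normalized trace. Let $\Gamma,\nabla_i:\mathfrak C\to\mathfrak C$ be the linear maps with $\Gamma(Q^\alpha)=(-1)^{|\alpha|}Q^\alpha$, and $\nabla_i(Q^\alpha)=Q_iQ^\alpha$ if $\alpha_i=1$, $\nabla_i(Q^\alpha)=0$ if $\alpha_i=0$. Put $\nabla A=(\nabla_1A,\dots,\nabla_nA)$ and $\operatorname{div}\mathbf A=-\sum_i\nabla_i^*A_i$, where $\nabla_i^*$ is the adjoint of $\nabla_i$ for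 the inner product $\langle A,B\rangle=\tau(A^*B)$. Let $\mathfrak P$ be the set of non-negative $\rho\in\mathfrak C$ with $\tau(\rho)=1$, let $\mathfrak P_+$ be the set of strictly positive $\rho\in\mathfrak P$, let $\mathfrak C_0$ be the set of self-adjoint $A\in\mathfrak C$ with $\tau(A)=0$, and let $S(\rho)=\tau(\rho\log\rho)$ for $\rho\in\mathfrak P$ (with $0\log0=0$). For $\rho\in\mathfrak P_+$ put $$(\Gamma(\rho),\rho)\#C=\int_0^1\Gamma(\rho)^{1-s}C\rho^s\,ds,\qquad \langle\mathbf A,\mathbf B\rangle_\rho=\sum_{i=1}^n\tau\big(A_i^*\,(\Gamma(\rho),\rho)\#B_i\big),\qquad \|\mathbf A\|_\rho=\sqrt{\langle\mathbf A,\mathbf A\rangle_\rho}.$$ The set $\mathfrak P_+$ is an open subset of the affine space $I+\mathfrak C_0$. For $\rho\in\mathfrak P_+$, each tangent vector $v\in\mathfrak C_0$ is identified with the gradient $\nabla U$, where $U\in\mathfrak C_0$ is the unique solution of $v+\operatorname{div}\big((\Gamma(\rho),\rho)\#\nabla U\big)=0$, and the Riemannian metric is $g_\rho(v,v)=\|\nabla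 U\|_\rho^2$. Let $\operatorname{Hess}_\rho S$ be the Riemannian Hessian of $S$ at $\rho\in\mathfrak P_+$ with respect to $g$; thus $\operatorname{Hess}_\rho S(\nabla U,\nabla U)$ is its value at $(v,v)$ for the tangent vector $v$ identified with $\nabla U$. For $\rho_0,\rho_1\in\mathfrak P_+$ let $d(\rho_0,\rho_1)$ be the infimum of $\int_0^1\sqrt{g_{\rho(t)}(\dot\rho(t),\dot\rho(t))}\,dt$ over the curves $\rho:[0,1]\to\mathfrak P_+$ from $\rho_0$ to $\rho_1$ that are continuous on $[0,1]$ and smooth on $(0,1)$. Extend $d$ to $\mathfrak P$ by $d(\rho_0,\rho_1)=\lim_k d(\rho_0^k,\rho_1^k)$, for arbitrary sequences $\rho_0^k\to\rho_0$, $\rho_1^k\to\rho_1$ in $\mathfrak P_+$. **Proposition.** Let $\kappa\in\mathbb R$, and suppose that $\operatorname{Hess}_\rho S(\nabla U,\nabla U)\ge\kappa\|\nabla U\|_\rho^2$ for all $\rho\in\mathfrak P_+$ and all $U\in\mathfrak C_0$. Then for every constant speed geodesic $u:[0,1]\to\mathfrak P$, that is, every $u$ with $d(u(s),u(t))=|t-s|\,d(u(0),u(1))$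 for all $s,t\in[0,1]$, and for all $t\in[0,1]$, $$S(u(t))\le(1-t)S(u(0))+tS(u(1))-\frac\kappa2\,t(1-t)\,d(u(0),u(1))^2 .$$ -/

import Mathlib

open Set Filter Topology MeasureTheory
open scoped ContDiff Matrix

noncomputable section

namespace FermiClifford

/-! ## The Clifford algebra -/

/-- Operators on the `n`-fold tensor product of `ℂ²` with itself, whose standard basis is indexed
by `Fin n → Fin 2`. -/
abbrev Op (n : ℕ) : Type := Matrix (Fin n → Fin 2) (Fin n → Fin 2) ℂ

/-- The matrix `Q = [[0, 1], [1, 0]]`. -/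
def matQ : Matrix (Fin 2) (Fin 2) ℂ := !![0, 1; 1, 0]

/-- The matrix `U = [[1, 0], [0, -1]]`. -/
def matU : Matrix (Fin 2) (Fin 2) ℂ := !![1, 0; 0, -1]

/-- The tensor product `X₁ ⊗ ⋯ ⊗ Xₙ` of `2 × 2` matrices. -/
def tensor {n : ℕ} (X : Fin n → Matrix (Fin 2) (Fin 2) ℂ) : Op n :=
  Matrix.of fun x y => ∏ i, X i (x i) (y i)

/-- The generator `Q_j = U ⊗ ⋯ ⊗ U ⊗ Q ⊗ I ⊗ ⋯ ⊗ I`, with `Q` in the slot `j`. -/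
def gen {n : ℕ} (j : Fin n) : Op n :=
  tensor fun i => if i < j then matU else if i = j then matQ else 1

/-- The Clifford algebra: the algebra of operators generated by `Q₁, …, Qₙ`. -/
def Cl (n : ℕ) : Subalgebra ℂ (Op n) := Algebra.adjoin ℂ (Set.range (gen (n := n)))

/-- The monomial `Q^α = Q₁^α₁ ⋯ Qₙ^αₙ`. -/
def mono {n : ℕ} (α : Fin n → Fin 2) : Op n :=
  ((List.finRange n).map fun j => gen j ^ (α j : ℕ)).prod

/-- The normalized trace `τ(A) = 2⁻ⁿ tr A`. -/
def tau {n : ℕ} (A : Op n) : ℂ := ((2 : ℂ) ^ n)⁻¹ * A.trace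

/-- The grading operator `Γ`, implemented as the conjugation by the parity operator
`U ⊗ ⋯ ⊗ U`. By `grading_mono` below it is the linear map with `Γ(Q^α) = (-1)^|α| Q^α`. -/
def grading {n : ℕ} (A : Op n) : Op n :=
  tensor (fun _ => matU) * A * tensor (fun _ => matU)

/-- The partial derivative `∇ᵢ A = (Qᵢ A - Γ(A) Qᵢ) / 2`. By `pderiv_mono` below it is the linear
map with `∇ᵢ(Q^α) = Qᵢ Q^α` if `αᵢ = 1`, and `∇ᵢ(Q^α) = 0` if `αᵢ = 0`. -/
def pderiv {n : ℕ} (i : Fin n) (A : Op n) : Op n :=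
  (2⁻¹ : ℂ) • (gen i * A - grading A * gen i)

/-- The adjoint of `∇ᵢ` with respect to `⟨A, B⟩ = τ(A* B)`; see `tau_pderiv`. -/
def pderivAdj {n : ℕ} (i : Fin n) (A : Op n) : Op n :=
  (2⁻¹ : ℂ) • (gen i * A + grading A * gen i)

/-- The gradient `∇ A = (∇₁ A, …, ∇ₙ A)`. -/
def grad {n : ℕ} (A : Op n) : Fin n → Op n := fun i => pderiv i A

/-- The divergence `div 𝐀 = - ∑ᵢ ∇ᵢ* Aᵢ`. -/
def dive {n : ℕ} (V : Fin n → Op n) : Op n := -∑ i, pderivAdj i (V i)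

/-! ### The operators `Γ`, `∇ᵢ`, `∇ᵢ*` are the intended ones -/

theorem tensor_mul {n : ℕ} (X Y : Fin n → Matrix (Fin 2) (Fin 2) ℂ) :
    tensor X * tensor Y = tensor fun i => X i * Y i := by
  ext x y
  simp only [tensor, Matrix.mul_apply, Matrix.of_apply]
  rw [Finset.prod_univ_sum, Fintype.piFinset_univ]
  exact Finset.sum_congr rfl fun z _ => Finset.prod_mul_distrib.symm

theorem tensor_one {n : ℕ} : tensor (fun _ : Fin n => (1 : Matrix (Fin 2) (Fin 2) ℂ)) = 1 := by
  ext x y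
  simp only [tensor, Matrix.of_apply, Matrix.one_apply, Finset.prod_ite_zero, funext_iff]
  simp

theorem tensor_neg {n : ℕ} (X Y : Fin n → Matrix (Fin 2) (Fin 2) ℂ) (j : Fin n)
    (hj : Y j = -X j) (h : ∀ i, i ≠ j → Y i = X i) : tensor Y = -tensor X := by
  ext x y
  simp only [tensor, Matrix.of_apply, Matrix.neg_apply]
  rw [← Finset.mul_prod_erase _ _ (Finset.mem_univ j),
    ← Finset.mul_prod_erase _ (fun i => X i (x i) (y i)) (Finset.mem_univ j), hj,
    Matrix.neg_apply, neg_mul]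
  congr 2
  exact Finset.prod_congr rfl fun i hi => by rw [h i (Finset.ne_of_mem_erase hi)]

theorem matU_mul_matU : matU * matU = 1 := by
  ext i j; fin_cases i <;> fin_cases j <;> simp [matU]

theorem matQ_mul_matQ : matQ * matQ = 1 := by
  ext i j; fin_cases i <;> fin_cases j <;> simp [matQ]

theorem matU_mul_matQ : matU * matQ = -(matQ * matU) := by
  ext i j; fin_cases i <;> fin_cases j <;> simp [matU, matQ]

theorem gen_mul_self {n : ℕ} (j : Fin n) : gen j * gen j = 1 := by
  rw [gen, tensor_mul, ← tensor_one]
  congr 1; funext i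
  split_ifs <;> simp [matU_mul_matU, matQ_mul_matQ]

theorem gen_mul_gen_of_lt {n : ℕ} {i j : Fin n} (h : i < j) :
    gen i * gen j = -(gen j * gen i) := by
  rw [gen, gen, tensor_mul, tensor_mul]
  refine tensor_neg _ _ i ?_ ?_
  · simp [h, matU_mul_matQ]
  · intro k hk
    rcases lt_trichotomy k i with hki | hki | hki
    · simp [hki, hki.trans h]
    · exact absurd hki hk
    · simp [hki.not_gt, hk]

/-- The canonical anticommutation relations. -/
theorem gen_anticomm {n : ℕ} (i j : Fin n) :
    gen i * gen j + gen j * gen i = if i = j then 2 else 0 := by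
  rcases lt_trichotomy i j with h | h | h
  · rw [gen_mul_gen_of_lt h, if_neg h.ne]; simp
  · subst h; rw [gen_mul_self, if_pos rfl, one_add_one_eq_two]
  · rw [gen_mul_gen_of_lt h, if_neg h.ne']; simp

theorem grading_mul {n : ℕ} (A B : Op n) : grading (A * B) = grading A * grading B := by
  have h : tensor (fun _ : Fin n => matU) * tensor (fun _ => matU) = 1 := by
    rw [tensor_mul, matU_mul_matU, tensor_one]
  simp only [grading]
  calc _ = tensor (fun _ : Fin n => matU) * A * 1 * B * tensor (fun _ => matU) := by
        simp only [mul_one, mul_assoc]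
    _ = _ := by rw [← h]; simp only [mul_assoc]

theorem grading_gen {n : ℕ} (j : Fin n) : grading (gen j) = -gen j := by
  rw [grading, gen, tensor_mul, tensor_mul]
  refine tensor_neg _ _ j ?_ ?_
  · simp [matU_mul_matQ, mul_assoc, matU_mul_matU]
  · intro k hk
    by_cases h : k < j
    · simp [h, matU_mul_matU]
    · simp [h, hk, matU_mul_matU]

theorem grading_one {n : ℕ} : grading (1 : Op n) = 1 := by
  rw [grading, mul_one, tensor_mul, matU_mul_matU, tensor_one]

theorem grading_gen_pow {n : ℕ} (j : Fin n) (a : ℕ) :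
    grading (gen j ^ a) = (-1 : ℂ) ^ a • gen j ^ a := by
  induction a with
  | zero => simp [grading_one]
  | succ a ih =>
    rw [pow_succ, grading_mul, ih, grading_gen, pow_succ]
    simp

/-- `Γ(Q^α) = (-1)^|α| Q^α`. -/
theorem grading_mono {n : ℕ} (α : Fin n → Fin 2) :
    grading (mono α) = (-1 : ℂ) ^ (∑ j, (α j : ℕ)) • mono α := by
  have key : ∀ l : List (Fin n), grading (l.map fun j => gen j ^ (α j : ℕ)).prod =
      (l.map fun j => (-1 : ℂ) ^ (α j : ℕ)).prod • (l.map fun j => gen j ^ (α j : ℕ)).prod := by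
    intro l
    induction l with
    | nil => simp [grading_one]
    | cons j l ih =>
      simp only [List.map_cons, List.prod_cons, grading_mul, ih, grading_gen_pow,
        smul_mul_assoc, mul_smul_comm, smul_smul]
      rw [mul_comm]
  rw [mono, key, ← Finset.prod_pow_eq_pow_sum, Fin.prod_univ_def]

theorem grading_gen_pow_mul_gen {n : ℕ} (i j : Fin n) (a : ℕ) :
    grading (gen j ^ a) * gen i =
      (if j = i then (-1 : ℂ) ^ a else 1) • (gen i * gen j ^ a) := by
  split_ifs with h
  · subst h
    rw [grading_gen_pow, smul_mul_assoc, ← pow_succ, ← pow_succ']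
  · have hc : gen j * gen i = -(gen i * gen j) := by
      have := gen_anticomm j i
      rw [if_neg h] at this
      exact eq_neg_of_add_eq_zero_left this
    rw [one_smul]
    induction a with
    | zero => simp [grading_one]
    | succ a ih =>
      rw [pow_succ, grading_mul, grading_gen, mul_assoc, neg_mul, hc, neg_neg, ← mul_assoc, ih,
        mul_assoc]

/-- `∇ᵢ(Q^α) = Qᵢ Q^α` if `αᵢ = 1`, and `∇ᵢ(Q^α) = 0` if `αᵢ = 0`. -/
theorem pderiv_mono {n : ℕ} (i : Fin n) (α : Fin n → Fin 2) :
    pderiv i (mono α) = if α i = 1 then gen i * mono α else 0 := by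
  have key : ∀ l : List (Fin n), grading (l.map fun j => gen j ^ (α j : ℕ)).prod * gen i =
      (l.map fun j => if j = i then (-1 : ℂ) ^ (α j : ℕ) else 1).prod •
        (gen i * (l.map fun j => gen j ^ (α j : ℕ)).prod) := by
    intro l
    induction l with
    | nil => simp [grading_one]
    | cons j l ih =>
      simp only [List.map_cons, List.prod_cons, grading_mul]
      rw [mul_assoc, ih, mul_smul_comm, ← mul_assoc, grading_gen_pow_mul_gen, smul_mul_assoc,
        smul_smul, mul_assoc, mul_comm]
  have h : grading (mono α) * gen i = (-1 : ℂ) ^ (α i : ℕ) • (gen i * mono α) := by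
    rw [mono, key, ← Fin.prod_univ_def]
    simp
  rw [pderiv, h]
  have h01 : α i = 0 ∨ α i = 1 := by omega
  rcases h01 with h0 | h1
  · simp [h0]
  · rw [h1]
    simp only [Fin.val_one, pow_one, neg_smul, one_smul, sub_neg_eq_add, if_true]
    rw [← two_smul ℂ, smul_smul]
    norm_num

theorem conjTranspose_tensor {n : ℕ} (X : Fin n → Matrix (Fin 2) (Fin 2) ℂ)
    (h : ∀ i, (X i)ᴴ = X i) : (tensor X)ᴴ = tensor X := by
  ext x y
  simp only [tensor, Matrix.conjTranspose_apply, Matrix.of_apply, star_prod]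
  refine Finset.prod_congr rfl fun i _ => ?_
  rw [← Matrix.conjTranspose_apply, h i]

theorem conjTranspose_matU : matUᴴ = matU := by
  ext i j; fin_cases i <;> fin_cases j <;> simp [matU]

theorem conjTranspose_matQ : matQᴴ = matQ := by
  ext i j; fin_cases i <;> fin_cases j <;> simp [matQ]

theorem conjTranspose_gen {n : ℕ} (j : Fin n) : (gen j)ᴴ = gen j := by
  refine conjTranspose_tensor _ fun i => ?_
  split_ifs
  exacts [conjTranspose_matU, conjTranspose_matQ, Matrix.conjTranspose_one]

/-- `⟨∇ᵢ A, B⟩ = ⟨A, ∇ᵢ* B⟩` for the inner product `⟨A, B⟩ = τ(A* B)`. -/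
theorem tau_pderiv {n : ℕ} (i : Fin n) (A B : Op n) :
    tau ((pderiv i A)ᴴ * B) = tau (Aᴴ * pderivAdj i B) := by
  set P : Op n := tensor fun _ => matU with hP
  have hPP : P * P = 1 := by rw [hP, tensor_mul, matU_mul_matU, tensor_one]
  have hPs : Pᴴ = P := conjTranspose_tensor _ fun _ => conjTranspose_matU
  have hg : P * gen i * P = -gen i := grading_gen i
  have hgP : gen i * P = -(P * gen i) := by
    have h := congrArg (fun X => P * X) hg
    simp only [← mul_assoc, hPP, one_mul, mul_neg] at h
    exact h
  have e : (Aᴴ * (P * B * P * gen i)).trace = -(gen i * (P * (Aᴴ * P)) * B).trace := by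
    have : Aᴴ * (P * B * P * gen i) = -((Aᴴ * P * B) * (gen i * P)) := by
      rw [hgP]; simp only [mul_assoc, mul_neg, neg_neg]
    rw [this, Matrix.trace_neg, Matrix.trace_mul_comm]
    simp only [mul_assoc]
  simp only [tau, pderiv, pderivAdj, grading, ← hP, Matrix.conjTranspose_smul,
    Matrix.conjTranspose_sub, Matrix.conjTranspose_mul, conjTranspose_gen, hPs,
    smul_mul_assoc, mul_smul_comm, Matrix.trace_smul, sub_mul, mul_add, Matrix.trace_sub,
    Matrix.trace_add, e]
  simp [mul_assoc, sub_eq_add_neg, mul_add]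

/-! ## Densities, the weighted inner product and the entropy -/

/-- The set `𝔓` of probability densities: the `ρ = B* B` with `B` in the Clifford algebra and
`τ(ρ) = 1`. -/
def density (n : ℕ) : Set (Op n) :=
  {ρ | (∃ B ∈ Cl n, ρ = Bᴴ * B) ∧ tau ρ = 1}

/-- The set `𝔓₊` of strictly positive probability densities: the `ρ = B* B + c I` with `B` in the
Clifford algebra, `c > 0` and `τ(ρ) = 1`. -/
def densityPos (n : ℕ) : Set (Op n) :=
  {ρ | (∃ B ∈ Cl n, ∃ c : ℝ, 0 < c ∧ ρ = Bᴴ * B + (c : ℂ) • 1) ∧ tau ρ = 1}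

/-- The self-adjoint elements of the Clifford algebra with trace zero. -/
def Cl0 (n : ℕ) : Set (Op n) := {A | A ∈ Cl n ∧ Aᴴ = A ∧ tau A = 0}

/-- The power `A ^ s` of a strictly positive matrix, by functional calculus. -/
def power {n : ℕ} (A : Op n) (s : ℝ) : Op n := cfc (fun x : ℝ => x ^ s) A

/-- `(A, B) # C = ∫₀¹ A^(1-s) C B^s ds`, the integral being taken entrywise. -/
def sharp {n : ℕ} (A B C : Op n) : Op n :=
  Matrix.of fun x y => ∫ s in (0 : ℝ)..1, (power A (1 - s) * C * power B s) x y

/-- `(Γ(ρ), ρ) # 𝐕`, componentwise. -/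
def weight {n : ℕ} (ρ : Op n) (V : Fin n → Op n) : Fin n → Op n :=
  fun i => sharp (grading ρ) ρ (V i)

/-- `⟨𝐀, 𝐁⟩_ρ = ∑ᵢ τ(Aᵢ* (Γ(ρ), ρ) # Bᵢ)`. -/
def innerRho {n : ℕ} (ρ : Op n) (A B : Fin n → Op n) : ℂ :=
  ∑ i, tau ((A i)ᴴ * weight ρ B i)

/-- `‖𝐀‖_ρ`, the norm of the inner product `⟨·, ·⟩_ρ`. -/
def normRho {n : ℕ} (ρ : Op n) (A : Fin n → Op n) : ℝ := √(innerRho ρ A A).re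

/-- The relative entropy `S(ρ) = τ(ρ log ρ)`, with `0 log 0 = 0`. -/
def entropy {n : ℕ} (ρ : Op n) : ℝ := (tau (cfc (fun x : ℝ => x * Real.log x) ρ)).re

/-! ## The Riemannian metric on the strictly positive densities and its distance

The manifold `𝔓₊` is an open subset of the affine space `I + Cl0 n`, so that all its tangent spaces
are `Cl0 n`. -/

/-- The velocity `ρ' = - div((Γ(ρ), ρ) # ∇U)` that the continuity equation assigns to the
gradient `∇U` at `ρ`. -/
def velocity {n : ℕ} (ρ U : Op n) : Op n := -dive (weight ρ (grad U))

/-- The potential of a tangent vector `v` at `ρ`: the (for `ρ` in `𝔓₊` and `v` in `Cl0 n` unique)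
`U` in `Cl0 n` with `v + div((Γ(ρ), ρ) # ∇U) = 0`. -/
def potential {n : ℕ} (ρ v : Op n) : Op n :=
  Classical.epsilon fun U => U ∈ Cl0 n ∧ v + dive (weight ρ (grad U)) = 0

/-- The Riemannian metric `g_ρ(v, w) = ⟨∇U, ∇W⟩_ρ`, where `U` and `W` are the potentials of the
tangent vectors `v` and `w`. -/
def metric {n : ℕ} (ρ v w : Op n) : ℝ :=
  (innerRho ρ (grad (potential ρ v)) (grad (potential ρ w))).re

/-- The derivative of a curve of matrices, entrywise. -/
def curveDeriv {n : ℕ} (γ : ℝ → Op n) (t : ℝ) : Op n :=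
  Matrix.of fun x y => deriv (fun r => γ r x y) t

/-- The curves `[0, 1] → 𝔓₊` from `ρ₀` to `ρ₁`, continuous on `[0, 1]` and smooth on `(0, 1)`. -/
def couplings {n : ℕ} (ρ₀ ρ₁ : Op n) : Set (ℝ → Op n) :=
  {γ | (∀ t ∈ Icc (0 : ℝ) 1, γ t ∈ densityPos n) ∧ ContinuousOn γ (Icc 0 1) ∧
    (∀ x y, ContDiffOn ℝ ∞ (fun t => γ t x y) (Ioo 0 1)) ∧ γ 0 = ρ₀ ∧ γ 1 = ρ₁}

/-- The arclength `∫₀¹ √(g_γ(γ', γ')) dt`, which may be infinite. -/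
def arclength {n : ℕ} (γ : ℝ → Op n) : ENNReal :=
  ∫⁻ t in Ioo (0 : ℝ) 1, ENNReal.ofReal √(metric (γ t) (curveDeriv γ t) (curveDeriv γ t))

/-- The Riemannian distance on `𝔓₊`. -/
def distPos {n : ℕ} (ρ₀ ρ₁ : Op n) : ℝ :=
  (⨅ γ ∈ couplings ρ₀ ρ₁, arclength γ).toReal

/-- The distance on `𝔓`: the limit of the Riemannian distances of strictly positive densities that
converge to `ρ₀` and to `ρ₁`. -/
def distance {n : ℕ} (ρ₀ ρ₁ : Op n) : ℝ :=
  extendFrom (densityPos n ×ˢ densityPos n) (fun p => distPos p.1 p.2) (ρ₀, ρ₁)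

/-! ## The Riemannian Hessian -/

/-- The Christoffel symbol `Γ_ρ(v, v)` of the Levi-Civita connection of `g` in the affine chart: the
(for `ρ` in `𝔓₊` unique) `a` in `Cl0 n` with
`g_ρ(a, w) = ∂_v g(v, w) - ½ ∂_w g(v, v)` for all constant vector fields `w`. -/
def christoffel {n : ℕ} (ρ v : Op n) : Op n :=
  Classical.epsilon fun a => a ∈ Cl0 n ∧ ∀ w ∈ Cl0 n,
    metric ρ a w = deriv (fun t : ℝ => metric (ρ + (t : ℂ) • v) v w) 0 -
      deriv (fun t : ℝ => metric (ρ + (t : ℂ) • w) v v) 0 / 2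

/-- The Riemannian Hessian at `ρ` of a function `F` on `𝔓₊`, evaluated at `(v, v)`:
`D²F(ρ)[v, v] - DF(ρ)[Γ_ρ(v, v)]` in the affine chart. -/
def hessian {n : ℕ} (F : Op n → ℝ) (ρ v : Op n) : ℝ :=
  iteratedDeriv 2 (fun t : ℝ => F (ρ + (t : ℂ) • v)) 0 -
    deriv (fun t : ℝ => F (ρ + (t : ℂ) • christoffel ρ v)) 0

/-- `Hess_ρ S(∇U, ∇U)`, where the gradient `∇U` is identified with the tangent vector
`- div((Γ(ρ), ρ) # ∇U)`. -/
def hessEntropy {n : ℕ} (ρ U : Op n) : ℝ := hessian entropy ρ (velocity ρ U)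

/-- Constant speed geodesics `[0, 1] → 𝔓` of the metric space `(𝔓, d)`. -/
def IsGeodesic {n : ℕ} (u : ℝ → Op n) : Prop :=
  (∀ t ∈ Icc (0 : ℝ) 1, u t ∈ density n) ∧
    ∀ s ∈ Icc (0 : ℝ) 1, ∀ t ∈ Icc (0 : ℝ) 1,
      distance (u s) (u t) = |t - s| * distance (u 0) (u 1)

end FermiClifford

end

/-! A geodesic of `𝔓` may run in the boundary, where the metric tensor is not defined, so the
Hessian bound cannot be integrated along it. The proof uses instead that `S` has a linear gradient
flow, the semigroup `exp (-tN)` with `N = ∑ᵢ ∇ᵢ* ∇ᵢ`, and argues as Daneri and Savaré do (Eulerian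
calculus).

The gradient flow structure is the chain rule `(Γ(ρ), ρ) # ∇ᵢ log ρ = ∇ᵢ ρ`, an instance of
Duhamel's formula (`NormedSpace.expMean_mul_sub_mul`, `metricOp_logPotential`). It gives `DS(ρ) =
g_ρ(Nρ, ·)`, and then the Christoffel terms cancel in part: the Hessian of `S` is `g(Nv, v) + ½
D_{Nρ} g(v, v)` (`hessian_entropy`). This is minus half the rate of change of `g(v, v)` when point
and vector are both moved by the flow.

Take a nearly shortest curve `γ` from `y` to `x` in the interior and move `γ(s)` by the flow for the
time `T η(s)`, where `η` increases from 0 to 1. The curve then ends at `exp (-TN) x`. The Hessian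
bound controls its action by that of `γ` and by the difference of the entropies of the endpoints.
The result is a discrete evolution variational inequality, `sq_rdist_flow_le`: with `x_T = exp (-TN)
x`, `d(y, x_T)² ≤ (d(y, x)² + 2T (S(y) - S(x_T)) + O(T²)) (1 - κT + O(T²))`.

Each term of this inequality is continuous up to the boundary. For the distance, the tensor at `ρ ≥
ε` is at most `C / ε`, which is integrable after the square root, so `d` is Hölder continuous of
exponent `1/2` (`rdist_le_sqrt`). The flow preserves lower bounds of densities, because `1 - (2/n)
N` averages the maps `A ↦ Qᵢ Γ(A) Qᵢ`.

For a geodesic `u`, the inequality is applied with `x = u(t)` and with `y` each of the two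
endpoints. The weighted sum of the two, the triangle inequality, division by `T` and `T → 0` give
the convexity estimate. -/

namespace LocalMetric

/-! ### The Riemannian distance of a metric tensor on a convex set. -/

variable {E : Type*} [NormedAddCommGroup E] [NormedSpace ℝ E]

/-- The speed of a curve with respect to the metric tensor `g`. -/
noncomputable def speed (g : E → E →L[ℝ] E →L[ℝ] ℝ) (γ : ℝ → E) (t : ℝ) : ℝ :=
  √(g (γ t) (deriv γ t) (deriv γ t))

/-- Smooth curves in `M` that are constant equal to `x` before time `0` and constant equal to `y`
after time `1`. -/
structure FlatCurve (M : Set E) (x y : E) (γ : ℝ → E) : Prop where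
  smooth : ContDiff ℝ ∞ γ
  mem : ∀ t, γ t ∈ M
  left : ∀ t ≤ 0, γ t = x
  right : ∀ t, 1 ≤ t → γ t = y

/-- The Riemannian distance of the metric tensor `g` on `M`, defined by flat curves. -/
noncomputable def rdist (g : E → E →L[ℝ] E →L[ℝ] ℝ) (M : Set E) (x y : E) : ℝ :=
  sInf ((fun γ => ∫ t in (0 : ℝ)..1, speed g γ t) '' {γ | FlatCurve M x y γ})

variable {g : E → E →L[ℝ] E →L[ℝ] ℝ} {M : Set E}

theorem speed_nonneg (γ : ℝ → E) (t : ℝ) : 0 ≤ speed g γ t := Real.sqrt_nonneg _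

theorem length_nonneg (γ : ℝ → E) {a b : ℝ} (hab : a ≤ b) : 0 ≤ ∫ t in a..b, speed g γ t :=
  intervalIntegral.integral_nonneg hab fun _ _ => speed_nonneg _ _

theorem rdist_nonneg (x y : E) : 0 ≤ rdist g M x y := by
  refine Real.sInf_nonneg ?_
  rintro _ ⟨γ, _, rfl⟩
  exact length_nonneg γ zero_le_one

theorem FlatCurve.rdist_le {x y : E} {γ : ℝ → E} (h : FlatCurve M x y γ) :
    rdist g M x y ≤ ∫ t in (0 : ℝ)..1, speed g γ t := by
  refine csInf_le ⟨0, ?_⟩ ⟨γ, h, rfl⟩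
  rintro _ ⟨γ, _, rfl⟩
  exact length_nonneg γ zero_le_one

/-- Convexity makes the set of flat curves nonempty, so that the `sInf` in `rdist` is a true infimum
and not the default value 0. -/
theorem flatCurve_segment (hM : Convex ℝ M) {x y : E} (hx : x ∈ M) (hy : y ∈ M) :
    FlatCurve M x y fun t => x + Real.smoothTransition t • (y - x) where
  smooth := contDiff_const.add (Real.smoothTransition.contDiff.smul contDiff_const)
  mem t := hM.add_smul_sub_mem hx hy
    ⟨Real.smoothTransition.nonneg t, Real.smoothTransition.le_one t⟩
  left t ht := by simp [Real.smoothTransition.zero_of_nonpos ht]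
  right t ht := by simp [Real.smoothTransition.one_of_one_le ht]

theorem exists_flatCurve_lt (hM : Convex ℝ M) {x y : E} (hx : x ∈ M) (hy : y ∈ M) {L : ℝ}
    (hL : rdist g M x y < L) :
    ∃ γ, FlatCurve M x y γ ∧ ∫ t in (0 : ℝ)..1, speed g γ t < L := by
  obtain ⟨_, ⟨γ, hγ, rfl⟩, h⟩ :=
    exists_lt_of_csInf_lt (Set.Nonempty.image _ ⟨_, flatCurve_segment hM hx hy⟩) hL
  exact ⟨γ, hγ, h⟩

theorem continuousOn_speed (hg : ContinuousOn g M) {γ : ℝ → E} {U : Set ℝ} (hU : IsOpen U)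
    (hγ : ContDiffOn ℝ ∞ γ U) {s : Set ℝ} (hs : s ⊆ U) (hsM : ∀ t ∈ s, γ t ∈ M) :
    ContinuousOn (speed g γ) s := by
  have h1 : ContinuousOn (deriv γ) s :=
    (hγ.continuousOn_deriv_of_isOpen hU (by norm_num)).mono hs
  have h2 : ContinuousOn (fun t => g (γ t)) s := hg.comp (hγ.continuousOn.mono hs) hsM
  exact ((h2.clm_apply h1).clm_apply h1).sqrt

theorem FlatCurve.continuous_speed (hg : ContinuousOn g M) {x y : E} {γ : ℝ → E}
    (h : FlatCurve M x y γ) : Continuous (speed g γ) :=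
  continuousOn_univ.1 <| continuousOn_speed hg isOpen_univ h.smooth.contDiffOn subset_rfl
    fun t _ => h.mem t

/-- A curve that is smooth in a neighbourhood of `[a, b]` is not shorter than the distance of its
endpoints. -/
theorem rdist_le_integral_speed (hg : ContinuousOn g M) {γ : ℝ → E} {U : Set ℝ} (hU : IsOpen U)
    (hγ : ContDiffOn ℝ ∞ γ U) {a b : ℝ} (hab : a ≤ b) (hs : Icc a b ⊆ U)
    (hsM : ∀ t ∈ Icc a b, γ t ∈ M) :
    rdist g M (γ a) (γ b) ≤ ∫ t in a..b, speed g γ t := by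
  -- Reparametrizing by a smooth monotone step makes the curve flat at both ends. It never leaves
  -- `[a, b]`, and its length is unchanged by substitution, since `φ' ≥ 0`.
  set φ : ℝ → ℝ := fun t => a + (b - a) * Real.smoothTransition t with hφ
  have hφs : ContDiff ℝ ∞ φ :=
    contDiff_const.add (contDiff_const.mul Real.smoothTransition.contDiff)
  have hφm : ∀ t, φ t ∈ Icc a b := fun t => by
    have h0 := Real.smoothTransition.nonneg t
    have h1 := Real.smoothTransition.le_one t
    constructor <;> simp only [hφ] <;> nlinarith
  have hφ0 : ∀ t ≤ 0, φ t = a := fun t ht => by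
    simp [hφ, Real.smoothTransition.zero_of_nonpos ht]
  have hφ1 : ∀ t, 1 ≤ t → φ t = b := fun t ht => by
    simp [hφ, Real.smoothTransition.one_of_one_le ht]
  have hmono : Monotone φ := fun s t hst => by
    have := Real.smoothTransition.monotone hst
    simp only [hφ]
    nlinarith
  have hflat : FlatCurve M (γ a) (γ b) (γ ∘ φ) :=
    { smooth := contDiffOn_univ.1 <|
        hγ.comp hφs.contDiffOn fun t _ => hs (hφm t)
      mem := fun t => hsM _ (hφm t)
      left := fun t ht => by simp [hφ0 t ht]
      right := fun t ht => by simp [hφ1 t ht] }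
  refine hflat.rdist_le.trans (le_of_eq ?_)
  have hφd : ∀ t, HasDerivAt φ (deriv φ t) t := fun t =>
    (hφs.differentiable (by norm_num) t).hasDerivAt
  have hsp : ∀ t, speed g (γ ∘ φ) t = (speed g γ ∘ φ) t * deriv φ t := fun t => by
    have hd : HasDerivAt γ (deriv γ (φ t)) (φ t) :=
      ((hγ.differentiableOn (by norm_num)).differentiableAt
        (hU.mem_nhds (hs (hφm t)))).hasDerivAt
    have h0 : 0 ≤ deriv φ t := hmono.deriv_nonneg
    simp only [speed, Function.comp_apply]
    rw [(hd.scomp t (hφd t)).deriv]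
    simp only [map_smul, _root_.smul_apply, smul_eq_mul]
    rw [← mul_assoc, mul_comm, Real.sqrt_mul' _ (mul_nonneg h0 h0), Real.sqrt_mul_self h0]
  simp_rw [hsp]
  have := intervalIntegral.integral_comp_mul_deriv'' (f := φ) (f' := deriv φ) (g := speed g γ)
    (a := 0) (b := 1) hφs.continuous.continuousOn (fun x _ => (hφd x).hasDerivWithinAt)
    (hφs.continuous_deriv (by norm_num)).continuousOn
    ((continuousOn_speed hg hU hγ hs hsM).mono (by rintro _ ⟨t, _, rfl⟩; exact hφm t))
  rw [this, hφ0 0 le_rfl, hφ1 1 le_rfl]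

theorem rdist_self (hg : ContinuousOn g M) {x : E} (hx : x ∈ M) : rdist g M x x = 0 := by
  refine le_antisymm ?_ (rdist_nonneg _ _)
  simpa using rdist_le_integral_speed hg isOpen_univ (γ := fun _ => x) (a := 0) (b := 0)
    contDiffOn_const le_rfl (subset_univ _) fun _ _ => hx

theorem FlatCurve.symm {x y : E} {γ : ℝ → E} (h : FlatCurve M x y γ) :
    FlatCurve M y x fun t => γ (1 - t) where
  smooth := h.smooth.comp (contDiff_const.sub contDiff_id)
  mem t := h.mem _
  left t ht := h.right _ (by linarith)
  right t ht := h.left _ (by linarith)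

theorem rdist_symm_le (hM : Convex ℝ M) {x y : E} (hx : x ∈ M) (hy : y ∈ M) :
    rdist g M y x ≤ rdist g M x y := by
  refine le_of_forall_gt fun L hL => ?_
  obtain ⟨γ, hγ, h⟩ := exists_flatCurve_lt hM hx hy hL
  refine lt_of_le_of_lt (le_trans hγ.symm.rdist_le (le_of_eq ?_)) h
  have : ∀ t, speed g (fun t => γ (1 - t)) t = speed g γ (1 - t) := fun t => by
    have hd : HasDerivAt γ (deriv γ (1 - t)) (1 - t) :=
      (hγ.smooth.differentiable (by norm_num) _).hasDerivAt
    have := hd.scomp t ((hasDerivAt_id t).const_sub 1)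
    simp only [speed]
    have h2 : deriv (fun t => γ (1 - t)) t = -deriv γ (1 - t) := by
      simpa [Function.comp_def] using this.deriv
    rw [h2]
    simp
  simp_rw [this]
  simp

theorem rdist_comm (hM : Convex ℝ M) {x y : E} (hx : x ∈ M) (hy : y ∈ M) :
    rdist g M x y = rdist g M y x :=
  le_antisymm (rdist_symm_le hM hy hx) (rdist_symm_le hM hx hy)

theorem speed_comp_affine {γ : ℝ → E} (h : Differentiable ℝ γ) {c : ℝ} (hc : 0 ≤ c) (d t : ℝ) :
    speed g (fun t => γ (c * t + d)) t = c * speed g γ (c * t + d) := by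
  have hd : HasDerivAt γ (deriv γ (c * t + d)) (c * t + d) := (h _).hasDerivAt
  have := hd.scomp t (((hasDerivAt_id t).const_mul c).add_const d)
  simp only [speed]
  have h2 : deriv (fun t => γ (c * t + d)) t = c • deriv γ (c * t + d) := by
    simpa [Function.comp_def] using this.deriv
  rw [h2]
  simp only [map_smul, _root_.smul_apply, smul_eq_mul]
  rw [← mul_assoc, mul_comm, Real.sqrt_mul' _ (mul_nonneg hc hc), Real.sqrt_mul_self hc, mul_comm]

/-- At each time one of the two pieces rests at `y`, so the concatenation is a sum of smooth curves
and needs no gluing. This is why flat curves are used. -/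
theorem FlatCurve.trans {x y z : E} {γ₁ γ₂ : ℝ → E} (h₁ : FlatCurve M x y γ₁)
    (h₂ : FlatCurve M y z γ₂) :
    FlatCurve M x z (fun t => γ₁ (2 * t + 0) + (γ₂ (2 * t + -1) - y)) where
  smooth := (h₁.smooth.comp (by fun_prop)).add ((h₂.smooth.comp (by fun_prop)).sub contDiff_const)
  mem t := by
    rcases le_total t (1 / 2) with ht | ht
    · rw [h₂.left _ (by linarith)]; simpa using h₁.mem _
    · rw [h₁.right _ (by linarith)]; simpa using h₂.mem _
  left t ht := by rw [h₁.left _ (by linarith), h₂.left _ (by linarith)]; simp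
  right t ht := by rw [h₁.right _ (by linarith), h₂.right _ (by linarith)]; simp

theorem FlatCurve.length_trans (hg : ContinuousOn g M) {x y z : E} {γ₁ γ₂ : ℝ → E}
    (h₁ : FlatCurve M x y γ₁) (h₂ : FlatCurve M y z γ₂) :
    ∫ t in (0 : ℝ)..1, speed g (fun t => γ₁ (2 * t + 0) + (γ₂ (2 * t + -1) - y)) t =
      (∫ t in (0 : ℝ)..1, speed g γ₁ t) + ∫ t in (0 : ℝ)..1, speed g γ₂ t := by
  set c : ℝ → E := fun t => γ₁ (2 * t + 0) + (γ₂ (2 * t + -1) - y)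
  have hc := (h₁.trans h₂).continuous_speed hg
  rw [← intervalIntegral.integral_add_adjacent_intervals (b := 1 / 2)
    (hc.intervalIntegrable _ _) (hc.intervalIntegrable _ _)]
  have e1 : ∫ t in (0 : ℝ)..(1 / 2), speed g c t =
      ∫ t in (0 : ℝ)..(1 / 2), 2 * speed g γ₁ (2 * t + 0) := by
    refine intervalIntegral.integral_congr_ae ?_
    have : ∀ᵐ t : ℝ, t ≠ 1 / 2 := by simp [ae_iff]
    filter_upwards [this] with t ht0 ht
    rw [uIoc_of_le (by norm_num)] at ht
    have htl : t < 1 / 2 := lt_of_le_of_ne ht.2 ht0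
    rw [← speed_comp_affine (h₁.smooth.differentiable (by norm_num)) zero_le_two]
    have : c =ᶠ[𝓝 t] fun t => γ₁ (2 * t + 0) := by
      filter_upwards [Iio_mem_nhds htl] with s hs
      have : s < 1 / 2 := hs
      simp only [c]
      rw [h₂.left _ (by linarith)]; simp
    simp only [speed, this.deriv_eq, this.eq_of_nhds]
  have e2 : ∫ t in (1 / 2 : ℝ)..1, speed g c t =
      ∫ t in (1 / 2 : ℝ)..1, 2 * speed g γ₂ (2 * t + -1) := by
    refine intervalIntegral.integral_congr_ae ?_
    refine Eventually.of_forall fun t ht => ?_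
    rw [uIoc_of_le (by norm_num)] at ht
    rw [← speed_comp_affine (h₂.smooth.differentiable (by norm_num)) zero_le_two]
    have : c =ᶠ[𝓝 t] fun t => γ₂ (2 * t + -1) := by
      filter_upwards [Ioi_mem_nhds ht.1] with s hs
      have : 1 / 2 < s := hs
      simp only [c]
      rw [h₁.right _ (by linarith)]; simp
    simp only [speed, this.deriv_eq, this.eq_of_nhds]
  rw [e1, e2, intervalIntegral.integral_const_mul, intervalIntegral.integral_const_mul,
    intervalIntegral.integral_comp_mul_add _ two_ne_zero,
    intervalIntegral.integral_comp_mul_add _ two_ne_zero]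
  norm_num
  ring

theorem rdist_triangle (hg : ContinuousOn g M) (hM : Convex ℝ M) {x y z : E} (hx : x ∈ M)
    (hy : y ∈ M) (hz : z ∈ M) : rdist g M x z ≤ rdist g M x y + rdist g M y z := by
  refine le_of_forall_pos_le_add fun ε hε => ?_
  obtain ⟨γ₁, h₁, hl₁⟩ := exists_flatCurve_lt (g := g) hM hx hy
    (lt_add_of_pos_right _ (half_pos hε))
  obtain ⟨γ₂, h₂, hl₂⟩ := exists_flatCurve_lt (g := g) hM hy hz
    (lt_add_of_pos_right _ (half_pos hε))
  have := (h₁.trans h₂).rdist_le (g := g)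
  rw [h₁.length_trans hg h₂] at this
  linarith

/-- The curve `t ↦ (1 - t) • x` has speed at most `√(C / t) ‖x‖`, and `∫₀^ε t^(-1/2) dt = 2 √ε`. -/
theorem rdist_smul_le (hg : ContinuousOn g M) (hM : Convex ℝ M) (h0 : (0 : E) ∈ M) {C R : ℝ}
    (hC : 0 ≤ C) (hgC : ∀ x ∈ M, ∀ v, ∀ ε ∈ Ioc (0 : ℝ) 1, g ((1 - ε) • x) v v ≤ C / ε * ‖v‖ ^ 2)
    (hR : ∀ x ∈ M, ‖x‖ ≤ R) {x : E} (hx : x ∈ M) {ε : ℝ} (hε : ε ∈ Ioo (0 : ℝ) 1) :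
    rdist g M x ((1 - ε) • x) ≤ 2 * √(C * ε) * R := by
  have hmem : ∀ t ∈ Icc 0 ε, (1 - t) • x ∈ M := fun t ht =>
    hM.smul_mem_of_zero_mem h0 hx ⟨by linarith [ht.2, hε.2], by linarith [ht.1]⟩
  have hγ : ContDiff ℝ ∞ fun t : ℝ => (1 - t) • x := by fun_prop
  have h := rdist_le_integral_speed hg isOpen_univ hγ.contDiffOn hε.1.le (subset_univ _) hmem
  simp only [sub_zero, one_smul] at h
  refine h.trans ?_
  have hd : ∀ t, deriv (fun t : ℝ => (1 - t) • x) t = -x := fun t => by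
    have : HasDerivAt (fun t : ℝ => (1 - t) • x) ((-1 : ℝ) • x) t :=
      ((hasDerivAt_id t).const_sub 1).smul_const x
    rw [this.deriv, neg_one_smul]
  have hle : ∀ t ∈ Ioo 0 ε, speed g (fun t : ℝ => (1 - t) • x) t ≤
      (√C * ‖x‖) * t ^ (-(1 / 2) : ℝ) := fun t ht => by
    simp only [speed, hd]
    refine Real.sqrt_le_iff.2 ⟨by have := ht.1; positivity, ?_⟩
    refine (hgC x hx _ t ⟨ht.1, ht.2.le.trans hε.2.le⟩).trans (le_of_eq ?_)
    rw [mul_pow, mul_pow, Real.sq_sqrt hC, norm_neg, ← Real.rpow_natCast (t ^ _),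
      ← Real.rpow_mul ht.1.le]
    norm_num
    rw [Real.rpow_neg_one]
    ring
  have hint : IntervalIntegrable (fun t : ℝ => (√C * ‖x‖) * t ^ (-(1 / 2) : ℝ)) volume 0 ε :=
    (intervalIntegral.intervalIntegrable_rpow' (by norm_num)).const_mul _
  calc ∫ t in (0 : ℝ)..ε, speed g (fun t : ℝ => (1 - t) • x) t
      ≤ ∫ t in (0 : ℝ)..ε, (√C * ‖x‖) * t ^ (-(1 / 2) : ℝ) := by
        refine intervalIntegral.integral_mono_on_of_le_Ioo hε.1.le ?_ hint hle
        refine ContinuousOn.intervalIntegrable ?_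
        rw [uIcc_of_le hε.1.le]
        exact continuousOn_speed hg isOpen_univ hγ.contDiffOn (subset_univ _) hmem
    _ = 2 * √(C * ε) * ‖x‖ := by
        rw [intervalIntegral.integral_const_mul, integral_rpow (Or.inl (by norm_num)),
          Real.sqrt_mul hC, Real.sqrt_eq_rpow ε]
        norm_num
        ring
    _ ≤ 2 * √(C * ε) * R := by gcongr; exact hR x hx

/-- Along the shrunk segment the tensor is at most `C / ε`. -/
theorem rdist_le_smul (hg : ContinuousOn g M) (hM : Convex ℝ M) (h0 : (0 : E) ∈ M) {C : ℝ}
    (hC : 0 ≤ C) (hgC : ∀ x ∈ M, ∀ v, ∀ ε ∈ Ioc (0 : ℝ) 1, g ((1 - ε) • x) v v ≤ C / ε * ‖v‖ ^ 2)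
    {x y : E} (hx : x ∈ M) (hy : y ∈ M) {ε : ℝ} (hε : ε ∈ Ioo (0 : ℝ) 1) :
    rdist g M ((1 - ε) • x) ((1 - ε) • y) ≤ √(C / ε) * ‖x - y‖ := by
  have hmem : ∀ t ∈ Icc (0 : ℝ) 1, x + t • (y - x) ∈ M := fun t ht => hM.add_smul_sub_mem hx hy ht
  have hε' : 0 ≤ 1 - ε := by linarith [hε.2]
  have hmem' : ∀ t ∈ Icc (0 : ℝ) 1, (1 - ε) • (x + t • (y - x)) ∈ M := fun t ht =>
    hM.smul_mem_of_zero_mem h0 (hmem t ht) ⟨hε', by linarith [hε.1]⟩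
  have hγ : ContDiff ℝ ∞ fun t : ℝ => (1 - ε) • (x + t • (y - x)) := by fun_prop
  have h := rdist_le_integral_speed hg isOpen_univ hγ.contDiffOn zero_le_one (subset_univ _) hmem'
  simp only [zero_smul, add_zero, one_smul, add_sub_cancel] at h
  refine h.trans ?_
  have hd : ∀ t, deriv (fun t : ℝ => (1 - ε) • (x + t • (y - x))) t = (1 - ε) • (y - x) := by
    intro t
    have : HasDerivAt (fun t : ℝ => (1 - ε) • (x + t • (y - x)))
        ((1 - ε) • ((1 : ℝ) • (y - x))) t :=
      (((hasDerivAt_id t).smul_const (y - x)).const_add x).const_smul (1 - ε)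
    rw [this.deriv, one_smul]
  have hle : ∀ t ∈ Icc (0 : ℝ) 1, speed g (fun t : ℝ => (1 - ε) • (x + t • (y - x))) t ≤
      √(C / ε) * ‖x - y‖ := fun t ht => by
    have hCε : 0 ≤ C / ε := div_nonneg hC hε.1.le
    simp only [speed, hd]
    refine Real.sqrt_le_iff.2 ⟨by positivity, ?_⟩
    refine (hgC _ (hmem t ht) _ ε ⟨hε.1, hε.2.le⟩).trans ?_
    rw [mul_pow, Real.sq_sqrt hCε, norm_smul, Real.norm_of_nonneg hε', norm_sub_rev y x]
    refine mul_le_mul_of_nonneg_left (pow_le_pow_left₀ (by positivity) ?_ 2) hCε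
    exact mul_le_of_le_one_left (norm_nonneg _) (by linarith [hε.1])
  refine (intervalIntegral.integral_mono_on zero_le_one ?_ (by simp) hle).trans (by simp)
  refine ContinuousOn.intervalIntegrable ?_
  rw [uIcc_of_le zero_le_one]
  exact continuousOn_speed hg isOpen_univ hγ.contDiffOn (subset_univ _) hmem'

/-- The Riemannian distance is Hölder continuous with exponent `1/2` if the metric tensor blows up
at most like the inverse of the distance to the boundary. -/
theorem rdist_le_sqrt (hg : ContinuousOn g M) (hM : Convex ℝ M) (h0 : (0 : E) ∈ M) {C R : ℝ}
    (hC : 0 ≤ C) (hgC : ∀ x ∈ M, ∀ v, ∀ ε ∈ Ioc (0 : ℝ) 1, g ((1 - ε) • x) v v ≤ C / ε * ‖v‖ ^ 2)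
    (hR : ∀ x ∈ M, ‖x‖ ≤ R) {x y : E} (hx : x ∈ M) (hy : y ∈ M) (hxy : ‖x - y‖ < 1) :
    rdist g M x y ≤ (4 * R + 1) * √C * √‖x - y‖ := by
  rcases eq_or_ne x y with rfl | hne
  · rw [rdist_self hg hx]; simp
  -- This choice balances the costs: moving both points inwards costs order `√ε` each, and crossing
  -- between them costs `√(C / ε) * ε`.
  set ε := ‖x - y‖ with hεd
  have hε : ε ∈ Ioo (0 : ℝ) 1 := ⟨norm_pos_iff.2 (sub_ne_zero.2 hne), hxy⟩
  have hm : ∀ z ∈ M, (1 - ε) • z ∈ M := fun z hz =>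
    hM.smul_mem_of_zero_mem h0 hz ⟨by linarith [hε.2], by linarith [hε.1]⟩
  have t1 := rdist_triangle hg hM hx (hm x hx) hy
  have t2 := rdist_triangle hg hM (hm x hx) (hm y hy) hy
  have b1 := rdist_smul_le hg hM h0 hC hgC hR hx hε
  have b2 := rdist_smul_le hg hM h0 hC hgC hR hy hε
  rw [rdist_comm hM hy (hm y hy)] at b2
  have b3 := rdist_le_smul hg hM h0 hC hgC hx hy hε
  rw [← hεd, Real.sqrt_div hC, div_mul_eq_mul_div, mul_div_assoc, Real.div_sqrt] at b3
  rw [Real.sqrt_mul hC] at b1 b2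
  linarith

theorem rdist_sub_le (hg : ContinuousOn g M) (hM : Convex ℝ M) {x y x' y' : E} (hx : x ∈ M)
    (hy : y ∈ M) (hx' : x' ∈ M) (hy' : y' ∈ M) :
    |rdist g M x y - rdist g M x' y'| ≤ rdist g M x x' + rdist g M y y' := by
  have h1 := rdist_triangle hg hM hx hx' hy
  have h2 := rdist_triangle hg hM hx' hy' hy
  have h3 := rdist_triangle hg hM hx' hx hy'
  have h4 := rdist_triangle hg hM hx hy hy'
  rw [rdist_comm hM hy' hy] at h2
  rw [rdist_comm hM hx' hx] at h3
  rw [abs_le]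
  constructor <;> linarith

theorem uniformContinuousOn_rdist (hg : ContinuousOn g M) (hM : Convex ℝ M) (h0 : (0 : E) ∈ M)
    {C R : ℝ} (hC : 0 ≤ C)
    (hgC : ∀ x ∈ M, ∀ v, ∀ ε ∈ Ioc (0 : ℝ) 1, g ((1 - ε) • x) v v ≤ C / ε * ‖v‖ ^ 2)
    (hR : ∀ x ∈ M, ‖x‖ ≤ R) :
    UniformContinuousOn (fun p : E × E => rdist g M p.1 p.2) (M ×ˢ M) := by
  have hR0 : 0 ≤ R := (norm_nonneg _).trans (hR 0 h0)
  rw [Metric.uniformContinuousOn_iff]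
  intro ε hε
  have hlim : Tendsto (fun r : ℝ => (4 * R + 1) * √C * √r) (𝓝 0) (𝓝 0) := by
    have : Continuous fun r : ℝ => (4 * R + 1) * √C * √r := by fun_prop
    simpa using this.tendsto 0
  obtain ⟨δ, hδ, h⟩ := Metric.eventually_nhds_iff.1
    (hlim.eventually (gt_mem_nhds (half_pos hε)))
  refine ⟨min δ 1, by positivity, fun p hp q hq hpq => ?_⟩
  have key : ∀ x ∈ M, ∀ y ∈ M, dist x y ≤ dist p q → rdist g M x y < ε / 2 := by
    intro x hx y hy hxy
    have hlt := hxy.trans_lt hpq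
    rw [dist_eq_norm] at hlt
    refine (rdist_le_sqrt hg hM h0 hC hgC hR hx hy (hlt.trans_le (min_le_right _ _))).trans_lt ?_
    refine h ?_
    rw [dist_zero_right, norm_norm]
    exact hlt.trans_le (min_le_left _ _)
  rw [Real.dist_eq]
  refine (rdist_sub_le hg hM hp.1 hp.2 hq.1 hq.2).trans_lt ?_
  have h1 := key _ hp.1 _ hq.1 (le_max_left _ _)
  have h2 := key _ hp.2 _ hq.2 (le_max_right _ _)
  linarith

/-- Uniform continuity maps the trace of the neighbourhood filter to a Cauchy filter, and `ℝ` is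
complete. -/
theorem exists_tendsto_rdist (hg : ContinuousOn g M) (hM : Convex ℝ M) (h0 : (0 : E) ∈ M)
    {C R : ℝ} (hC : 0 ≤ C)
    (hgC : ∀ x ∈ M, ∀ v, ∀ ε ∈ Ioc (0 : ℝ) 1, g ((1 - ε) • x) v v ≤ C / ε * ‖v‖ ^ 2)
    (hR : ∀ x ∈ M, ‖x‖ ≤ R) {p : E × E} (hp : p ∈ closure (M ×ˢ M)) :
    ∃ l, Tendsto (fun p : E × E => rdist g M p.1 p.2) (𝓝[M ×ˢ M] p) (𝓝 l) := by
  have := mem_closure_iff_nhdsWithin_neBot.1 hp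
  refine cauchy_map_iff_exists_tendsto.1 ⟨inferInstance, ?_⟩
  rw [prod_map_map_eq]
  refine (map_mono (le_inf ?_ ?_)).trans (uniformContinuousOn_rdist hg hM h0 hC hgC hR)
  · exact (cauchy_nhds.mono (f := 𝓝 p) nhdsWithin_le_nhds).2
  · rw [← prod_principal_principal]
    exact Filter.prod_mono inf_le_right inf_le_right

/-- A curve that is smooth in the open interval `(0, 1)` only is not shorter than the distance of
its endpoints. -/
theorem ofReal_rdist_le_lintegral_speed (hg : ContinuousOn g M) (hM : Convex ℝ M)
    (h0 : (0 : E) ∈ M) {C R : ℝ} (hC : 0 ≤ C)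
    (hgC : ∀ x ∈ M, ∀ v, ∀ ε ∈ Ioc (0 : ℝ) 1, g ((1 - ε) • x) v v ≤ C / ε * ‖v‖ ^ 2)
    (hR : ∀ x ∈ M, ‖x‖ ≤ R) {γ : ℝ → E} (hγM : ∀ t ∈ Icc (0 : ℝ) 1, γ t ∈ M)
    (hγc : ContinuousOn γ (Icc 0 1)) (hγ : ContDiffOn ℝ ∞ γ (Ioo 0 1)) :
    ENNReal.ofReal (rdist g M (γ 0) (γ 1)) ≤
      ∫⁻ t in Ioo (0 : ℝ) 1, ENNReal.ofReal (speed g γ t) := by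
  set I := ∫⁻ t in Ioo (0 : ℝ) 1, ENNReal.ofReal (speed g γ t) with hI
  rcases eq_or_ne I ⊤ with htop | htop
  · rw [htop]; exact le_top
  rw [ENNReal.ofReal_le_iff_le_toReal htop]
  have huc := uniformContinuousOn_rdist hg hM h0 hC hgC hR
  have hm0 := hγM 0 (left_mem_Icc.2 zero_le_one)
  have hm1 := hγM 1 (right_mem_Icc.2 zero_le_one)
  have hcont : ContinuousOn (fun δ : ℝ => rdist g M (γ δ) (γ (1 - δ))) (Icc 0 1) := by
    have : ContinuousOn (fun δ : ℝ => ((γ δ, γ (1 - δ)) : E × E)) (Icc 0 1) :=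
      hγc.prodMk (hγc.comp (by fun_prop) fun t ht => ⟨by linarith [ht.2], by linarith [ht.1]⟩)
    exact huc.continuousOn.comp this fun t ht =>
      ⟨hγM t ht, hγM _ ⟨by linarith [ht.2], by linarith [ht.1]⟩⟩
  -- The curve is smooth on `[δ, 1 - δ]` only; continuity of the distance then allows `δ → 0`.
  have hlim : Tendsto (fun δ : ℝ => rdist g M (γ δ) (γ (1 - δ))) (𝓝[>] 0)
      (𝓝 (rdist g M (γ 0) (γ 1))) := by
    have h := (hcont 0 (left_mem_Icc.2 zero_le_one)).tendsto
    rw [sub_zero] at h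
    refine h.mono_left ?_
    rw [nhdsWithin_le_iff]
    filter_upwards [Ioo_mem_nhdsGT (zero_lt_one' ℝ)] with t ht using ⟨ht.1.le, ht.2.le⟩
  refine le_of_tendsto hlim ?_
  filter_upwards [Ioo_mem_nhdsGT (half_pos (zero_lt_one' ℝ))] with δ hδ
  have hδ2 : δ ≤ 1 - δ := by linarith [hδ.2]
  have hsub : Icc δ (1 - δ) ⊆ Ioo (0 : ℝ) 1 := fun t ht =>
    ⟨hδ.1.trans_le ht.1, by linarith [ht.2, hδ.1]⟩
  refine (rdist_le_integral_speed hg isOpen_Ioo hγ hδ2 hsub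
    fun t ht => hγM t (Ioo_subset_Icc_self (hsub ht))).trans ?_
  rw [intervalIntegral.integral_of_le hδ2, integral_eq_lintegral_of_nonneg_ae
    (Eventually.of_forall fun t => speed_nonneg _ _)]
  · exact ENNReal.toReal_mono htop
      (lintegral_mono_set (Ioc_subset_Icc_self.trans hsub))
  · exact ((continuousOn_speed hg isOpen_Ioo hγ hsub
      fun t ht => hγM t (Ioo_subset_Icc_self (hsub ht))).mono
        Ioc_subset_Icc_self).aestronglyMeasurable measurableSet_Ioc

/-! ### Linear gradient flows and the evolution variational inequality. -/

/-- The semigroup `exp (-tN)`. -/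
noncomputable def flow (N : E →L[ℝ] E) (t : ℝ) : E →L[ℝ] E := NormedSpace.exp (t • -N)

theorem flow_zero (N : E →L[ℝ] E) : flow N 0 = 1 := by simp [flow]

theorem flow_comm (N : E →L[ℝ] E) (t : ℝ) (x : E) : flow N t (N x) = N (flow N t x) := by
  have : Commute (flow N t) N :=
    (((Commute.refl N).neg_left.smul_left t)).exp_left
  exact DFunLike.congr_fun this.eq x

variable {N : E →L[ℝ] E} {S : E → ℝ} {κ B : ℝ}

/-- The linear flow `exp (-tN)` is the gradient flow of `S` with respect to `g`, and the Hessian of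
`S` is bounded from below by `κ`. -/
structure ConvexFlow (g : E → E →L[ℝ] E →L[ℝ] ℝ) (M : Set E) (N : E →L[ℝ] E) (S : E → ℝ)
    (κ B : ℝ) : Prop where
  isOpen : IsOpen M
  convex : Convex ℝ M
  contDiffOn : ContDiffOn ℝ 1 g M
  symm : ∀ x ∈ M, ∀ v w, g x v w = g x w v
  nonneg : ∀ x ∈ M, ∀ v, 0 ≤ g x v v
  flow_mem : ∀ x ∈ M, ∀ t, 0 ≤ t → flow N t x ∈ M
  hasFDerivAt : ∀ x ∈ M, HasFDerivAt S (g x (N x)) x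
  -- The right-hand side is the Riemannian Hessian of a function whose gradient is the linear field
  -- `N`.
  hess : ∀ x ∈ M, ∀ v, κ * g x v v ≤ g x (N v) v + fderiv ℝ g x (N x) v v / 2
  bound : ∀ x ∈ M, |S x| ≤ B

theorem ConvexFlow.hasDerivAt_metric (h : ConvexFlow g M N S κ B) {x v : ℝ → E} {x' v' : E} {t : ℝ}
    (hxM : x t ∈ M) (hx : HasDerivAt x x' t) (hv : HasDerivAt v v' t) :
    HasDerivAt (fun r => g (x r) (v r) (v r))
      (fderiv ℝ g (x t) x' (v t) (v t) + 2 * g (x t) v' (v t)) t := by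
  have hg : HasFDerivAt g (fderiv ℝ g (x t)) (x t) :=
    ((h.contDiffOn.contDiffAt (h.isOpen.mem_nhds hxM)).differentiableAt (by norm_num)).hasFDerivAt
  have h1 : HasDerivAt (fun r => g (x r)) (fderiv ℝ g (x t) x') t :=
    HasFDerivAt.comp_hasDerivAt (E := E →L[ℝ] E →L[ℝ] ℝ) t hg hx
  have h2 : HasDerivAt (fun r => g (x r) (v r)) (fderiv ℝ g (x t) x' (v t) + g (x t) v') t :=
    h1.clm_apply hv
  refine (h2.clm_apply hv).congr_deriv ?_
  rw [_root_.add_apply, h.symm _ hxM (v t) v']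
  ring

variable [CompleteSpace E]

theorem contDiff_flow (N : E →L[ℝ] E) : ContDiff ℝ ∞ (flow N) := by
  have : ContDiff ℝ ∞ (NormedSpace.exp : (E →L[ℝ] E) → (E →L[ℝ] E)) :=
    contDiff_iff_contDiffAt.2 fun x => (NormedSpace.exp_analytic (𝕂 := ℝ) x).contDiffAt
  exact this.comp (contDiff_id.smul contDiff_const)

theorem hasDerivAt_flow (N : E →L[ℝ] E) {τ : ℝ → ℝ} {τ' t : ℝ} (hτ : HasDerivAt τ τ' t) {x : ℝ → E}
    {x' : E} (hx : HasDerivAt x x' t) :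
    HasDerivAt (fun r => flow N (τ r) (x r)) (flow N (τ t) (x' - τ' • N (x t))) t := by
  have h : HasDerivAt (flow N) (flow N (τ t) * -N) (τ t) := hasDerivAt_exp_smul_const (-N) (τ t)
  convert! (h.scomp t hτ).clm_apply hx using 1
  simp [mul_apply_eq_comp, sub_eq_neg_add]

namespace ConvexFlow

/-- Along a gradient flow the derivative of `S` is `-g (N x) (N x) ≤ 0`. -/
theorem antitone (h : ConvexFlow g M N S κ B) {x : E} (hx : x ∈ M) {s t : ℝ} (hs : 0 ≤ s)
    (hst : s ≤ t) : S (flow N t x) ≤ S (flow N s x) := by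
  have hd : ∀ r, 0 ≤ r → HasDerivAt (fun r => S (flow N r x))
      (g (flow N r x) (N (flow N r x)) (-N (flow N r x))) r := fun r hr => by
    have h1 := hasDerivAt_flow N (hasDerivAt_id r) (hasDerivAt_const r x)
    have h2 := (h.hasFDerivAt _ (h.flow_mem x hx r hr)).comp_hasDerivAt r h1
    simpa [flow_comm, Function.comp_def] using h2
  have hanti : AntitoneOn (fun r => S (flow N r x)) (Ici 0) := by
    refine antitoneOn_of_deriv_nonpos (convex_Ici 0)
      (fun r hr => (hd r hr).continuousAt.continuousWithinAt)
      (fun r hr => ?_) fun r hr => ?_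
    · rw [interior_Ici] at hr
      exact (hd r (le_of_lt hr)).differentiableAt.differentiableWithinAt
    · rw [interior_Ici] at hr
      rw [(hd r (le_of_lt hr)).deriv, map_neg]
      exact neg_nonpos.2 (h.nonneg _ (h.flow_mem x hx r (le_of_lt hr)) _)
  exact hanti hs (hs.trans hst) hst

/-- The differential inequality satisfied by the squared speed of a deformed curve at a fixed
point of the curve, in integrated form. -/
theorem exp_mul_metric_le (h : ConvexFlow g M N S κ B) {x w : E} (hx : x ∈ M) {η p T : ℝ}
    (hη : 0 ≤ η) (hT : 0 ≤ T) :
    let ρ : ℝ → E := fun t => flow N (t * η) x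
    let v : ℝ → E := fun t => flow N (t * η) (w - (t * p) • N x)
    Real.exp (2 * κ * η * T) * g (ρ T) (v T) (v T) ≤ g x w w +
      ∫ t in (0 : ℝ)..T, -2 * p * (Real.exp (2 * κ * η * t) * g (ρ t) (N (ρ t)) (v t)) := by
  intro ρ v
  have hρM : ∀ t, 0 ≤ t → ρ t ∈ M := fun t ht => h.flow_mem x hx _ (mul_nonneg ht hη)
  have hτ : ∀ t, HasDerivAt (fun t : ℝ => t * η) η t := fun t => by
    simpa using (hasDerivAt_id t).mul_const η
  have hρ : ∀ t, HasDerivAt ρ (-(η • N (ρ t))) t := fun t => by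
    convert! hasDerivAt_flow N (hτ t) (hasDerivAt_const t x) using 1
    simp [flow_comm, ρ]
  have hv : ∀ t, HasDerivAt v (-(η • N (v t)) - p • N (ρ t)) t := fun t => by
    have h1 : HasDerivAt (fun t : ℝ => w - (t * p) • N x) (-((1 * p) • N x)) t :=
      (((hasDerivAt_id t).mul_const p).smul_const (N x)).const_sub w
    convert! hasDerivAt_flow N (hτ t) h1 using 1
    simp only [one_mul, map_sub, map_neg, map_smul, flow_comm, v, ρ]
    abel
  have hA : ∀ t, 0 ≤ t → HasDerivAt (fun t => Real.exp (2 * κ * η * t) * g (ρ t) (v t) (v t))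
      (Real.exp (2 * κ * η * t) * (2 * κ * η) * g (ρ t) (v t) (v t) + Real.exp (2 * κ * η * t) *
        (fderiv ℝ g (ρ t) (-(η • N (ρ t))) (v t) (v t) +
          2 * g (ρ t) (-(η • N (v t)) - p • N (ρ t)) (v t))) t := fun t ht => by
    have he : HasDerivAt (fun t => Real.exp (2 * κ * η * t))
        (Real.exp (2 * κ * η * t) * (2 * κ * η)) t := by
      simpa using ((hasDerivAt_id t).const_mul (2 * κ * η)).exp
    exact he.mul (h.hasDerivAt_metric (hρM t ht) (hρ t) (hv t))
  have hρc : Continuous ρ := continuous_iff_continuousAt.2 fun t => (hρ t).continuousAt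
  have hvc : Continuous v := continuous_iff_continuousAt.2 fun t => (hv t).continuousAt
  have hcont : ContinuousOn (fun t => -2 * p * (Real.exp (2 * κ * η * t) *
      g (ρ t) (N (ρ t)) (v t))) (Icc 0 T) := by
    have h1 : ContinuousOn (fun t => g (ρ t)) (Icc 0 T) :=
      h.contDiffOn.continuousOn.comp hρc.continuousOn fun t ht => hρM t ht.1
    have h2 := (h1.clm_apply (N.continuous.comp hρc).continuousOn).clm_apply hvc.continuousOn
    exact continuousOn_const.mul (Continuous.continuousOn (by fun_prop) |>.mul h2)
  -- The terms with a factor `η` in the derivative are `-2η` times the Hessian plus `2κη` times the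
  -- metric, hence nonpositive. Only the contribution of the shear `-p • N (ρ t)` of `v` remains.
  have key := intervalIntegral.sub_le_integral_of_hasDeriv_right_of_le hT
    (fun t ht => (hA t ht.1).continuousAt.continuousWithinAt)
    (fun t ht => (hA t ht.1.le).hasDerivWithinAt) hcont.integrableOn_Icc (fun t ht => by
      have hh := h.hess _ (hρM t ht.1.le) (v t)
      have he := Real.exp_pos (2 * κ * η * t)
      simp only [map_neg, map_smul, map_sub, _root_.neg_apply,
        _root_.sub_apply, _root_.smul_apply, smul_eq_mul]
      have := mul_le_mul_of_nonneg_left hh (mul_nonneg he.le hη)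
      nlinarith)
  have e0 : ρ 0 = x := by simp [ρ, flow_zero]
  have e1 : v 0 = w := by simp [v, flow_zero]
  rw [e0, e1] at key
  simp only [mul_zero, Real.exp_zero, one_mul] at key
  linarith

end ConvexFlow

/-- A smooth positive probability density on `[0, 1]` for which the Cauchy–Schwarz inequality
`(∫ f)² ≤ ∫ f² / p` is almost an equality. -/
theorem exists_density_integral_sq_div_le {f : ℝ → ℝ} (hf : ContinuousOn f (Icc 0 1))
    (hf0 : ∀ t, 0 ≤ f t) {δ : ℝ} (hδ : 0 < δ) :
    ∃ p : ℝ → ℝ, ContDiff ℝ ∞ p ∧ (∀ t ∈ Icc (0 : ℝ) 1, 0 < p t) ∧ ∫ t in (0 : ℝ)..1, p t = 1 ∧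
      ∫ t in (0 : ℝ)..1, f t ^ 2 / p t ≤ ((∫ t in (0 : ℝ)..1, f t) + δ) ^ 2 := by
  -- A polynomial between `f` and `f + δ` replaces `f`, which need be neither smooth nor positive.
  -- After division by its integral `Z`, `f² / p ≤ Z f` with `Z ≤ ∫ f + δ`.
  obtain ⟨q, hq⟩ := exists_polynomial_near_of_continuousOn 0 1 (fun t => f t + δ / 2)
    (hf.add continuousOn_const) (δ / 2) (by positivity)
  have hlow : ∀ t ∈ Icc (0 : ℝ) 1, f t < q.eval t := fun t ht => by
    have := abs_lt.1 (hq t ht); linarith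
  have hupp : ∀ t ∈ Icc (0 : ℝ) 1, q.eval t ≤ f t + δ := fun t ht => by
    have := abs_lt.1 (hq t ht); linarith
  have hpos : ∀ t ∈ Icc (0 : ℝ) 1, 0 < q.eval t := fun t ht => (hf0 t).trans_lt (hlow t ht)
  have hqc : ContDiff ℝ ∞ fun t => q.eval t := by
    simpa using Polynomial.contDiff_aeval (𝕜 := ℝ) q ∞
  have hfi : IntervalIntegrable f volume 0 1 :=
    ContinuousOn.intervalIntegrable (by rwa [uIcc_of_le zero_le_one])
  set Z := ∫ t in (0 : ℝ)..1, q.eval t with hZ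
  have hZpos : 0 < Z := intervalIntegral.intervalIntegral_pos_of_pos_on
    (hqc.continuous.intervalIntegrable _ _) (fun t ht => hpos t (Ioo_subset_Icc_self ht))
    zero_lt_one
  have hZle : Z ≤ (∫ t in (0 : ℝ)..1, f t) + δ := by
    refine (intervalIntegral.integral_mono_on zero_le_one (hqc.continuous.intervalIntegrable _ _)
      (hfi.add (by simp)) hupp).trans (le_of_eq ?_)
    rw [intervalIntegral.integral_add hfi (by simp)]
    simp
  have hI : 0 ≤ ∫ t in (0 : ℝ)..1, f t :=
    intervalIntegral.integral_nonneg zero_le_one fun t _ => hf0 t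
  refine ⟨fun t => q.eval t / Z, hqc.div_const Z, fun t ht => div_pos (hpos t ht) hZpos, ?_, ?_⟩
  · rw [intervalIntegral.integral_div, ← hZ, div_self hZpos.ne']
  · calc ∫ t in (0 : ℝ)..1, f t ^ 2 / (q.eval t / Z) ≤ ∫ t in (0 : ℝ)..1, Z * f t := by
          refine intervalIntegral.integral_mono_on zero_le_one ?_ (hfi.const_mul Z)
            fun t ht => ?_
          · refine ContinuousOn.intervalIntegrable ?_
            rw [uIcc_of_le zero_le_one]
            exact (hf.pow 2).div (hqc.div_const Z).continuous.continuousOn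
              fun t ht => (div_pos (hpos t ht) hZpos).ne'
          · rw [div_div_eq_mul_div, div_le_iff₀ (hpos t ht)]
            nlinarith [mul_nonneg (mul_nonneg hZpos.le (hf0 t)) (sub_nonneg.2 (hlow t ht).le)]
      _ = Z * ∫ t in (0 : ℝ)..1, f t := intervalIntegral.integral_const_mul _ _
      _ ≤ ((∫ t in (0 : ℝ)..1, f t) + δ) ^ 2 := by nlinarith

/-- Clamping both variables with `projIcc` makes the integrand continuous on the whole plane without
changing it on the rectangle. -/
theorem continuousOn_intervalIntegral_of_prod {F : ℝ → ℝ → ℝ} {a b c d : ℝ} (hab : a ≤ b)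
    (hcd : c ≤ d) (hF : ContinuousOn (fun q : ℝ × ℝ => F q.1 q.2) (Icc a b ×ˢ Icc c d)) :
    ContinuousOn (fun s => ∫ t in c..d, F s t) (Icc a b) := by
  have hc : Continuous fun q : ℝ × ℝ => F (projIcc a b hab q.1) (projIcc c d hcd q.2) :=
    hF.comp_continuous (f := fun q : ℝ × ℝ => ((projIcc a b hab q.1 : ℝ), (projIcc c d hcd q.2 : ℝ)))
      (by fun_prop) fun q => ⟨Subtype.coe_prop _, Subtype.coe_prop _⟩
  refine (intervalIntegral.continuous_parametric_intervalIntegral_of_continuous'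
    (f := fun s t => F (projIcc a b hab s) (projIcc c d hcd t)) (μ := volume) hc c d).continuousOn.congr
    fun s hs => intervalIntegral.integral_congr fun t ht => ?_
  rw [uIcc_of_le hcd] at ht
  simp only [projIcc_of_mem _ hs, projIcc_of_mem _ ht]

/-- Weighted Cauchy–Schwarz, by integrating `(f - (F / W) w)² / w ≥ 0` with `F = ∫ f` and `W = ∫ w`.
-/
theorem sq_integral_le_mul {f w : ℝ → ℝ} (hf : ContinuousOn f (Icc 0 1))
    (hw : ContinuousOn w (Icc 0 1)) (hw0 : ∀ t ∈ Icc (0 : ℝ) 1, 0 < w t) :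
    (∫ t in (0 : ℝ)..1, f t) ^ 2 ≤
      (∫ t in (0 : ℝ)..1, f t ^ 2 / w t) * ∫ t in (0 : ℝ)..1, w t := by
  have hII : ∀ {u : ℝ → ℝ}, ContinuousOn u (Icc 0 1) → IntervalIntegrable u volume 0 1 :=
    fun hu => ContinuousOn.intervalIntegrable (by rwa [uIcc_of_le zero_le_one])
  have hfw : ContinuousOn (fun t => f t ^ 2 / w t) (Icc 0 1) :=
    (hf.pow 2).div hw fun t ht => (hw0 t ht).ne'
  set F := ∫ t in (0 : ℝ)..1, f t
  set W := ∫ t in (0 : ℝ)..1, w t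
  have hW : 0 < W := intervalIntegral.intervalIntegral_pos_of_pos_on (hII hw)
    (fun t ht => hw0 t (Ioo_subset_Icc_self ht)) zero_lt_one
  have key : ∫ t in (0 : ℝ)..1, 2 * (F / W) * f t ≤
      ∫ t in (0 : ℝ)..1, f t ^ 2 / w t + (F / W) ^ 2 * w t := by
    refine intervalIntegral.integral_mono_on zero_le_one ((hII hf).const_mul _)
      ((hII hfw).add ((hII hw).const_mul _)) fun t ht => ?_
    have hwt := hw0 t ht
    have : f t ^ 2 / w t + (F / W) ^ 2 * w t - 2 * (F / W) * f t =
        (f t - F / W * w t) ^ 2 / w t := by field_simp; ring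
    have h2 : 0 ≤ (f t - F / W * w t) ^ 2 / w t := by positivity
    linarith
  rw [intervalIntegral.integral_const_mul, intervalIntegral.integral_add (hII hfw)
    ((hII hw).const_mul _), intervalIntegral.integral_const_mul] at key
  change 2 * (F / W) * F ≤ _ + (F / W) ^ 2 * W at key
  have e1 : 2 * (F / W) * F = 2 * (F ^ 2 / W) := by ring
  have e2 : (F / W) ^ 2 * W = F ^ 2 / W := by field_simp
  rw [e1, e2] at key
  rw [← div_le_iff₀ hW]
  linarith

/-- The velocity of the deformed curve `s ↦ exp (-t η(s) N) γ(s)`. -/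
noncomputable def deformVel (N : E →L[ℝ] E) (γ : ℝ → E) (η p : ℝ → ℝ) (s t : ℝ) : E :=
  flow N (t * η s) (deriv γ s - (t * p s) • N (γ s))

theorem hasDerivAt_deform {γ : ℝ → E} {η p : ℝ → ℝ} (hγ : Differentiable ℝ γ)
    (hη : ∀ s, HasDerivAt η (p s) s) (s t : ℝ) :
    HasDerivAt (fun s => flow N (t * η s) (γ s)) (deformVel N γ η p s t) s :=
  hasDerivAt_flow N ((hη s).const_mul t) (hγ s).hasDerivAt

theorem continuous_deform {γ : ℝ → E} {η : ℝ → ℝ} (hγ : Continuous γ) (hη : Continuous η) :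
    Continuous fun q : ℝ × ℝ => flow N (q.2 * η q.1) (γ q.1) :=
  ((contDiff_flow N).continuous.comp (by fun_prop)).clm_apply (hγ.comp continuous_fst)

theorem continuous_deformVel {γ : ℝ → E} {η p : ℝ → ℝ} (hγ : ContDiff ℝ ∞ γ)
    (hη : Continuous η) (hp : Continuous p) :
    Continuous fun q : ℝ × ℝ => deformVel N γ η p q.1 q.2 := by
  have h1 : Continuous (deriv γ) := hγ.continuous_deriv (by norm_num)
  have h2 := hγ.continuous
  exact ((contDiff_flow N).continuous.comp (by fun_prop)).clm_apply (by fun_prop)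

namespace ConvexFlow

/-- Without the exponential the integrand is the derivative in `s` of `S` along the deformed curve,
and the integral is the difference of the end values. The exponential differs from 1 by `O(|κ| t)`,
and `|S| ≤ B` bounds the error: `6 |κ| B t` from differentiating it (as `e < 3`) and `4 |κ| B t`
from its value at the end, together below `12 |κ| B t`. -/
theorem integral_deriv_entropy_ge (h : ConvexFlow g M N S κ B) {γ : ℝ → E} {x y : E}
    (hγ : FlatCurve M y x γ) {η p : ℝ → ℝ} (hη : ∀ s, HasDerivAt η (p s) s) (hp : Continuous p)
    (hη0 : η 0 = 0) (hη1 : η 1 = 1) (hηI : ∀ s ∈ Icc (0 : ℝ) 1, η s ∈ Icc (0 : ℝ) 1)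
    (hp0 : ∀ s ∈ Icc (0 : ℝ) 1, 0 < p s) (hp1 : ∫ s in (0 : ℝ)..1, p s = 1) {t : ℝ}
    (ht0 : 0 ≤ t) (ht : 2 * |κ| * t ≤ 1) :
    S (flow N t x) - S y - 12 * |κ| * B * t ≤ ∫ s in (0 : ℝ)..1,
      Real.exp (2 * κ * η s * t) *
        g (flow N (t * η s) (γ s)) (N (flow N (t * η s) (γ s))) (deformVel N γ η p s t) := by
  have hηc : Continuous η := continuous_iff_continuousAt.2 fun s => (hη s).continuousAt
  set ρ : ℝ → E := fun s => flow N (t * η s) (γ s) with hρ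
  set v : ℝ → E := fun s => deformVel N γ η p s t with hv
  have hρM : ∀ s ∈ Icc (0 : ℝ) 1, ρ s ∈ M := fun s hs =>
    h.flow_mem _ (hγ.mem s) _ (mul_nonneg ht0 (hηI s hs).1)
  have hρd : ∀ s, HasDerivAt ρ (v s) s := fun s =>
    hasDerivAt_deform (hγ.smooth.differentiable (by norm_num)) hη s t
  have hρc : Continuous ρ := continuous_iff_continuousAt.2 fun s => (hρd s).continuousAt
  have hvc : Continuous v :=
    (continuous_deformVel hγ.smooth hηc hp).comp (by fun_prop : Continuous fun s : ℝ => (s, t))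
  have hgc : ContinuousOn (fun s => g (ρ s) (N (ρ s)) (v s)) (Icc 0 1) :=
    ((h.contDiffOn.continuousOn.comp hρc.continuousOn hρM).clm_apply
      (N.continuous.comp hρc).continuousOn).clm_apply hvc.continuousOn
  have hSc : ContinuousOn (fun s => S (ρ s)) (Icc 0 1) := fun s hs =>
    ((h.hasFDerivAt _ (hρM s hs)).comp_hasDerivAt s (hρd s)).continuousAt.continuousWithinAt
  have hexp : Continuous fun s => Real.exp (2 * κ * η s * t) := by fun_prop
  have hB : 0 ≤ B := (abs_nonneg _).trans (h.bound _ (hγ.mem 0))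
  have hd : ∀ s ∈ Icc (0 : ℝ) 1, HasDerivAt (fun s => Real.exp (2 * κ * η s * t) * S (ρ s))
      (Real.exp (2 * κ * η s * t) * (2 * κ * p s * t) * S (ρ s) +
        Real.exp (2 * κ * η s * t) * g (ρ s) (N (ρ s)) (v s)) s := fun s hs =>
    ((((hη s).const_mul (2 * κ)).mul_const t).exp).mul
      ((h.hasFDerivAt _ (hρM s hs)).comp_hasDerivAt s (hρd s))
  have hI1 : ContinuousOn (fun s => Real.exp (2 * κ * η s * t) * (2 * κ * p s * t) * S (ρ s))
      (Icc 0 1) :=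
    (Continuous.continuousOn (by fun_prop)).mul hSc
  have hI2 : ContinuousOn (fun s => Real.exp (2 * κ * η s * t) * g (ρ s) (N (ρ s)) (v s))
      (Icc 0 1) := hexp.continuousOn.mul hgc
  have hII : ∀ {u : ℝ → ℝ}, ContinuousOn u (Icc 0 1) → IntervalIntegrable u volume 0 1 :=
    fun hu => ContinuousOn.intervalIntegrable (by rwa [uIcc_of_le zero_le_one])
  have key := intervalIntegral.integral_eq_sub_of_hasDerivAt
    (fun s hs => hd s (by rwa [uIcc_of_le zero_le_one] at hs)) ((hII hI1).add (hII hI2))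
  rw [intervalIntegral.integral_add (hII hI1) (hII hI2)] at key
  have hz : ∀ r ∈ Icc (0 : ℝ) 1, |2 * κ * r * t| ≤ 2 * |κ| * t := fun r hr => by
    rw [abs_mul, abs_mul, abs_mul, abs_two, abs_of_nonneg hr.1, abs_of_nonneg ht0]
    have : 2 * |κ| * r * t = (2 * |κ| * t) * r := by ring
    rw [this]
    exact mul_le_of_le_one_right (by positivity) hr.2
  have hbd : ∫ s in (0 : ℝ)..1, Real.exp (2 * κ * η s * t) * (2 * κ * p s * t) * S (ρ s) ≤
      ∫ s in (0 : ℝ)..1, (6 * |κ| * B * t) * p s := by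
    refine intervalIntegral.integral_mono_on zero_le_one (hII hI1)
      ((hp.intervalIntegrable _ _).const_mul _) fun s hs => ?_
    have h1 : Real.exp (2 * κ * η s * t) ≤ 3 := by
      have hle : 2 * κ * η s * t ≤ 1 := (le_abs_self _).trans ((hz _ (hηI s hs)).trans ht)
      exact (Real.exp_le_exp.2 hle).trans Real.exp_one_lt_three.le
    have h2 := h.bound _ (hρM s hs)
    refine (le_abs_self _).trans ?_
    have hps := hp0 s hs
    rw [abs_mul, abs_mul, abs_of_pos (Real.exp_pos _), abs_mul, abs_mul, abs_mul, abs_two,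
      abs_of_pos hps, abs_of_nonneg ht0]
    calc Real.exp (2 * κ * η s * t) * (2 * |κ| * p s * t) * |S (ρ s)|
        ≤ 3 * (2 * |κ| * p s * t) * B := by gcongr
      _ = 6 * |κ| * B * t * p s := by ring
  rw [intervalIntegral.integral_const_mul, hp1] at hbd
  have e1 : ρ 1 = flow N t x := by simp [hρ, hη1, hγ.right 1 le_rfl]
  have e0 : ρ 0 = y := by simp [hρ, hη0, hγ.left 0 le_rfl, flow_zero]
  rw [e1, e0, hη1, hη0] at key
  have hend : S (flow N t x) - 4 * |κ| * B * t ≤ Real.exp (2 * κ * 1 * t) * S (flow N t x) := by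
    have hz1 := hz 1 (right_mem_Icc.2 zero_le_one)
    have h1 := Real.abs_exp_sub_one_le (hz1.trans ht)
    have h2 := h.bound _ (e1 ▸ hρM 1 (right_mem_Icc.2 zero_le_one))
    have h3 : |(Real.exp (2 * κ * 1 * t) - 1) * S (flow N t x)| ≤ 2 * (2 * |κ| * t) * B := by
      rw [abs_mul]
      exact mul_le_mul (h1.trans (by linarith)) h2 (abs_nonneg _) (by positivity)
    have h4 := (abs_le.1 h3).1
    linarith
  have hpos : 0 ≤ |κ| * B * t := by positivity
  simp only [mul_zero, zero_mul, Real.exp_zero, one_mul] at key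
  linarith

set_option maxHeartbeats 1000000 in
/-- The discrete evolution variational inequality. -/
theorem sq_rdist_flow_le (h : ConvexFlow g M N S κ B) {x y : E} (hx : x ∈ M) (hy : y ∈ M) {T : ℝ}
    (hT0 : 0 ≤ T) (hT : 2 * |κ| * T ≤ 1) :
    rdist g M y (flow N T x) ^ 2 ≤
      (rdist g M y x ^ 2 + 2 * T * (S y - S (flow N T x)) + 24 * |κ| * B * T ^ 2) *
        (1 - κ * T + 4 * κ ^ 2 * T ^ 2) := by
  set d := rdist g M y x with hd
  have hd0 : 0 ≤ d := rdist_nonneg _ _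
  set Y := 1 - κ * T + 4 * κ ^ 2 * T ^ 2 with hY
  have hY0 : 0 ≤ Y := by rw [hY]; nlinarith [sq_nonneg (κ * T - 1 / 2)]
  have hgc : ContinuousOn g M := h.contDiffOn.continuousOn
  have hII : ∀ {u : ℝ → ℝ}, ContinuousOn u (Icc 0 1) → IntervalIntegrable u volume 0 1 :=
    fun hu => ContinuousOn.intervalIntegrable (by rwa [uIcc_of_le zero_le_one])
  -- The margin `ε` pays for a curve that is only nearly shortest and for a density `p` that is only
  -- nearly proportional to its speed.
  suffices H : ∀ ε > 0, rdist g M y (flow N T x) ^ 2 ≤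
      ((d + ε) ^ 2 + 2 * T * (S y - S (flow N T x)) + 24 * |κ| * B * T ^ 2) * Y by
    have hlim : Tendsto (fun ε : ℝ => ((d + ε) ^ 2 + 2 * T * (S y - S (flow N T x)) +
        24 * |κ| * B * T ^ 2) * Y) (𝓝[>] 0)
        (𝓝 ((d ^ 2 + 2 * T * (S y - S (flow N T x)) + 24 * |κ| * B * T ^ 2) * Y)) := by
      have : Continuous fun ε : ℝ => ((d + ε) ^ 2 + 2 * T * (S y - S (flow N T x)) +
        24 * |κ| * B * T ^ 2) * Y := by fun_prop
      simpa using (this.tendsto 0).mono_left nhdsWithin_le_nhds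
    exact ge_of_tendsto hlim (by filter_upwards [self_mem_nhdsWithin] with ε hε using H ε hε)
  intro ε hε
  obtain ⟨γ, hγ, hγl⟩ := exists_flatCurve_lt (g := g) h.convex hy hx
    (lt_add_of_pos_right d (half_pos hε))
  obtain ⟨p, hpc, hp0, hp1, hpE⟩ := exists_density_integral_sq_div_le
    (hγ.continuous_speed hgc).continuousOn (fun t => speed_nonneg γ t) (half_pos hε)
  have hpcont := hpc.continuous
  -- The delay `η` grows like the arclength of `γ`, so that no constant speed parametrization of `γ`
  -- is needed.
  set η : ℝ → ℝ := fun s => ∫ r in (0 : ℝ)..s, p r with hηdef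
  have hη : ∀ s, HasDerivAt η (p s) s := fun s =>
    intervalIntegral.integral_hasDerivAt_right (hpcont.intervalIntegrable _ _)
      (hpcont.stronglyMeasurableAtFilter _ _) hpcont.continuousAt
  have hηs : ContDiff ℝ ∞ η := by
    refine contDiff_infty_iff_deriv.2 ⟨fun s => (hη s).differentiableAt, ?_⟩
    rwa [show deriv η = p from funext fun s => (hη s).deriv]
  have hηc := hηs.continuous
  have hη0 : η 0 = 0 := by simp [hηdef]
  have hη1 : η 1 = 1 := hp1
  have hmono : MonotoneOn η (Icc 0 1) :=
    monotoneOn_of_deriv_nonneg (convex_Icc 0 1) hηc.continuousOn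
      (hηs.differentiable (by norm_num)).differentiableOn fun s hs => by
        rw [(hη s).deriv]; exact (hp0 s (interior_subset hs)).le
  have hηI : ∀ s ∈ Icc (0 : ℝ) 1, η s ∈ Icc (0 : ℝ) 1 := fun s hs =>
    ⟨hη0 ▸ hmono (left_mem_Icc.2 zero_le_one) hs hs.1,
      hη1 ▸ hmono hs (right_mem_Icc.2 zero_le_one) hs.2⟩
  -- Since `η 0 = 0` and `η 1 = 1`, the curve `s ↦ ρ s T` still starts at `y` and ends at `flow N T
  -- x`.
  set ρ : ℝ → ℝ → E := fun s t => flow N (t * η s) (γ s) with hρdef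
  set v : ℝ → ℝ → E := deformVel N γ η p with hvdef
  have hρM : ∀ s ∈ Icc (0 : ℝ) 1, ∀ t, 0 ≤ t → ρ s t ∈ M := fun s hs t ht =>
    h.flow_mem _ (hγ.mem s) _ (mul_nonneg ht (hηI s hs).1)
  have hρc : Continuous fun q : ℝ × ℝ => ρ q.1 q.2 := continuous_deform hγ.smooth.continuous hηc
  have hvc : Continuous fun q : ℝ × ℝ => v q.1 q.2 := continuous_deformVel hγ.smooth hηc hpcont
  set b : ℝ → ℝ → ℝ := fun s t =>
    Real.exp (2 * κ * η s * t) * g (ρ s t) (N (ρ s t)) (v s t) with hbdef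
  have hbc : ContinuousOn (fun q : ℝ × ℝ => b q.1 q.2) (Icc 0 1 ×ˢ Icc 0 T) := by
    have h1 : ContinuousOn (fun q : ℝ × ℝ => g (ρ q.1 q.2)) (Icc 0 1 ×ˢ Icc 0 T) :=
      hgc.comp hρc.continuousOn fun q hq => hρM _ hq.1 _ hq.2.1
    exact (Continuous.continuousOn (by fun_prop)).mul
      ((h1.clm_apply (N.continuous.comp hρc).continuousOn).clm_apply hvc.continuousOn)
  have hbc' : ContinuousOn (fun q : ℝ × ℝ => b q.2 q.1) (Icc 0 T ×ˢ Icc 0 1) :=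
    hbc.comp continuous_swap.continuousOn fun q hq => ⟨hq.2, hq.1⟩
  set A : ℝ → ℝ := fun s => g (ρ s T) (v s T) (v s T) with hAdef
  have hslice : Continuous fun s : ℝ => (s, T) := by fun_prop
  have hAc : ContinuousOn A (Icc 0 1) := by
    have h1 : ContinuousOn (fun s => g (ρ s T)) (Icc 0 1) :=
      hgc.comp (hρc.comp hslice).continuousOn fun s hs => hρM s hs T hT0
    exact (h1.clm_apply (hvc.comp hslice).continuousOn).clm_apply (hvc.comp hslice).continuousOn
  have hA0 : ∀ s ∈ Icc (0 : ℝ) 1, 0 ≤ A s := fun s hs => h.nonneg _ (hρM s hs T hT0) _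
  -- the deformed curve bounds the distance
  have hlen : rdist g M y (flow N T x) ≤ ∫ s in (0 : ℝ)..1, √(A s) := by
    have hsm : ContDiff ℝ ∞ fun s => ρ s T :=
      ((contDiff_flow N).comp (contDiff_const.mul hηs)).clm_apply hγ.smooth
    have := rdist_le_integral_speed hgc isOpen_univ hsm.contDiffOn zero_le_one (subset_univ _)
      fun s hs => hρM s hs T hT0
    simp only [hρdef, hη0, hη1, hγ.left 0 le_rfl, hγ.right 1 le_rfl, mul_zero, mul_one, flow_zero,
      one_apply_eq_self] at this
    refine this.trans (le_of_eq ?_)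
    refine intervalIntegral.integral_congr fun s _ => ?_
    simp only [speed, hAdef]
    rw [(hasDerivAt_deform (hγ.smooth.differentiable (by norm_num)) hη s T).deriv]
  -- With this weight `A / w` is `exp (2κηT) A / p`, the quantity that `exp_mul_metric_le` controls.
  set w : ℝ → ℝ := fun s => Real.exp (-(2 * κ * η s * T)) * p s with hwdef
  have hwc : ContinuousOn w (Icc 0 1) := Continuous.continuousOn (by fun_prop)
  have hw0 : ∀ s ∈ Icc (0 : ℝ) 1, 0 < w s := fun s hs => mul_pos (Real.exp_pos _) (hp0 s hs)
  have hCS := sq_integral_le_mul hAc.sqrt hwc hw0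
  -- the weight
  have hW : ∫ s in (0 : ℝ)..1, w s ≤ Y := by
    have hle : ∀ s ∈ Icc (0 : ℝ) 1,
        w s ≤ p s - 2 * κ * T * (η s * p s) + 4 * κ ^ 2 * T ^ 2 * p s := fun s hs => by
      obtain ⟨ha, hb⟩ := hηI s hs
      have habs : |(-(2 * κ * η s * T))| ≤ 1 := by
        rw [abs_neg, abs_mul, abs_mul, abs_mul, abs_two, abs_of_nonneg ha, abs_of_nonneg hT0]
        have : 2 * |κ| * η s * T = (2 * |κ| * T) * η s := by ring
        rw [this]
        exact (mul_le_of_le_one_right (by positivity) hb).trans hT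
      have h1 := (abs_le.1 (Real.abs_exp_sub_one_sub_id_le habs)).2
      have h2 : (-(2 * κ * η s * T)) ^ 2 ≤ 4 * κ ^ 2 * T ^ 2 := by
        have : (-(2 * κ * η s * T)) ^ 2 = 4 * κ ^ 2 * T ^ 2 * η s ^ 2 := by ring
        rw [this]
        exact mul_le_of_le_one_right (by positivity) (pow_le_one₀ ha hb)
      have h3 : Real.exp (-(2 * κ * η s * T)) ≤ 1 - 2 * κ * η s * T + 4 * κ ^ 2 * T ^ 2 := by
        linarith
      have := mul_le_mul_of_nonneg_right h3 (hp0 s hs).le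
      simp only [hwdef]
      linarith
    -- The mean delay is `1/2`, which turns the exponent `-2κηT` into the first order term `-κT`.
    have hηp : ∫ s in (0 : ℝ)..1, η s * p s = 1 / 2 := by
      have := intervalIntegral.integral_eq_sub_of_hasDerivAt (a := 0) (b := 1)
        (f := fun s => η s ^ 2 / 2) (f' := fun s => η s * p s)
        (fun s _ => by
          have := ((hη s).pow 2).div_const 2
          convert! this using 1
          simp only [Nat.cast_ofNat, Nat.add_one_sub_one, pow_one]
          ring)
        ((hηc.mul hpcont).intervalIntegrable _ _)
      rw [this, hη0, hη1]; norm_num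
    have i1 : IntervalIntegrable p volume 0 1 := hpcont.intervalIntegrable _ _
    have i2 : IntervalIntegrable (fun s => η s * p s) volume 0 1 :=
      (hηc.mul hpcont).intervalIntegrable _ _
    refine (intervalIntegral.integral_mono_on zero_le_one (hII hwc)
      ((i1.sub (i2.const_mul _)).add (i1.const_mul _)) hle).trans (le_of_eq ?_)
    rw [intervalIntegral.integral_add (i1.sub (i2.const_mul _)) (i1.const_mul _),
      intervalIntegral.integral_sub i1 (i2.const_mul _), intervalIntegral.integral_const_mul,
      intervalIntegral.integral_const_mul, hηp, hp1, hY]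
    ring
  -- the weighted action
  have hX : ∫ s in (0 : ℝ)..1, √(A s) ^ 2 / w s ≤
      (d + ε) ^ 2 + 2 * T * (S y - S (flow N T x)) + 24 * |κ| * B * T ^ 2 := by
    have hstep : ∀ s ∈ Icc (0 : ℝ) 1, √(A s) ^ 2 / w s ≤
        speed g γ s ^ 2 / p s + -2 * ∫ t in (0 : ℝ)..T, b s t := fun s hs => by
      have hps := hp0 s hs
      have h1 := h.exp_mul_metric_le (hγ.mem s) (w := deriv γ s) (p := p s) (hηI s hs).1 hT0
      simp only at h1
      rw [intervalIntegral.integral_const_mul] at h1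
      rw [Real.sq_sqrt (hA0 s hs), speed, Real.sq_sqrt (h.nonneg _ (hγ.mem s) _)]
      simp only [hwdef, Real.exp_neg]
      have e : A s / ((Real.exp (2 * κ * η s * T))⁻¹ * p s) =
          Real.exp (2 * κ * η s * T) * A s / p s := by field_simp
      rw [e, div_le_iff₀ hps, add_mul, div_mul_cancel₀ _ hps.ne']
      refine h1.trans (le_of_eq ?_)
      simp only [hbdef, hρdef, hvdef, deformVel]
      ring
    have hbI : ContinuousOn (fun s => ∫ t in (0 : ℝ)..T, b s t) (Icc 0 1) :=
      continuousOn_intervalIntegral_of_prod zero_le_one hT0 hbc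
    have hbI' : ContinuousOn (fun t => ∫ s in (0 : ℝ)..1, b s t) (Icc 0 T) :=
      continuousOn_intervalIntegral_of_prod (F := fun t s => b s t) hT0 zero_le_one hbc'
    have hE : ContinuousOn (fun s => speed g γ s ^ 2 / p s) (Icc 0 1) :=
      ((hγ.continuous_speed hgc).continuousOn.pow 2).div hpcont.continuousOn
        fun s hs => (hp0 s hs).ne'
    -- For fixed `t` the integral over `s` is nearly a difference of entropies, so the order is
    -- exchanged. Monotonicity of `S` along the flow then replaces the time `t` by `T`.
    have hswap : ∫ s in (0 : ℝ)..1, ∫ t in (0 : ℝ)..T, b s t =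
        ∫ t in (0 : ℝ)..T, ∫ s in (0 : ℝ)..1, b s t := by
      refine intervalIntegral_intervalIntegral_swap ?_
      rw [uIoc_of_le zero_le_one, uIoc_of_le hT0]
      exact (hbc.integrableOn_compact (isCompact_Icc.prod isCompact_Icc)).mono_set
        (prod_mono Ioc_subset_Icc_self Ioc_subset_Icc_self)
    have hlow : ∫ t in (0 : ℝ)..T, (S (flow N T x) - S y - 12 * |κ| * B * T) ≤
        ∫ t in (0 : ℝ)..T, ∫ s in (0 : ℝ)..1, b s t := by
      refine intervalIntegral.integral_mono_on hT0 (by simp)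
        (ContinuousOn.intervalIntegrable (by rwa [uIcc_of_le hT0])) fun t ht => ?_
      have hB : 0 ≤ B := (abs_nonneg _).trans (h.bound _ hx)
      have htT : 2 * |κ| * t ≤ 1 := (mul_le_mul_of_nonneg_left ht.2 (by positivity)).trans hT
      have h1 := h.integral_deriv_entropy_ge hγ hη hpcont hη0 hη1 hηI hp0 hp1 ht.1 htT
      have h2 := h.antitone hx ht.1 ht.2
      have h3 : 12 * |κ| * B * t ≤ 12 * |κ| * B * T :=
        mul_le_mul_of_nonneg_left ht.2 (by positivity)
      exact le_trans (by linarith) h1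
    rw [intervalIntegral.integral_const, sub_zero, smul_eq_mul] at hlow
    have hL : (∫ s in (0 : ℝ)..1, speed g γ s) + ε / 2 ≤ d + ε := by linarith
    have hL0 : 0 ≤ (∫ s in (0 : ℝ)..1, speed g γ s) + ε / 2 :=
      add_nonneg (length_nonneg γ zero_le_one) (by positivity)
    have hE2 := hpE.trans (pow_le_pow_left₀ hL0 hL 2)
    have hint := intervalIntegral.integral_mono_on zero_le_one
      (hII ((hAc.sqrt.pow 2).div hwc fun s hs => (hw0 s hs).ne'))
      ((hII hE).add ((hII hbI).const_mul (-2))) hstep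
    rw [intervalIntegral.integral_add (hII hE) ((hII hbI).const_mul (-2)),
      intervalIntegral.integral_const_mul, hswap] at hint
    refine hint.trans ?_
    nlinarith
  have hX0 : 0 ≤ ∫ s in (0 : ℝ)..1, √(A s) ^ 2 / w s :=
    intervalIntegral.integral_nonneg zero_le_one fun s hs => div_nonneg (sq_nonneg _) (hw0 s hs).le
  calc rdist g M y (flow N T x) ^ 2 ≤ (∫ s in (0 : ℝ)..1, √(A s)) ^ 2 :=
        pow_le_pow_left₀ (rdist_nonneg _ _) hlen 2
    _ ≤ _ := hCS
    _ ≤ (∫ s in (0 : ℝ)..1, √(A s) ^ 2 / w s) * Y := mul_le_mul_of_nonneg_left hW hX0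
    _ ≤ _ := mul_le_mul_of_nonneg_right hX hY0

end ConvexFlow

end LocalMetric

/-! ### Parametric integrals and functions with continuous slopes. -/

section ParametricIntegral

variable {X F : Type*} [NormedAddCommGroup X] [NormedSpace ℝ X] [ProperSpace X]
  [NormedAddCommGroup F] [NormedSpace ℝ F]

/-- Differentiation under the integral sign, for `C¹` integrands over a compact interval. -/
theorem contDiff_one_intervalIntegral_of_contDiff {f : X × ℝ → F} (hf : ContDiff ℝ 1 f)
    (a b : ℝ) : ContDiff ℝ 1 fun x => ∫ s in a..b, f (x, s) := by
  set f' : X → ℝ → X →L[ℝ] F := fun x s =>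
    (fderiv ℝ f (x, s)).comp (ContinuousLinearMap.inl ℝ X ℝ) with hf'
  have hf'c : Continuous fun p : X × ℝ => f' p.1 p.2 :=
    (hf.continuous_fderiv (by norm_num)).clm_comp continuous_const
  have hd : ∀ x s, HasFDerivAt (fun x => f (x, s)) (f' x s) x := fun x s => by
    have h1 := (hf.differentiable (by norm_num) (x, s)).hasFDerivAt
    exact h1.comp x (hasFDerivAt_prodMk_left x s)
  have key : ∀ x₀, HasFDerivAt (fun x => ∫ s in a..b, f (x, s)) (∫ s in a..b, f' x₀ s) x₀ := by
    intro x₀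
    obtain ⟨C, hC⟩ := ((isCompact_closedBall x₀ 1).prod isCompact_uIcc).exists_bound_of_continuousOn
      (hf'c.continuousOn (s := Metric.closedBall x₀ 1 ×ˢ uIcc a b))
    refine intervalIntegral.hasFDerivAt_integral_of_dominated_of_fderiv_le (bound := fun _ => C)
      (Metric.closedBall_mem_nhds x₀ one_pos) ?_ ?_ ?_ ?_ ?_ ?_
    · exact Eventually.of_forall fun x =>
        (hf.continuous.comp (by fun_prop : Continuous fun s : ℝ => (x, s))).aestronglyMeasurable
    · exact (hf.continuous.comp (by fun_prop : Continuous fun s : ℝ => (x₀, s))).intervalIntegrable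
        _ _
    · exact (hf'c.comp (by fun_prop : Continuous fun s : ℝ => (x₀, s))).aestronglyMeasurable
    · exact Eventually.of_forall fun s hs x hx => hC (x, s) ⟨hx, uIoc_subset_uIcc hs⟩
    · simp
    · exact Eventually.of_forall fun s _ x _ => hd x s
  rw [contDiff_one_iff_fderiv]
  refine ⟨fun x => (key x).differentiableAt, ?_⟩
  rw [show fderiv ℝ (fun x => ∫ s in a..b, f (x, s)) = fun x => ∫ s in a..b, f' x s from
    funext fun x => (key x).fderiv]
  exact intervalIntegral.continuous_parametric_intervalIntegral_of_continuous' hf'c a b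

end ParametricIntegral

section Slope

variable {X F : Type*} [NormedAddCommGroup X] [NormedSpace ℝ X]
  [NormedAddCommGroup F] [NormedSpace ℝ F]

/-- A function with a continuous slope operator is strictly differentiable. -/
theorem hasStrictFDerivAt_of_slope {f : X → F} {Ψ : X × X → X →L[ℝ] F} {M : Set X} (hM : IsOpen M)
    (h : ∀ x ∈ M, ∀ y ∈ M, f x - f y = Ψ (x, y) (x - y)) (hΨ : ContinuousOn Ψ (M ×ˢ M)) {x : X}
    (hx : x ∈ M) : HasStrictFDerivAt f (Ψ (x, x)) x := by
  rw [hasStrictFDerivAt_iff_isLittleO]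
  have hMM : M ×ˢ M ∈ 𝓝 (x, x) := (hM.prod hM).mem_nhds ⟨hx, hx⟩
  have hcont : Tendsto (fun p => Ψ p - Ψ (x, x)) (𝓝 (x, x)) (𝓝 0) := by
    have := (hΨ.continuousAt hMM).tendsto.sub_const (Ψ (x, x))
    rwa [sub_self] at this
  refine Asymptotics.isLittleO_iff.2 fun c hc => ?_
  filter_upwards [hMM, Metric.tendsto_nhds.1 hcont c hc] with p hp hpc
  rw [h _ hp.1 _ hp.2, ← _root_.sub_apply]
  rw [dist_zero_right] at hpc
  exact ((Ψ (p.1, p.2) - Ψ (x, x)).le_opNorm _).trans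
    (mul_le_mul_of_nonneg_right hpc.le (norm_nonneg _))

/-- The derivative is the slope operator on the diagonal. This serves for the matrix logarithm,
whose slope operator is explicit. -/
theorem contDiffOn_one_of_slope {f : X → F} {Ψ : X × X → X →L[ℝ] F} {M : Set X} (hM : IsOpen M)
    (h : ∀ x ∈ M, ∀ y ∈ M, f x - f y = Ψ (x, y) (x - y)) (hΨ : ContinuousOn Ψ (M ×ˢ M)) :
    ContDiffOn ℝ 1 f M := by
  have hd := fun x hx => (hasStrictFDerivAt_of_slope hM h hΨ (x := x) hx).hasFDerivAt
  rw [show (1 : WithTop ℕ∞) = 0 + 1 by norm_num, contDiffOn_succ_iff_fderiv_of_isOpen hM]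
  refine ⟨fun x hx => (hd x hx).differentiableAt.differentiableWithinAt, by simp, ?_⟩
  rw [contDiffOn_zero]
  exact (hΨ.comp (by fun_prop : Continuous fun x : X => (x, x)).continuousOn
    fun x hx => ⟨hx, hx⟩).congr fun x hx => (hd x hx).fderiv

end Slope

/-! ### The exponential mean and Duhamel's formula. -/

namespace NormedSpace

variable {𝔸 : Type*} [NormedRing 𝔸] [NormedAlgebra ℝ 𝔸] [CompleteSpace 𝔸]

/-- The operator `C ↦ ∫₀¹ exp((1-s)a) C exp(sb) ds`. -/
noncomputable def expMean (a b : 𝔸) : 𝔸 →L[ℝ] 𝔸 :=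
  ∫ s in (0 : ℝ)..1, ContinuousLinearMap.mulLeftRight ℝ 𝔸 (exp ((1 - s) • a)) (exp (s • b))

theorem contDiff_exp_algebra {n : WithTop ℕ∞} : ContDiff ℝ n (exp : 𝔸 → 𝔸) :=
  contDiff_iff_contDiffAt.2 fun x => (exp_analytic (𝕂 := ℝ) x).contDiffAt

theorem contDiff_expMean_integrand {n : WithTop ℕ∞} : ContDiff ℝ n fun p : (𝔸 × 𝔸) × ℝ =>
    ContinuousLinearMap.mulLeftRight ℝ 𝔸 (exp ((1 - p.2) • p.1.1)) (exp (p.2 • p.1.2)) := by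
  have h1 : ContDiff ℝ n fun p : (𝔸 × 𝔸) × ℝ => exp ((1 - p.2) • p.1.1) :=
    contDiff_exp_algebra.comp (by fun_prop)
  have h2 : ContDiff ℝ n fun p : (𝔸 × 𝔸) × ℝ => exp (p.2 • p.1.2) :=
    contDiff_exp_algebra.comp (by fun_prop)
  exact ((ContinuousLinearMap.contDiff _).comp h1).clm_apply h2

theorem continuous_expMean : Continuous fun p : 𝔸 × 𝔸 => expMean p.1 p.2 :=
  intervalIntegral.continuous_parametric_intervalIntegral_of_continuous'
    (f := fun (p : 𝔸 × 𝔸) s =>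
      ContinuousLinearMap.mulLeftRight ℝ 𝔸 (exp ((1 - s) • p.1)) (exp (s • p.2)))
    (contDiff_expMean_integrand (n := 0)).continuous 0 1

theorem contDiff_expMean [FiniteDimensional ℝ 𝔸] :
    ContDiff ℝ 1 fun p : 𝔸 × 𝔸 => expMean p.1 p.2 :=
  have : ProperSpace (𝔸 × 𝔸) := FiniteDimensional.proper ℝ _
  contDiff_one_intervalIntegral_of_contDiff contDiff_expMean_integrand 0 1

theorem continuous_expMean_curve (a b : 𝔸) : Continuous fun s : ℝ =>
    ContinuousLinearMap.mulLeftRight ℝ 𝔸 (exp ((1 - s) • a)) (exp (s • b)) := by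
  have hexp : Continuous (exp : 𝔸 → 𝔸) := (contDiff_exp_algebra (n := 0)).continuous
  have h1 : Continuous fun s : ℝ => exp ((1 - s) • a) := hexp.comp (by fun_prop)
  have h2 : Continuous fun s : ℝ => exp (s • b) := hexp.comp (by fun_prop)
  exact ((ContinuousLinearMap.continuous _).comp h1).clm_apply h2

theorem expMean_apply (a b C : 𝔸) :
    expMean a b C = ∫ s in (0 : ℝ)..1, exp ((1 - s) • a) * C * exp (s • b) := by
  rw [expMean, ContinuousLinearMap.intervalIntegral_apply
    ((continuous_expMean_curve a b).intervalIntegrable _ _)]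
  simp

theorem continuous_exp_mul_mul_exp (a b C : 𝔸) :
    Continuous fun s : ℝ => exp ((1 - s) • a) * C * exp (s • b) := by
  simpa using (continuous_expMean_curve a b).clm_apply continuous_const (g := fun _ => C)

/-- A continuous linear functional of the mean is the integral of the functional. -/
theorem map_expMean {F : Type*} [NormedAddCommGroup F] [NormedSpace ℝ F] [CompleteSpace F]
    (L : 𝔸 →L[ℝ] F) (a b C : 𝔸) :
    L (expMean a b C) = ∫ s in (0 : ℝ)..1, L (exp ((1 - s) • a) * C * exp (s • b)) := by
  rw [expMean_apply, ContinuousLinearMap.intervalIntegral_comp_comm L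
    ((continuous_exp_mul_mul_exp a b C).intervalIntegrable _ _)]

/-- Duhamel's formula. -/
theorem expMean_mul_sub_mul (a b C : 𝔸) : expMean a b (a * C - C * b) = exp a * C - C * exp b := by
  -- The mean of `a * C - C * b` integrates minus the derivative of a curve from `exp a * C` to `C *
  -- exp b`.
  have hd : ∀ s : ℝ, HasDerivAt (fun s : ℝ => exp ((1 - s) • a) * C * exp (s • b))
      (-(exp ((1 - s) • a) * (a * C - C * b) * exp (s • b))) s := fun s => by
    have h1 : HasDerivAt (fun s : ℝ => exp ((1 - s) • a)) (-(exp ((1 - s) • a) * a)) s := by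
      have := (hasDerivAt_exp_smul_const a (1 - s)).scomp s ((hasDerivAt_id s).const_sub 1)
      simpa [Function.comp_def] using this
    have h2 : HasDerivAt (fun s : ℝ => exp (s • b)) (b * exp (s • b)) s :=
      hasDerivAt_exp_smul_const' b s
    convert! (h1.mul_const C).mul h2 using 1
    noncomm_ring
  have := intervalIntegral.integral_eq_sub_of_hasDerivAt (fun s _ => hd s)
    ((continuous_exp_mul_mul_exp a b (a * C - C * b)).neg.intervalIntegrable 0 1)
  rw [intervalIntegral.integral_neg, ← expMean_apply] at this
  rw [← neg_neg (expMean a b _), this]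
  simp

end NormedSpace

/-! ### Coercivity and operator inverses in finite dimension. -/

/-- A continuous quadratically homogeneous function that is positive away from the origin of a
finite-dimensional space is coercive. -/
theorem exists_pos_mul_sq_norm_le {V : Type*} [NormedAddCommGroup V] [NormedSpace ℝ V]
    [FiniteDimensional ℝ V] {q : V → ℝ} (hq : Continuous q)
    (hh : ∀ (c : ℝ) v, q (c • v) = c ^ 2 * q v) (hpos : ∀ v, v ≠ 0 → 0 < q v) :
    ∃ c > 0, ∀ v, c * ‖v‖ ^ 2 ≤ q v := by
  have : ProperSpace V := FiniteDimensional.proper ℝ V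
  have h0 : q 0 = 0 := by simpa using hh 0 0
  rcases (Metric.sphere (0 : V) 1).eq_empty_or_nonempty with he | hne
  -- An empty unit sphere means a trivial space, which does occur: `cl0 0` is zero.
  · refine ⟨1, one_pos, fun v => ?_⟩
    have hv : v = 0 := by
      by_contra hv
      have : ‖v‖⁻¹ • v ∈ Metric.sphere (0 : V) 1 := by
        simp [norm_smul, inv_mul_cancel₀ (norm_ne_zero_iff.2 hv)]
      rw [he] at this
      exact this
    rw [hv, h0]; simp
  · obtain ⟨w, hw, hmin⟩ := (isCompact_sphere (0 : V) 1).exists_isMinOn hne hq.continuousOn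
    have hw0 : w ≠ 0 := by rintro rfl; simp at hw
    refine ⟨q w, hpos w hw0, fun v => ?_⟩
    by_cases hv : v = 0
    · rw [hv, h0]; simp
    have hn : ‖v‖ ≠ 0 := norm_ne_zero_iff.2 hv
    have hs : ‖v‖⁻¹ • v ∈ Metric.sphere (0 : V) 1 := by
      simp [norm_smul, inv_mul_cancel₀ hn]
    have h1 : q w ≤ q (‖v‖⁻¹ • v) := hmin hs
    rw [hh] at h1
    calc q w * ‖v‖ ^ 2 ≤ (‖v‖⁻¹ ^ 2 * q v) * ‖v‖ ^ 2 := by gcongr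
      _ = q v := by field_simp

theorem ContinuousLinearMap.isUnit_of_injective {V : Type*} [NormedAddCommGroup V]
    [NormedSpace ℝ V] [FiniteDimensional ℝ V] {f : V →L[ℝ] V} (hf : ∀ v, f v = 0 → v = 0) :
    IsUnit f := by
  have : CompleteSpace V := FiniteDimensional.complete ℝ V
  rw [ContinuousLinearMap.isUnit_iff_bijective]
  have hi : Function.Injective (f : V →ₗ[ℝ] V) := (injective_iff_map_eq_zero _).2 hf
  exact ⟨hi, LinearMap.injective_iff_surjective.1 hi⟩

section

variable {X Y 𝔸 V : Type*} [TopologicalSpace X] [NormedAddCommGroup Y] [NormedSpace ℝ Y]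
  [NormedRing 𝔸] [NormedAlgebra ℝ 𝔸] [CompleteSpace 𝔸]
  [NormedAddCommGroup V] [NormedSpace ℝ V] [CompleteSpace V]

theorem ContinuousOn.expMean [FiniteDimensional ℝ 𝔸] {f g : X → 𝔸} {s : Set X}
    (hf : ContinuousOn f s) (hg : ContinuousOn g s) :
    ContinuousOn (fun x => NormedSpace.expMean (f x) (g x)) s :=
  Continuous.comp_continuousOn (g := fun p : 𝔸 × 𝔸 => NormedSpace.expMean p.1 p.2)
    (f := fun x => (f x, g x)) NormedSpace.continuous_expMean (hf.prodMk hg)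

theorem ContDiffOn.expMean [FiniteDimensional ℝ 𝔸] {f g : Y → 𝔸} {s : Set Y}
    (hf : ContDiffOn ℝ 1 f s) (hg : ContDiffOn ℝ 1 g s) :
    ContDiffOn ℝ 1 (fun x => NormedSpace.expMean (f x) (g x)) s :=
  ContDiff.comp_contDiffOn (g := fun p : 𝔸 × 𝔸 => NormedSpace.expMean p.1 p.2)
    (f := fun x => (f x, g x)) NormedSpace.contDiff_expMean (hf.prodMk hg)

theorem ContinuousOn.clm_ringInverse {f : X → V →L[ℝ] V} {s : Set X} (hf : ContinuousOn f s)
    (h : ∀ x ∈ s, IsUnit (f x)) : ContinuousOn (fun x => Ring.inverse (f x)) s := by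
  intro x hx
  obtain ⟨u, hu⟩ := h x hx
  have h1 := NormedRing.inverse_continuousAt u
  rw [hu] at h1
  exact h1.comp_continuousWithinAt (hf x hx)

theorem ContDiffOn.clm_ringInverse {f : Y → V →L[ℝ] V} {s : Set Y} {k : WithTop ℕ∞}
    (hf : ContDiffOn ℝ k f s) (h : ∀ x ∈ s, IsUnit (f x)) :
    ContDiffOn ℝ k (fun x => Ring.inverse (f x)) s := by
  intro x hx
  obtain ⟨u, hu⟩ := h x hx
  have h1 := contDiffAt_ringInverse ℝ (n := k) u
  rw [hu] at h1
  exact h1.comp_contDiffWithinAt x (hf x hx)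

end

/-! ### Convex sets invariant under a semigroup, and transfer of limits. -/

namespace LocalMetric

variable {E : Type*} [NormedAddCommGroup E] [NormedSpace ℝ E] [CompleteSpace E]

/-- The semigroup generated by `P - 1` preserves every closed convex set that `P` preserves. -/
theorem flow_mem_of_convex {K : Set E} (hK : Convex ℝ K) (hKc : IsClosed K) {P : E →L[ℝ] E}
    (hP : ∀ x ∈ K, P x ∈ K) {s : ℝ} (hs : 0 ≤ s) {x : E} (hx : x ∈ K) :
    flow (1 - P) s x ∈ K := by
  have hPk : ∀ k : ℕ, (P ^ k) x ∈ K := fun k => by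
    induction k with
    | zero => simpa using hx
    | succ k ih => rw [pow_succ', mul_apply_eq_comp]; exact hP _ ih
  have hsum : HasSum (fun k : ℕ => ((k.factorial : ℝ)⁻¹ * s ^ k) • (P ^ k) x)
      (NormedSpace.exp (s • P) x) := by
    have h := NormedSpace.exp_series_hasSum_exp' (𝕂 := ℝ) (s • P)
    have h2 := h.mapL (ContinuousLinearMap.apply ℝ E x)
    simpa [smul_pow, smul_smul] using h2
  have hexp : HasSum (fun k : ℕ => (k.factorial : ℝ)⁻¹ * s ^ k) (Real.exp s) := by
    have h := NormedSpace.exp_series_hasSum_exp' (𝕂 := ℝ) s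
    rw [← Real.exp_eq_exp_ℝ] at h
    simpa using h
  have hflow : flow (1 - P) s x = (Real.exp s)⁻¹ • NormedSpace.exp (s • P) x := by
    have hc : Commute (-(s • (1 : E →L[ℝ] E))) (s • P) :=
      (((Commute.one_left P).smul_left s).smul_right s).neg_left
    have e : s • -(1 - P) = -(s • (1 : E →L[ℝ] E)) + s • P := by module
    have e2 : NormedSpace.exp (-(s • (1 : E →L[ℝ] E))) = (Real.exp s)⁻¹ • 1 := by
      let _ : NormedAlgebra ℚ (E →L[ℝ] E) := .restrictScalars ℚ ℝ _
      have := NormedSpace.algebraMap_exp_comm (𝕂 := ℝ) (𝔸 := E →L[ℝ] E) (-s)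
      rw [← Real.exp_eq_exp_ℝ, Algebra.algebraMap_eq_smul_one, Algebra.algebraMap_eq_smul_one,
        Real.exp_neg, neg_smul] at this
      exact this.symm
    let _ : NormedAlgebra ℚ (E →L[ℝ] E) := .restrictScalars ℚ ℝ _
    rw [flow, e, NormedSpace.exp_add_of_commute hc, e2, smul_mul_assoc, one_mul,
      _root_.smul_apply]
  rw [hflow]
  -- The partial sums of the operator series are divided by those of the scalar series, not by `exp
  -- s`, so that each approximant is a convex combination of the points `P ^ k x`.
  have hlim := (hexp.tendsto_sum_nat.inv₀ (Real.exp_pos s).ne').smul hsum.tendsto_sum_nat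
  refine hKc.mem_of_tendsto hlim ((eventually_ge_atTop 1).mono fun m hm => ?_)
  have hpos : 0 < ∑ k ∈ Finset.range m, (k.factorial : ℝ)⁻¹ * s ^ k :=
    Finset.sum_pos' (fun k _ => by positivity) ⟨0, Finset.mem_range.2 hm, by simp⟩
  have := hK.centerMass_mem (t := Finset.range m) (w := fun k => (k.factorial : ℝ)⁻¹ * s ^ k)
    (z := fun k => (P ^ k) x) (fun k _ => by positivity) hpos fun k _ => hPk k
  simpa [Finset.centerMass] using this

end LocalMetric

theorem HasFDerivAt.hasDerivAt_add_smul {V W : Type*} [NormedAddCommGroup V] [NormedSpace ℝ V]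
    [NormedAddCommGroup W] [NormedSpace ℝ W] {f : V → W} {f' : V →L[ℝ] W} {x : V}
    (h : HasFDerivAt f f' x) (v : V) : HasDerivAt (fun t : ℝ => f (x + t • v)) (f' v) 0 :=
  h.hasLineDerivAt v

/-- This computes an extension by limits in a chart `φ`; it is used to pass from pairs of densities
to pairs in `cl0 n`. -/
theorem extendFrom_eq_of_tendsto {X Y Z : Type*} [TopologicalSpace X] [TopologicalSpace Y]
    [TopologicalSpace Z] [T2Space Z] {A : Set X} {B : Set Y} {f : X → Z} {r : Y → Z} {φ : X → Y}
    {p : X} {l : Z} (hp : p ∈ closure A) (hφ : ContinuousAt φ p) (hφB : MapsTo φ A B)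
    (hf : ∀ x ∈ A, f x = r (φ x)) (hr : Tendsto r (𝓝[B] φ p) (𝓝 l)) : extendFrom A f p = l := by
  have h1 : Tendsto φ (𝓝[A] p) (𝓝[B] φ p) :=
    tendsto_nhdsWithin_iff.2 ⟨hφ.tendsto.mono_left nhdsWithin_le_nhds,
      eventually_of_mem self_mem_nhdsWithin hφB⟩
  exact extendFrom_eq hp ((hr.comp h1).congr'
    (eventually_of_mem self_mem_nhdsWithin fun x hx => (hf x hx).symm))

theorem tendsto_uncurry_comp {X Y Z W : Type*} {r : X → Y → Z} {f : W → X} {g : W → Y}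
    {F : Filter (X × Y)} {G : Filter W} {H : Filter Z}
    (hr : Tendsto (fun p : X × Y => r p.1 p.2) F H) (h : Tendsto (fun w => (f w, g w)) G F) :
    Tendsto (fun w => r (f w) (g w)) G H :=
  hr.comp h

namespace FermiClifford

open scoped Matrix.Norms.L2Operator MatrixOrder ComplexOrder
open NormedSpace (expMean)
open LocalMetric

variable {n : ℕ}

/-! ### The grading and the derivations -/

theorem parity_mul_self : tensor (fun _ : Fin n => matU) * tensor (fun _ => matU) = 1 := by
  rw [tensor_mul, matU_mul_matU, tensor_one]

theorem conjTranspose_parity : (tensor (fun _ : Fin n => matU))ᴴ = tensor (fun _ => matU) :=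
  conjTranspose_tensor _ fun _ => conjTranspose_matU

theorem conjTranspose_grading (A : Op n) : (grading A)ᴴ = grading Aᴴ := by
  simp only [grading, Matrix.conjTranspose_mul, conjTranspose_parity, mul_assoc]

theorem grading_grading (A : Op n) : grading (grading A) = A := by
  simp only [grading]
  calc _ = tensor (fun _ : Fin n => matU) * tensor (fun _ => matU) * A *
        (tensor (fun _ => matU) * tensor (fun _ => matU)) := by simp only [mul_assoc]
    _ = A := by rw [parity_mul_self, one_mul, mul_one]

/-- The grading as a homomorphism of star algebras. -/
noncomputable def gradingHom (n : ℕ) : Op n →⋆ₐ[ℂ] Op n where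
  toFun := grading
  map_one' := grading_one
  map_mul' := grading_mul
  map_zero' := by simp [grading]
  map_add' A B := by simp [grading, mul_add, add_mul]
  commutes' r := by
    rw [Algebra.algebraMap_eq_smul_one]
    simp only [grading, mul_smul_comm, smul_mul_assoc, mul_one, parity_mul_self]
  map_star' A := (conjTranspose_grading A).symm

theorem grading_add (A B : Op n) : grading (A + B) = grading A + grading B :=
  map_add (gradingHom n) A B

theorem grading_sub (A B : Op n) : grading (A - B) = grading A - grading B :=
  map_sub (gradingHom n) A B

theorem grading_smul (c : ℂ) (A : Op n) : grading (c • A) = c • grading A :=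
  map_smul (gradingHom n) c A

theorem trace_grading (A : Op n) : (grading A).trace = A.trace := by
  rw [grading, Matrix.trace_mul_comm, ← mul_assoc, parity_mul_self, one_mul]

theorem grading_pderiv (i : Fin n) (A : Op n) :
    grading (pderiv i A) = (2⁻¹ : ℂ) • (A * gen i - gen i * grading A) := by
  rw [pderiv, grading_smul, grading_sub, grading_mul, grading_mul, grading_gen, grading_grading]
  congr 1
  noncomm_ring

theorem conjTranspose_pderiv (i : Fin n) (A : Op n) :
    (pderiv i A)ᴴ = grading (pderiv i Aᴴ) := by
  rw [grading_pderiv, pderiv, Matrix.conjTranspose_smul, Matrix.conjTranspose_sub,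
    Matrix.conjTranspose_mul, Matrix.conjTranspose_mul, conjTranspose_gen, conjTranspose_grading]
  simp

theorem conjTranspose_pderivAdj (i : Fin n) (A : Op n) :
    (pderivAdj i A)ᴴ = pderivAdj i (grading A)ᴴ := by
  rw [pderivAdj, pderivAdj, Matrix.conjTranspose_smul, Matrix.conjTranspose_add,
    Matrix.conjTranspose_mul, Matrix.conjTranspose_mul, conjTranspose_gen, ← conjTranspose_grading,
    grading_grading, add_comm]
  simp

/-- The derivation `∇ᵢ` as a linear map. -/
noncomputable def pderivL (i : Fin n) : Op n →ₗ[ℂ] Op n where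
  toFun := pderiv i
  map_add' A B := by
    simp only [pderiv, grading_add, ← smul_add, mul_add, add_mul, add_sub_add_comm]
  map_smul' c A := by
    simp only [pderiv, grading_smul, mul_smul_comm, smul_mul_assoc, ← smul_sub, RingHom.id_apply]
    rw [smul_comm]

/-- The adjoint `∇ᵢ*` as a linear map. -/
noncomputable def pderivAdjL (i : Fin n) : Op n →ₗ[ℂ] Op n where
  toFun := pderivAdj i
  map_add' A B := by
    simp only [pderivAdj, grading_add, ← smul_add, mul_add, add_mul, add_add_add_comm]
  map_smul' c A := by
    simp only [pderivAdj, grading_smul, mul_smul_comm, smul_mul_assoc, ← smul_add, RingHom.id_apply]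
    rw [smul_comm]

/-- The map `A ↦ Qᵢ Γ(A) Qᵢ` is a trace-preserving automorphism. Its appearance here gives both the
kernel of the gradient and the positivity of the semigroup. -/
theorem pderivAdj_pderiv (i : Fin n) (A : Op n) :
    pderivAdj i (pderiv i A) = (2⁻¹ : ℂ) • (A - gen i * grading A * gen i) := by
  rw [pderivAdj, grading_pderiv, pderiv]
  simp only [mul_smul_comm, smul_mul_assoc, ← smul_add, smul_smul, mul_sub, sub_mul]
  rw [← mul_assoc, gen_mul_self, mul_assoc A, gen_mul_self, one_mul, mul_one]
  have : A - gen i * (grading A * gen i) + (A - gen i * grading A * gen i) =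
      (2 : ℂ) • (A - gen i * grading A * gen i) := by rw [two_smul, mul_assoc]
  rw [this, smul_smul]
  norm_num

/-! ### The normalized trace -/

/-- The normalized trace as a linear functional. -/
noncomputable def tauL (n : ℕ) : Op n →ₗ[ℂ] ℂ := ((2 : ℂ) ^ n)⁻¹ • Matrix.traceLinearMap _ ℂ ℂ

theorem tau_mul_comm (A B : Op n) : tau (A * B) = tau (B * A) := by
  rw [tau, tau, Matrix.trace_mul_comm]

theorem tau_grading (A : Op n) : tau (grading A) = tau A := by rw [tau, tau, trace_grading]

theorem tau_conjTranspose (A : Op n) : tau Aᴴ = star (tau A) := by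
  rw [tau, tau, Matrix.trace_conjTranspose, star_mul']
  simp

theorem tau_one : tau (1 : Op n) = 1 := by
  simp [tau, Matrix.trace_one, Fintype.card_pi]

theorem tau_add (A B : Op n) : tau (A + B) = tau A + tau B := map_add (tauL n) A B

theorem tau_sub (A B : Op n) : tau (A - B) = tau A - tau B := map_sub (tauL n) A B

theorem tau_neg (A : Op n) : tau (-A) = -tau A := map_neg (tauL n) A

theorem tau_smul (c : ℂ) (A : Op n) : tau (c • A) = c * tau A := map_smul (tauL n) c A

theorem tau_sum {ι : Type*} (s : Finset ι) (f : ι → Op n) :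
    tau (∑ i ∈ s, f i) = ∑ i ∈ s, tau (f i) := map_sum (tauL n) f s

/-- The real part of the normalized trace, as a continuous real linear functional. -/
noncomputable def tauRe (n : ℕ) : Op n →L[ℝ] ℝ :=
  LinearMap.toContinuousLinearMap (Complex.reLm ∘ₗ (tauL n).restrictScalars ℝ)

theorem tauRe_apply (A : Op n) : tauRe n A = (tau A).re := rfl

theorem tauRe_nonneg {A : Op n} (hA : 0 ≤ A) : 0 ≤ tauRe n A := by
  have h := (Matrix.nonneg_iff_posSemidef.1 hA).trace_nonneg
  have h2 : (0 : ℂ) ≤ ((2 : ℂ) ^ n)⁻¹ := by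
    have : ((2 : ℂ) ^ n)⁻¹ = (((2 : ℝ) ^ n)⁻¹ : ℝ) := by push_cast; rfl
    rw [this]
    exact Complex.zero_le_real.2 (by positivity)
  exact (Complex.le_def.1 (mul_nonneg h2 h)).1

theorem tauRe_star_mul_self_nonneg (A : Op n) : 0 ≤ tauRe n (Aᴴ * A) :=
  tauRe_nonneg (star_mul_self_nonneg A)

theorem eq_zero_of_tau_mul_star {A : Op n} (h : tau (A * Aᴴ) = 0) : A = 0 := by
  have h2 : (A * Aᴴ).trace = 0 := by
    rcases mul_eq_zero.1 h with h | h
    · simp at h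
    · exact h
  exact Matrix.trace_mul_conjTranspose_self_eq_zero_iff.1 h2

/-- With `B = C* C`, cyclicity turns the trace into that of `C A C* ≥ 0`. -/
theorem tauRe_mul_nonneg {A B : Op n} (hA : 0 ≤ A) (hB : 0 ≤ B) : 0 ≤ tauRe n (A * B) := by
  obtain ⟨C, rfl⟩ := CStarAlgebra.nonneg_iff_eq_star_mul_self.1 hB
  rw [tauRe_apply, ← mul_assoc, tau_mul_comm, ← mul_assoc]
  exact tauRe_nonneg (by simpa using star_left_conjugate_nonneg hA (star C))

/-! ### The Clifford algebra -/

theorem gen_mem_Cl (i : Fin n) : gen i ∈ Cl n := Algebra.subset_adjoin ⟨i, rfl⟩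

theorem conjTranspose_mem_Cl {A : Op n} (hA : A ∈ Cl n) : Aᴴ ∈ Cl n := by
  induction hA using Algebra.adjoin_induction with
  | mem A h =>
    obtain ⟨i, rfl⟩ := h
    rw [conjTranspose_gen]
    exact gen_mem_Cl i
  | algebraMap r =>
    rw [Algebra.algebraMap_eq_smul_one, Matrix.conjTranspose_smul, Matrix.conjTranspose_one]
    exact (Cl n).smul_mem (one_mem _) _
  | add A B _ _ h1 h2 =>
    rw [Matrix.conjTranspose_add]
    exact add_mem h1 h2
  | mul A B _ _ h1 h2 =>
    rw [Matrix.conjTranspose_mul]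
    exact mul_mem h2 h1

theorem grading_mem_Cl {A : Op n} (hA : A ∈ Cl n) : grading A ∈ Cl n := by
  induction hA using Algebra.adjoin_induction with
  | mem A h =>
    obtain ⟨i, rfl⟩ := h
    rw [grading_gen]
    exact neg_mem (gen_mem_Cl i)
  | algebraMap r =>
    rw [Algebra.algebraMap_eq_smul_one, grading_smul, grading_one]
    exact (Cl n).smul_mem (one_mem _) _
  | add A B _ _ h1 h2 =>
    rw [grading_add]
    exact add_mem h1 h2
  | mul A B _ _ h1 h2 =>
    rw [grading_mul]
    exact mul_mem h1 h2

theorem pderiv_mem_Cl (i : Fin n) {A : Op n} (hA : A ∈ Cl n) : pderiv i A ∈ Cl n :=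
  (Cl n).smul_mem (sub_mem (mul_mem (gen_mem_Cl i) hA) (mul_mem (grading_mem_Cl hA) (gen_mem_Cl i)))
    _

theorem pderivAdj_mem_Cl (i : Fin n) {A : Op n} (hA : A ∈ Cl n) : pderivAdj i A ∈ Cl n :=
  (Cl n).smul_mem (add_mem (mul_mem (gen_mem_Cl i) hA) (mul_mem (grading_mem_Cl hA) (gen_mem_Cl i)))
    _

/-- The Clifford algebra as a star subalgebra. -/
noncomputable def ClStar (n : ℕ) : StarSubalgebra ℂ (Op n) :=
  { Cl n with star_mem' := fun hA => conjTranspose_mem_Cl hA }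

theorem isClosed_Cl : IsClosed (Cl n : Set (Op n)) :=
  Submodule.closed_of_finiteDimensional (Subalgebra.toSubmodule (Cl n))

theorem cfc_mem_Cl (f : ℝ → ℝ) {A : Op n} (hA : A ∈ Cl n) : cfc f A ∈ Cl n := by
  have : IsClosed (ClStar n : Set (Op n)) := isClosed_Cl
  exact cfc_mem (𝕜' := ℂ) (s := ClStar n) f hA

/-! ### Elements of the Clifford algebra with vanishing gradient are scalar -/

/-- The product of the generators in a list. -/
noncomputable def word (l : List (Fin n)) : Op n := (l.map gen).prod

theorem gen_mul_gen_of_ne {i j : Fin n} (h : i ≠ j) : gen i * gen j = -(gen j * gen i) := by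
  have := gen_anticomm i j
  rw [if_neg h] at this
  exact eq_neg_of_add_eq_zero_left this

/-- The automorphism `X ↦ Qᵢ Γ(X) Qᵢ` negates `Qᵢ` and fixes every other generator. -/
theorem gen_mul_grading_word_mul_gen (i : Fin n) (l : List (Fin n)) :
    gen i * grading (word l) * gen i = (-1 : ℂ) ^ l.count i • word l := by
  induction l with
  | nil => simp [word, grading_one, gen_mul_self]
  | cons j l ih =>
    have hs : gen i * grading (word (j :: l)) * gen i =
        (gen i * grading (gen j) * gen i) * (gen i * grading (word l) * gen i) := by
      have : word (j :: l) = gen j * word l := by simp [word]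
      rw [this, grading_mul]
      calc _ = gen i * grading (gen j) * 1 * grading (word l) * gen i := by
            simp only [mul_one, mul_assoc]
        _ = _ := by rw [← gen_mul_self i]; simp only [mul_assoc]
    have hw : word (j :: l) = gen j * word l := by simp [word]
    rw [hs, ih, grading_gen, hw, List.count_cons]
    by_cases h : j = i
    · subst h
      simp [gen_mul_self, pow_succ]
    · have : gen i * -gen j * gen i = gen j := by
        rw [mul_neg, gen_mul_gen_of_ne (Ne.symm h), neg_neg, mul_assoc, gen_mul_self, mul_one]
      rw [this]
      simp [h]

/-- Moving all copies of `Qᵢ` to the front changes only the sign. -/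
theorem exists_word_eq_smul (i : Fin n) (l : List (Fin n)) : ∃ ε : ℂ, ε ≠ 0 ∧
    word l = ε • (gen i ^ l.count i * word (l.filter (· ≠ i))) := by
  induction l with
  | nil => exact ⟨1, one_ne_zero, by simp [word]⟩
  | cons j l ih =>
    obtain ⟨ε, hε, h⟩ := ih
    have hw : ∀ l', word (j :: l') = gen j * word l' := fun l' => by simp [word]
    by_cases hj : j = i
    · subst hj
      refine ⟨ε, hε, ?_⟩
      rw [hw, h]
      simp [pow_succ', mul_assoc]
    · have hc : ∀ k : ℕ, gen j * gen i ^ k = (-1 : ℂ) ^ k • (gen i ^ k * gen j) := by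
        intro k
        induction k with
        | zero => simp
        | succ k ihk =>
          rw [pow_succ (gen i), ← mul_assoc, ihk, smul_mul_assoc, mul_assoc, gen_mul_gen_of_ne hj,
            pow_succ]
          simp [mul_assoc]
      refine ⟨ε * (-1) ^ l.count i, mul_ne_zero hε (by simp), ?_⟩
      have hf : (j :: l).filter (· ≠ i) = j :: l.filter (· ≠ i) := by simp [hj]
      rw [hw, h, hf, hw, List.count_cons_of_ne hj, mul_smul_comm, ← mul_assoc, hc, smul_mul_assoc,
        smul_smul, mul_assoc]

theorem exists_word_eq_smul_one (l : List (Fin n)) (hl : ∀ i, Even (l.count i)) :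
    ∃ ε : ℂ, word l = ε • 1 := by
  induction h : l.length using Nat.strong_induction_on generalizing l with
  | _ k ih =>
    match l, hl, h with
    | [], _, _ => exact ⟨1, by simp [word]⟩
    | i :: l', hl, h =>
      obtain ⟨ε, _, he⟩ := exists_word_eq_smul i (i :: l')
      have hpow : gen i ^ (i :: l').count i = 1 := by
        obtain ⟨m, hm⟩ := hl i
        rw [hm, ← two_mul, pow_mul, pow_two, gen_mul_self, one_pow]
      have hlen : ((i :: l').filter (· ≠ i)).length < k := by
        rw [← h]
        simpa using Nat.lt_succ_of_le (List.length_filter_le _ _)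
      obtain ⟨δ, hδ⟩ := ih _ hlen ((i :: l').filter (· ≠ i)) (fun j => by
        by_cases hj : j = i
        · subst hj
          rw [List.count_eq_zero_of_not_mem (by simp)]
          exact Even.zero
        · rw [List.count_filter (by simpa using hj)]
          exact hl j) rfl
      exact ⟨ε * δ, by rw [he, hpow, one_mul, hδ, smul_smul]⟩

theorem exists_word_of_mem_closure {A : Op n}
    (hA : A ∈ Submonoid.closure (Set.range (gen (n := n)))) : ∃ l, A = word l := by
  induction hA using Submonoid.closure_induction with
  | mem A h =>
    obtain ⟨i, rfl⟩ := h
    exact ⟨[i], by simp [word]⟩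
  | one => exact ⟨[], by simp [word]⟩
  | mul A B _ _ h1 h2 =>
    obtain ⟨l1, rfl⟩ := h1
    obtain ⟨l2, rfl⟩ := h2
    exact ⟨l1 ++ l2, by simp [word]⟩

/-- If `∇ᵢ U = 0`, then `U` is fixed by `X ↦ Qᵢ Γ(X) Qᵢ`. This map preserves `τ` and negates the
words with an odd number of `Qᵢ`, so they are orthogonal to `U`. A word with only even
multiplicities is scalar, and `τ(U) = 0` applies. Words span the algebra. -/
theorem tau_mul_eq_zero_of_pderiv_eq_zero {U A : Op n} (hU : ∀ i, pderiv i U = 0)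
    (h0 : tau U = 0) (hA : A ∈ Cl n) : tau (U * A) = 0 := by
  have hfix : ∀ i, gen i * grading U * gen i = U := fun i => by
    have h := pderivAdj_pderiv i U
    rw [hU i, show pderivAdj i (0 : Op n) = 0 from map_zero (pderivAdjL i)] at h
    have := (smul_eq_zero.1 h.symm).resolve_left (by norm_num)
    exact (sub_eq_zero.1 this).symm
  have hw : ∀ l : List (Fin n), tau (U * word l) = 0 := by
    intro l
    by_cases hl : ∀ i, Even (l.count i)
    · obtain ⟨ε, h⟩ := exists_word_eq_smul_one l hl
      rw [h, mul_smul_comm, mul_one, tau_smul, h0, mul_zero]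
    · push Not at hl
      obtain ⟨i, hi⟩ := hl
      have h1 : tau (gen i * grading (U * word l) * gen i) = tau (U * word l) := by
        rw [tau_mul_comm, ← mul_assoc, gen_mul_self, one_mul, tau_grading]
      have h2 : gen i * grading (U * word l) * gen i = -(U * word l) := by
        have : gen i * grading (U * word l) * gen i =
            (gen i * grading U * gen i) * (gen i * grading (word l) * gen i) := by
          rw [grading_mul]
          calc _ = gen i * grading U * 1 * grading (word l) * gen i := by
                simp only [mul_one, mul_assoc]
            _ = _ := by rw [← gen_mul_self i]; simp only [mul_assoc]
        rw [this, hfix, gen_mul_grading_word_mul_gen,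
          (Nat.not_even_iff_odd.1 hi).neg_one_pow]
        simp
      rw [h2, tau_neg] at h1
      exact self_eq_neg.1 h1.symm
  rw [Cl, ← Subalgebra.mem_toSubmodule, Algebra.adjoin_eq_span] at hA
  induction hA using Submodule.span_induction with
  | mem A h =>
    obtain ⟨l, rfl⟩ := exists_word_of_mem_closure h
    exact hw l
  | zero => rw [mul_zero]; exact map_zero (tauL n)
  | add A B _ _ h1 h2 => rw [mul_add, tau_add, h1, h2, add_zero]
  | smul c A _ h => rw [mul_smul_comm, tau_smul, h, mul_zero]

theorem eq_zero_of_pderiv_eq_zero {U : Op n} (hUC : U ∈ Cl n) (hU : ∀ i, pderiv i U = 0)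
    (h0 : tau U = 0) : U = 0 :=
  eq_zero_of_tau_mul_star (tau_mul_eq_zero_of_pderiv_eq_zero hU h0 (conjTranspose_mem_Cl hUC))

/-! ### Functional calculus of strictly positive matrices -/

theorem isSelfAdjoint_of_algebraMap_le {A : Op n} {c : ℝ} (hA : algebraMap ℝ (Op n) c ≤ A) :
    IsSelfAdjoint A := by
  have h := (IsSelfAdjoint.of_nonneg (sub_nonneg.2 hA)).add (IsSelfAdjoint.algebraMap (Op n)
    (IsSelfAdjoint.all c))
  simpa using h

theorem le_of_mem_spectrum {A : Op n} {c : ℝ} (hA : algebraMap ℝ (Op n) c ≤ A) {x : ℝ}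
    (hx : x ∈ spectrum ℝ A) : c ≤ x :=
  (algebraMap_le_iff_le_spectrum (ha := isSelfAdjoint_of_algebraMap_le hA)).1 hA x hx

theorem nonneg_of_algebraMap_le {A : Op n} {c : ℝ} (hc : 0 ≤ c)
    (hA : algebraMap ℝ (Op n) c ≤ A) : 0 ≤ A :=
  le_trans (by rw [← map_zero (algebraMap ℝ (Op n))]; exact algebraMap_mono _ hc) hA

theorem isUnit_of_algebraMap_le {A : Op n} {c : ℝ} (hc : 0 < c)
    (hA : algebraMap ℝ (Op n) c ≤ A) : IsUnit A :=
  spectrum.zero_notMem_iff ℝ |>.1 fun h => (hc.trans_le (le_of_mem_spectrum hA h)).ne rfl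

theorem exp_log_of_algebraMap_le {A : Op n} {c : ℝ} (hc : 0 < c)
    (hA : algebraMap ℝ (Op n) c ≤ A) : NormedSpace.exp (CFC.log A) = A :=
  CFC.exp_log A
    (IsStrictlyPositive.iff_of_unital.2
      ⟨nonneg_of_algebraMap_le hc.le hA, isUnit_of_algebraMap_le hc hA⟩)

/-- This turns `sharp` into `expMean` of logarithms, to which Duhamel's formula applies. -/
theorem power_eq_exp {A : Op n} {c : ℝ} (hc : 0 < c) (hA : algebraMap ℝ (Op n) c ≤ A) (s : ℝ) :
    power A s = NormedSpace.exp (s • CFC.log A) := by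
  have hsa := isSelfAdjoint_of_algebraMap_le hA
  have hpos : ∀ x ∈ spectrum ℝ A, 0 < x := fun x hx => hc.trans_le (le_of_mem_spectrum hA hx)
  have hlog : ContinuousOn Real.log (spectrum ℝ A) :=
    Real.continuousOn_log.mono fun x hx => (hpos x hx).ne'
  rw [power, CFC.log, ← cfc_const_mul s Real.log A hlog,
    ← CFC.real_exp_eq_normedSpace_exp (cfc_predicate _ A),
    ← cfc_comp' Real.exp (fun x => s * Real.log x) A Real.continuous_exp.continuousOn
      (continuousOn_const.mul hlog)]
  refine cfc_congr fun x hx => ?_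
  rw [Real.rpow_def_of_pos (hpos x hx), mul_comm]

theorem algebraMap_rpow_le_power {A : Op n} {c : ℝ} (hc : 0 < c)
    (hA : algebraMap ℝ (Op n) c ≤ A) {s : ℝ} (hs : 0 ≤ s) :
    algebraMap ℝ (Op n) (c ^ s) ≤ power A s := by
  have hsa := isSelfAdjoint_of_algebraMap_le hA
  refine algebraMap_le_cfc _ _ A (fun x hx => ?_) ?_ hsa
  · exact Real.rpow_le_rpow hc.le (le_of_mem_spectrum hA hx) hs
  · exact continuousOn_id.rpow_const fun x hx => Or.inr hs

theorem grading_cfc (f : ℝ → ℝ) {A : Op n} (hA : IsSelfAdjoint A) :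
    grading (cfc f A) = cfc f (grading A) := by
  have hc : Continuous (gradingHom n) :=
    LinearMap.continuous_of_finiteDimensional (gradingHom n).toAlgHom.toLinearMap
  have h2 : IsSelfAdjoint (gradingHom n A) := hA.map (gradingHom n)
  have hfin : (spectrum ℝ A).Finite := by
    rw [Matrix.IsHermitian.spectrum_real_eq_range_eigenvalues (A := A) hA]
    exact finite_range _
  exact StarAlgHomClass.map_cfc (S := ℂ) (gradingHom n) f A (hfin.continuousOn f) hc hA h2

theorem algebraMap_le_grading {A : Op n} {c : ℝ} (hA : algebraMap ℝ (Op n) c ≤ A) :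
    algebraMap ℝ (Op n) c ≤ grading A := by
  have h := star_right_conjugate_nonneg (sub_nonneg.2 hA) (tensor fun _ : Fin n => matU)
  have e : grading (algebraMap ℝ (Op n) c) = algebraMap ℝ (Op n) c := by
    rw [Algebra.algebraMap_eq_smul_one]
    simp only [grading, mul_smul_comm, smul_mul_assoc, mul_one, parity_mul_self]
  rw [← sub_nonneg, ← e, ← grading_sub]
  rwa [Matrix.star_eq_conjTranspose, conjTranspose_parity] at h

theorem grading_log {A : Op n} (hA : IsSelfAdjoint A) :
    grading (CFC.log A) = CFC.log (grading A) := grading_cfc _ hA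

theorem sharp_eq_expMean {A B : Op n} {c : ℝ} (hc : 0 < c) (hA : algebraMap ℝ (Op n) c ≤ A)
    (hB : algebraMap ℝ (Op n) c ≤ B) (C : Op n) :
    sharp A B C = expMean (CFC.log A) (CFC.log B) C := by
  ext x y
  have := NormedSpace.map_expMean
    (LinearMap.toContinuousLinearMap (Matrix.entryLinearMap ℝ ℂ x y)) (CFC.log A) (CFC.log B) C
  simp only [LinearMap.coe_toContinuousLinearMap', Matrix.entryLinearMap_apply] at this
  rw [this]
  simp only [sharp, Matrix.of_apply, power_eq_exp hc hA, power_eq_exp hc hB]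

/-! ### The logarithmic mean of left and right multiplication -/

/-- `X` is replaced by `a` and then `Y` by `b`; each error is the trace of a product of two
nonnegative matrices. -/
theorem tauRe_conj_mul_ge {X Y C : Op n} {a b : ℝ} (ha : 0 ≤ a) (hb : 0 ≤ b)
    (hX : algebraMap ℝ (Op n) a ≤ X) (hY : algebraMap ℝ (Op n) b ≤ Y) :
    a * b * tauRe n (Cᴴ * C) ≤ tauRe n (Cᴴ * (X * C * Y)) := by
  have h1 : 0 ≤ tauRe n (Cᴴ * (X - algebraMap ℝ (Op n) a) * C * Y) :=
    tauRe_mul_nonneg (star_left_conjugate_nonneg (sub_nonneg.2 hX) C)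
      (nonneg_of_algebraMap_le hb hY)
  have h2 : 0 ≤ tauRe n (Cᴴ * C * (Y - algebraMap ℝ (Op n) b)) :=
    tauRe_mul_nonneg (star_mul_self_nonneg C) (sub_nonneg.2 hY)
  have e1 : Cᴴ * (X - algebraMap ℝ (Op n) a) * C * Y =
      Cᴴ * (X * C * Y) - a • (Cᴴ * C * Y) := by
    rw [Algebra.algebraMap_eq_smul_one]
    simp only [mul_sub, sub_mul, mul_assoc, mul_smul_comm, smul_mul_assoc, one_mul]
  have e2 : Cᴴ * C * (Y - algebraMap ℝ (Op n) b) = Cᴴ * C * Y - b • (Cᴴ * C) := by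
    rw [Algebra.algebraMap_eq_smul_one]
    simp only [mul_sub, mul_smul_comm, mul_one]
  rw [e1, map_sub, map_smul, smul_eq_mul] at h1
  rw [e2, map_sub, map_smul, smul_eq_mul] at h2
  nlinarith [mul_nonneg ha h2]

/-- At every `s` the integrand is at least `c^(1-s) c^s = c` times the left-hand trace. -/
theorem tauRe_conj_expMean_ge {A B : Op n} {c : ℝ} (hc : 0 < c)
    (hA : algebraMap ℝ (Op n) c ≤ A) (hB : algebraMap ℝ (Op n) c ≤ B) (C : Op n) :
    c * tauRe n (Cᴴ * C) ≤ tauRe n (Cᴴ * expMean (CFC.log A) (CFC.log B) C) := by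
  have h := NormedSpace.map_expMean ((tauRe n).comp (ContinuousLinearMap.mul ℝ (Op n) Cᴴ))
    (CFC.log A) (CFC.log B) C
  simp only [ContinuousLinearMap.comp_apply, ContinuousLinearMap.mul_apply'] at h
  rw [h]
  have hcont := ((tauRe n).comp (ContinuousLinearMap.mul ℝ (Op n) Cᴴ)).continuous.comp
    (NormedSpace.continuous_exp_mul_mul_exp (CFC.log A) (CFC.log B) C)
  have hmono := intervalIntegral.integral_mono_on (μ := volume) (zero_le_one' ℝ)
    (f := fun _ => c * tauRe n (Cᴴ * C))
    (by simp) (hcont.intervalIntegrable 0 1) (fun s hs => by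
      have hs1 : 0 ≤ 1 - s := by linarith [hs.2]
      have := tauRe_conj_mul_ge (C := C) (Real.rpow_nonneg hc.le (1 - s))
        (Real.rpow_nonneg hc.le s) (algebraMap_rpow_le_power hc hA hs1)
        (algebraMap_rpow_le_power hc hB hs.1)
      rw [← Real.rpow_add hc, sub_add_cancel, Real.rpow_one, power_eq_exp hc hA,
        power_eq_exp hc hB] at this
      exact this)
  simpa using hmono

/-- Taking adjoints reverses the product, and `s ↦ 1 - s` restores the form of the mean with `a` and
`b` exchanged. -/
theorem conjTranspose_expMean {a b : Op n} (ha : IsSelfAdjoint a) (hb : IsSelfAdjoint b)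
    (C : Op n) : (expMean a b C)ᴴ = expMean b a Cᴴ := by
  have hexp : ∀ {x : Op n} (s : ℝ), IsSelfAdjoint x →
      (NormedSpace.exp (s • x))ᴴ = NormedSpace.exp (s • x) := fun s hx =>
    ((IsSelfAdjoint.all s).smul hx).exp
  have h := NormedSpace.map_expMean
    ((starL' ℝ : Op n ≃L[ℝ] Op n) : Op n →L[ℝ] Op n) a b C
  simp only [ContinuousLinearEquiv.coe_coe, starL'_apply, Matrix.star_eq_conjTranspose] at h
  rw [h, NormedSpace.expMean_apply]
  have := intervalIntegral.integral_comp_sub_left (a := 0) (b := 1)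
    (fun s : ℝ => NormedSpace.exp ((1 - s) • b) * Cᴴ * NormedSpace.exp (s • a)) 1
  simp only [sub_self, sub_zero, sub_sub_cancel] at this
  rw [← this]
  refine intervalIntegral.integral_congr fun s _ => ?_
  simp only [Matrix.conjTranspose_mul, hexp _ ha, hexp _ hb, mul_assoc]

theorem grading_expMean (a b C : Op n) :
    grading (expMean a b C) = expMean (grading a) (grading b) (grading C) := by
  have hc : Continuous (gradingHom n) :=
    LinearMap.continuous_of_finiteDimensional (gradingHom n).toAlgHom.toLinearMap
  have h := NormedSpace.map_expMean (LinearMap.toContinuousLinearMap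
    ((gradingHom n).toAlgHom.toLinearMap.restrictScalars ℝ)) a b C
  have hexp : ∀ (x : Op n) (s : ℝ), grading (NormedSpace.exp (s • x)) =
      NormedSpace.exp (s • grading x) := fun x s => by
    let _ : NormedAlgebra ℚ (Op n) := .restrictScalars ℚ ℝ _
    have h1 := NormedSpace.map_exp (gradingHom n) hc (s • x)
    have h2 : gradingHom n (s • x) = s • grading x :=
      map_smul ((gradingHom n).toAlgHom.toLinearMap.restrictScalars ℝ) s x
    rwa [h2] at h1
  refine (show grading (expMean a b C) = _ from h).trans ?_
  rw [NormedSpace.expMean_apply]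
  refine intervalIntegral.integral_congr fun s _ => ?_
  change grading _ = _
  rw [grading_mul, grading_mul, hexp, hexp]

theorem tau_mul_expMean (a b X Y : Op n) :
    tau (X * expMean a b Y) = tau (Y * expMean b a X) := by
  set τ : Op n →L[ℝ] ℂ := LinearMap.toContinuousLinearMap ((tauL n).restrictScalars ℝ) with hτ
  have hτa : ∀ A, τ A = tau A := fun _ => rfl
  have h1 := NormedSpace.map_expMean (τ.comp (ContinuousLinearMap.mul ℝ (Op n) X)) a b Y
  have h2 := NormedSpace.map_expMean (τ.comp (ContinuousLinearMap.mul ℝ (Op n) Y)) b a X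
  simp only [ContinuousLinearMap.comp_apply, ContinuousLinearMap.mul_apply', hτa] at h1 h2
  rw [h1, h2]
  have := intervalIntegral.integral_comp_sub_left (a := 0) (b := 1)
    (fun s : ℝ => tau (Y * (NormedSpace.exp ((1 - s) • b) * X * NormedSpace.exp (s • a)))) 1
  simp only [sub_self, sub_zero, sub_sub_cancel] at this
  rw [← this]
  refine intervalIntegral.integral_congr fun s _ => ?_
  have e : X * (NormedSpace.exp ((1 - s) • a) * Y * NormedSpace.exp (s • b)) =
      (X * NormedSpace.exp ((1 - s) • a)) * (Y * NormedSpace.exp (s • b)) := by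
    simp only [mul_assoc]
  rw [e, tau_mul_comm]
  simp only [mul_assoc]

theorem isUnit_expMean_log {A B : Op n} {c : ℝ} (hc : 0 < c) (hA : algebraMap ℝ (Op n) c ≤ A)
    (hB : algebraMap ℝ (Op n) c ≤ B) : IsUnit (expMean (CFC.log A) (CFC.log B)) := by
  refine ContinuousLinearMap.isUnit_of_injective fun C hC => ?_
  have h1 := tauRe_conj_expMean_ge hc hA hB C
  rw [hC, mul_zero, map_zero] at h1
  have h2 : tauRe n (Cᴴ * C) = 0 :=
    le_antisymm (nonpos_of_mul_nonpos_right h1 hc) (tauRe_star_mul_self_nonneg C)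
  have h3 : tau (Cᴴ * C) = 0 := by
    refine Complex.ext h2 ?_
    have h4 := tau_conjTranspose (Cᴴ * C)
    rw [Matrix.conjTranspose_mul, Matrix.conjTranspose_conjTranspose] at h4
    exact Complex.conj_eq_iff_im.1 h4.symm
  exact eq_zero_of_tau_mul_star (by rwa [tau_mul_comm])

/-! ### The manifold of strictly positive densities -/

/-- The tangent space `Cl0 n` as a real vector space. -/
def cl0 (n : ℕ) : Submodule ℝ (Op n) where
  carrier := Cl0 n
  add_mem' := by
    rintro A B ⟨h1, h2, h3⟩ ⟨h4, h5, h6⟩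
    exact ⟨add_mem h1 h4, by rw [Matrix.conjTranspose_add, h2, h5], by rw [tau_add, h3, h6, add_zero]⟩
  zero_mem' := ⟨zero_mem _, by simp, map_zero (tauL n)⟩
  smul_mem' := by
    rintro c A ⟨h1, h2, h3⟩
    have e : c • A = (c : ℂ) • A := (Complex.coe_smul c A).symm
    refine ⟨by rw [e]; exact (Cl n).smul_mem h1 _, by rw [Matrix.conjTranspose_smul, h2]; simp, ?_⟩
    rw [e, tau_smul, h3, mul_zero]

/-- The strictly positive densities, in the chart `ρ = 1 + x`. -/
def posSet (n : ℕ) : Set (cl0 n) := {x | ∃ c : ℝ, 0 < c ∧ algebraMap ℝ (Op n) c ≤ 1 + x}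

theorem algebraMap_eq_coe_smul (c : ℝ) : algebraMap ℝ (Op n) c = (c : ℂ) • 1 := by
  rw [Algebra.algebraMap_eq_smul_one, Complex.coe_smul]

theorem algebraMap_mem_Cl (c : ℝ) : algebraMap ℝ (Op n) c ∈ Cl n := by
  rw [algebraMap_eq_coe_smul]
  exact (Cl n).smul_mem (one_mem _) _

theorem one_add_mem_Cl (x : cl0 n) : 1 + (x : Op n) ∈ Cl n := add_mem (one_mem _) x.2.1

theorem isSelfAdjoint_coe (x : cl0 n) : IsSelfAdjoint (x : Op n) := x.2.2.1

theorem isSelfAdjoint_one_add (x : cl0 n) : IsSelfAdjoint (1 + (x : Op n)) :=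
  (IsSelfAdjoint.one _).add (isSelfAdjoint_coe x)

theorem tau_one_add (x : cl0 n) : tau (1 + (x : Op n)) = 1 := by
  rw [tau_add, tau_one, x.2.2.2, add_zero]

theorem exists_mem_Cl_of_nonneg {A : Op n} (hA : A ∈ Cl n) (h0 : 0 ≤ A) :
    ∃ B ∈ Cl n, A = Bᴴ * B := by
  refine ⟨cfc Real.sqrt A, cfc_mem_Cl _ hA, ?_⟩
  have hsa : IsSelfAdjoint A := IsSelfAdjoint.of_nonneg h0
  have h1 : (cfc Real.sqrt A)ᴴ = cfc Real.sqrt A := (cfc_predicate Real.sqrt A : IsSelfAdjoint _)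
  rw [h1, ← cfc_mul Real.sqrt Real.sqrt A Real.continuous_sqrt.continuousOn
    Real.continuous_sqrt.continuousOn]
  conv_lhs => rw [← cfc_id ℝ A hsa]
  exact cfc_congr fun x hx => (Real.mul_self_sqrt (spectrum_nonneg_of_nonneg h0 hx)).symm

theorem sub_one_mem_cl0 {A : Op n} (hA : A ∈ Cl n) (hs : Aᴴ = A) (ht : tau A = 1) :
    A - 1 ∈ cl0 n :=
  ⟨sub_mem hA (one_mem _), by rw [Matrix.conjTranspose_sub, hs, Matrix.conjTranspose_one],
    by rw [tau_sub, ht, tau_one, sub_self]⟩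

theorem mem_densityPos_iff {ρ : Op n} : ρ ∈ densityPos n ↔ ∃ x ∈ posSet n, ρ = 1 + (x : Op n) := by
  constructor
  · rintro ⟨⟨B, hB, c, hc, rfl⟩, ht⟩
    have hm : Bᴴ * B + (c : ℂ) • 1 ∈ Cl n :=
      add_mem (mul_mem (conjTranspose_mem_Cl hB) hB) ((Cl n).smul_mem (one_mem _) _)
    refine ⟨⟨_, sub_one_mem_cl0 hm (by simp [Matrix.conjTranspose_mul]) ht⟩, ⟨c, hc, ?_⟩, by simp⟩
    simp only [add_sub_cancel]
    rw [algebraMap_eq_coe_smul]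
    exact le_add_of_nonneg_left (star_mul_self_nonneg B)
  · rintro ⟨x, ⟨c, hc, hx⟩, rfl⟩
    obtain ⟨B, hB, h⟩ := exists_mem_Cl_of_nonneg
      (sub_mem (one_add_mem_Cl x) (algebraMap_mem_Cl c)) (sub_nonneg.2 hx)
    refine ⟨⟨B, hB, c, hc, ?_⟩, tau_one_add x⟩
    rw [← h, ← algebraMap_eq_coe_smul, sub_add_cancel]

theorem mem_density_iff {ρ : Op n} :
    ρ ∈ density n ↔ ∃ x : cl0 n, 0 ≤ 1 + (x : Op n) ∧ ρ = 1 + (x : Op n) := by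
  constructor
  · rintro ⟨⟨B, hB, rfl⟩, ht⟩
    have hm : Bᴴ * B ∈ Cl n := mul_mem (conjTranspose_mem_Cl hB) hB
    refine ⟨⟨_, sub_one_mem_cl0 hm (by simp [Matrix.conjTranspose_mul]) ht⟩, ?_, by simp⟩
    simp only [add_sub_cancel]
    exact star_mul_self_nonneg B
  · rintro ⟨x, hx, rfl⟩
    obtain ⟨B, hB, h⟩ := exists_mem_Cl_of_nonneg (one_add_mem_Cl x) hx
    exact ⟨⟨B, hB, h⟩, tau_one_add x⟩

/-- `1 + (1 - ε) x = (1 - ε)(1 + x) + ε`: mixing with the identity moves any density into the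
interior at a quantitative rate. -/
theorem algebraMap_le_one_add_smul {x : cl0 n} (hx : 0 ≤ 1 + (x : Op n)) {ε : ℝ} (hε : ε ≤ 1) :
    algebraMap ℝ (Op n) ε ≤ 1 + (((1 - ε) • x : cl0 n) : Op n) := by
  have h : 1 + (((1 - ε) • x : cl0 n) : Op n) - algebraMap ℝ (Op n) ε =
      (1 - ε) • (1 + (x : Op n)) := by
    rw [Algebra.algebraMap_eq_smul_one, Submodule.coe_smul]
    module
  rw [← sub_nonneg, h]
  exact smul_nonneg (by linarith) hx

theorem smul_mem_posSet {x : cl0 n} (hx : 0 ≤ 1 + (x : Op n)) {ε : ℝ} (hε0 : 0 < ε) (hε : ε ≤ 1) :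
    (1 - ε) • x ∈ posSet n := ⟨ε, hε0, algebraMap_le_one_add_smul hx hε⟩

theorem nonneg_of_mem_posSet {x : cl0 n} (hx : x ∈ posSet n) : 0 ≤ 1 + (x : Op n) := by
  obtain ⟨c, hc, h⟩ := hx
  exact nonneg_of_algebraMap_le hc.le h

theorem zero_mem_posSet : (0 : cl0 n) ∈ posSet n := ⟨1, one_pos, by simp⟩

theorem convex_posSet : Convex ℝ (posSet n) := by
  rintro x ⟨c, hc, hx⟩ y ⟨d, hd, hy⟩ a b ha hb hab
  refine ⟨a * c + b * d, ?_, ?_⟩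
  · rcases ha.eq_or_lt with rfl | ha
    · have : b = 1 := by linarith
      subst this; simpa using hd
    · have := mul_nonneg hb hd.le
      positivity
  · have h := add_nonneg (smul_nonneg ha (sub_nonneg.2 hx)) (smul_nonneg hb (sub_nonneg.2 hy))
    rw [← sub_nonneg]
    convert h using 1
    simp only [Algebra.algebraMap_eq_smul_one, Submodule.coe_add, Submodule.coe_smul, add_smul,
      mul_smul]
    have e : (1 : Op n) = a • (1 : Op n) + b • (1 : Op n) := by rw [← add_smul, hab, one_smul]
    nth_rewrite 1 [e]
    module

theorem isOpen_posSet : IsOpen (posSet n) := by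
  rw [Metric.isOpen_iff]
  rintro x ⟨c, hc, hx⟩
  refine ⟨c / 2, by positivity, fun y hy => ⟨c / 2, by positivity, ?_⟩⟩
  rw [Metric.mem_ball, dist_eq_norm] at hy
  have h1 := (isSelfAdjoint_coe (y - x)).neg_algebraMap_norm_le_self
  have h2 : algebraMap ℝ (Op n) ‖((y - x : cl0 n) : Op n)‖ ≤ algebraMap ℝ (Op n) (c / 2) :=
    algebraMap_mono _ hy.le
  have h3 := add_le_add hx (neg_le_neg h2 |>.trans h1)
  have e1 : 1 + (x : Op n) + ((y - x : cl0 n) : Op n) = 1 + (y : Op n) := by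
    rw [Submodule.coe_sub]; abel
  rw [e1, ← sub_eq_add_neg, ← map_sub] at h3
  rwa [sub_half] at h3

/-- The eigenvalues are nonnegative with sum `2 ^ n`, so none exceeds this sum. -/
theorem spectrum_le_of_density {x : cl0 n} (hx : 0 ≤ 1 + (x : Op n)) :
    spectrum ℝ (1 + (x : Op n)) ⊆ Icc 0 ((2 : ℝ) ^ n) := by
  intro r hr
  refine ⟨spectrum_nonneg_of_nonneg hx hr, ?_⟩
  have hps := Matrix.nonneg_iff_posSemidef.1 hx
  rw [hps.isHermitian.spectrum_real_eq_range_eigenvalues] at hr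
  obtain ⟨i, rfl⟩ := hr
  have htr := hps.isHermitian.trace_eq_sum_eigenvalues
  have ht := tau_one_add x
  have h2 : (1 + (x : Op n)).trace = (2 : ℂ) ^ n := by
    have h0 : (2 : ℂ) ^ n ≠ 0 := by positivity
    rw [tau] at ht
    field_simp at ht
    exact ht
  rw [h2] at htr
  have h3 : (2 : ℝ) ^ n = ∑ i, hps.isHermitian.eigenvalues i := by
    have : (((2 : ℝ) ^ n : ℝ) : ℂ) = ((∑ i, hps.isHermitian.eigenvalues i : ℝ) : ℂ) := by
      push_cast
      simpa using htr
    exact_mod_cast this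
  rw [h3]
  exact Finset.single_le_sum (fun j _ => hps.eigenvalues_nonneg j) (Finset.mem_univ i)

theorem norm_le_of_density {x : cl0 n} (hx : 0 ≤ 1 + (x : Op n)) : ‖x‖ ≤ 2 ^ n + 1 := by
  have h1 : ‖1 + (x : Op n)‖ ≤ 2 ^ n := by
    rw [CStarAlgebra.norm_le_iff_le_algebraMap _ (by positivity) hx,
      le_algebraMap_iff_spectrum_le (ha := isSelfAdjoint_one_add x)]
    exact fun r hr => (spectrum_le_of_density hx hr).2
  have h2 : (x : Op n) = (1 + (x : Op n)) - 1 := by abel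
  change ‖(x : Op n)‖ ≤ _
  rw [h2]
  exact (norm_sub_le _ _).trans (add_le_add h1 (by simp))

noncomputable instance : NormedAddCommGroup (cl0 n) := Submodule.normedAddCommGroup _

noncomputable instance : NormedSpace ℝ (cl0 n) := Submodule.normedSpace _

instance : FiniteDimensional ℝ (cl0 n) := FiniteDimensional.finiteDimensional_submodule _

instance : CompleteSpace (cl0 n) := FiniteDimensional.complete ℝ _

/-! ### Regularity of the logarithm -/

/-- The logarithm of the density `1 + x`. -/
noncomputable def logDensity (x : cl0 n) : Op n := CFC.log (1 + (x : Op n))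

theorem exp_logDensity {x : cl0 n} (hx : x ∈ posSet n) :
    NormedSpace.exp (logDensity x) = 1 + (x : Op n) := by
  obtain ⟨c, hc, h⟩ := hx
  exact exp_log_of_algebraMap_le hc h

theorem isSelfAdjoint_logDensity (x : cl0 n) : IsSelfAdjoint (logDensity x) := IsSelfAdjoint.log

theorem continuousOn_logDensity : ContinuousOn (logDensity (n := n)) (posSet n) := by
  refine CFC.continuousOn_log.comp (by fun_prop) fun x hx => ?_
  obtain ⟨c, hc, h⟩ := hx
  exact ⟨isSelfAdjoint_one_add x, isUnit_of_algebraMap_le hc h⟩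

theorem isUnit_expMean_logDensity {x y : cl0 n} (hx : x ∈ posSet n) (hy : y ∈ posSet n) :
    IsUnit (expMean (logDensity x) (logDensity y)) := by
  obtain ⟨c, hc, hx⟩ := hx
  obtain ⟨d, hd, hy⟩ := hy
  exact isUnit_expMean_log (lt_min hc hd)
    ((algebraMap_mono _ (min_le_left c d)).trans hx)
    ((algebraMap_mono _ (min_le_right c d)).trans hy)

/-- The slope operator of the logarithm. -/
noncomputable def logSlope (p : cl0 n × cl0 n) : cl0 n →L[ℝ] Op n :=
  (Ring.inverse (expMean (logDensity p.1) (logDensity p.2))).comp (cl0 n).subtypeL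

/-- Duhamel's formula with `C = 1`: the mean of the two logarithms maps their difference to the
difference of the densities, and it is invertible. -/
theorem logDensity_sub {x y : cl0 n} (hx : x ∈ posSet n) (hy : y ∈ posSet n) :
    logDensity x - logDensity y = logSlope (x, y) (x - y) := by
  have h := NormedSpace.expMean_mul_sub_mul (logDensity x) (logDensity y) 1
  rw [mul_one, one_mul, mul_one, one_mul, exp_logDensity hx, exp_logDensity hy] at h
  have hu := Ring.inverse_mul_cancel _ (isUnit_expMean_logDensity hx hy)
  have h2 := congrArg (fun f : Op n →L[ℝ] Op n => f (logDensity x - logDensity y)) hu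
  simp only [mul_apply_eq_comp, one_apply_eq_self] at h2
  rw [h] at h2
  rw [← h2, logSlope, ContinuousLinearMap.comp_apply]
  congr 1
  simp

theorem continuousOn_logSlope : ContinuousOn (logSlope (n := n)) (posSet n ×ˢ posSet n) := by
  have h2 := ((continuousOn_logDensity.comp continuousOn_fst fun p hp => hp.1).expMean
    (continuousOn_logDensity.comp continuousOn_snd fun p hp => hp.2)).clm_ringInverse
    (s := posSet n ×ˢ posSet n) fun p hp => isUnit_expMean_logDensity hp.1 hp.2
  exact h2.clm_comp continuousOn_const

theorem contDiffOn_logDensity : ContDiffOn ℝ 1 (logDensity (n := n)) (posSet n) :=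
  contDiffOn_one_of_slope isOpen_posSet (fun _ hx _ hy => logDensity_sub hx hy)
    continuousOn_logSlope

theorem hasFDerivAt_logDensity {x : cl0 n} (hx : x ∈ posSet n) :
    HasFDerivAt (logDensity (n := n)) (logSlope (x, x)) x :=
  (hasStrictFDerivAt_of_slope isOpen_posSet (fun _ hx _ hy => logDensity_sub hx hy)
    continuousOn_logSlope hx).hasFDerivAt

/-! ### The metric tensor -/

/-- The grading as a continuous linear map. -/
noncomputable def gradingCLM (n : ℕ) : Op n →L[ℝ] Op n :=
  LinearMap.toContinuousLinearMap ((gradingHom n).toAlgHom.toLinearMap.restrictScalars ℝ)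

/-- The derivation `∇ᵢ` as a continuous linear map. -/
noncomputable def pderivCLM (i : Fin n) : Op n →L[ℝ] Op n :=
  LinearMap.toContinuousLinearMap ((pderivL i).restrictScalars ℝ)

theorem pderivCLM_apply (i : Fin n) (A : Op n) : pderivCLM i A = pderiv i A := rfl

/-- The adjoint `∇ᵢ*` as a continuous linear map. -/
noncomputable def pderivAdjCLM (i : Fin n) : Op n →L[ℝ] Op n :=
  LinearMap.toContinuousLinearMap ((pderivAdjL i).restrictScalars ℝ)

theorem pderivAdjCLM_apply (i : Fin n) (A : Op n) : pderivAdjCLM i A = pderivAdj i A := rfl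

/-- The operator `U ↦ - div((Γ(ρ), ρ) # ∇U)` at `ρ = 1 + x`. -/
noncomputable def velocityCLM (x : cl0 n) : Op n →L[ℝ] Op n :=
  ∑ i, (pderivAdjCLM i).comp
    ((expMean (grading (logDensity x)) (logDensity x)).comp (pderivCLM i))

theorem weight_eq_expMean {x : cl0 n} (hx : x ∈ posSet n) (V : Fin n → Op n) (i : Fin n) :
    weight (1 + (x : Op n)) V i = expMean (grading (logDensity x)) (logDensity x) (V i) := by
  obtain ⟨c, hc, h⟩ := hx
  rw [weight, sharp_eq_expMean hc (algebraMap_le_grading h) h, logDensity,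
    grading_log (isSelfAdjoint_one_add x)]

theorem velocity_eq {x : cl0 n} (hx : x ∈ posSet n) (U : Op n) :
    velocity (1 + (x : Op n)) U = velocityCLM x U := by
  simp only [velocity, dive, neg_neg, velocityCLM, _root_.sum_apply,
    ContinuousLinearMap.comp_apply, pderivAdjCLM_apply, pderivCLM_apply, weight_eq_expMean hx, grad]

theorem logDensity_mem_Cl (x : cl0 n) : logDensity x ∈ Cl n := cfc_mem_Cl _ (one_add_mem_Cl x)

theorem tau_mul_pderivAdj (i : Fin n) (A B : Op n) :
    tau (A * pderivAdj i B) = tau ((pderiv i Aᴴ)ᴴ * B) := by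
  rw [tau_pderiv, Matrix.conjTranspose_conjTranspose]

/-- A continuous linear projection onto a real subspace. -/
theorem exists_projection (S : Submodule ℝ (Op n)) : ∃ p : Op n →L[ℝ] S, ∀ x : S, p x = x := by
  obtain ⟨f, hf⟩ := S.subtype.exists_leftInverse_of_injective S.ker_subtype
  exact ⟨LinearMap.toContinuousLinearMap f, fun x => LinearMap.congr_fun hf x⟩

theorem exp_smul_mem_Cl {a : Op n} (ha : a ∈ Cl n) (hs : IsSelfAdjoint a) (s : ℝ) :
    NormedSpace.exp (s • a) ∈ Cl n := by
  rw [← CFC.real_exp_eq_normedSpace_exp ((IsSelfAdjoint.all s).smul hs), ← Complex.coe_smul]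
  exact cfc_mem_Cl _ ((Cl n).smul_mem ha _)

/-- The identity minus a projection onto `Cl n` kills the integrand at every `s`, hence kills the
integral. -/
theorem expMean_mem_Cl {a b C : Op n} (ha : a ∈ Cl n) (hb : b ∈ Cl n) (hC : C ∈ Cl n)
    (hsa : IsSelfAdjoint a) (hsb : IsSelfAdjoint b) : expMean a b C ∈ Cl n := by
  set S : Submodule ℝ (Op n) := (Subalgebra.toSubmodule (Cl n)).restrictScalars ℝ
  obtain ⟨p, hp⟩ := exists_projection S
  have h := NormedSpace.map_expMean (ContinuousLinearMap.id ℝ (Op n) - S.subtypeL.comp p) a b C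
  have h0 : ∀ A ∈ Cl n, (ContinuousLinearMap.id ℝ (Op n) - S.subtypeL.comp p) A = 0 :=
    fun A hA => by
      have := hp ⟨A, hA⟩
      simp only at this
      simp [this]
  rw [intervalIntegral.integral_congr (g := fun _ => 0) fun s _ => h0 _
    (mul_mem (mul_mem (exp_smul_mem_Cl ha hsa _) hC) (exp_smul_mem_Cl hb hsb _)),
    intervalIntegral.integral_zero] at h
  have h1 : expMean a b C = (p (expMean a b C) : Op n) := by
    simpa [sub_eq_zero] using h
  rw [h1]
  exact (p (expMean a b C)).2

/-- The adjoint exchanges the two logarithms in the mean and the grading exchanges them back, so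
self-adjointness survives. The trace vanishes because `∇ᵢ 1 = 0`. -/
theorem velocityCLM_mem (x : cl0 n) (U : cl0 n) : velocityCLM x (U : Op n) ∈ cl0 n := by
  have hL := logDensity_mem_Cl x
  have hs := isSelfAdjoint_logDensity x
  have hg : IsSelfAdjoint (grading (logDensity x)) := hs.map (gradingHom n)
  simp only [velocityCLM, _root_.sum_apply, ContinuousLinearMap.comp_apply, pderivAdjCLM_apply,
    pderivCLM_apply]
  refine sum_mem fun i _ => ⟨pderivAdj_mem_Cl i (expMean_mem_Cl (grading_mem_Cl hL) hL
    (pderiv_mem_Cl i U.2.1) hg hs), ?_, ?_⟩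
  · rw [conjTranspose_pderivAdj, conjTranspose_grading, conjTranspose_expMean hg hs,
      grading_expMean, grading_grading, conjTranspose_pderiv, U.2.2.1, grading_grading]
  · have h := tau_mul_pderivAdj i 1
      (expMean (grading (logDensity x)) (logDensity x) (pderiv i (U : Op n)))
    rw [one_mul, Matrix.conjTranspose_one] at h
    have h1 : pderiv i (1 : Op n) = 0 := by simp [pderiv, grading_one]
    rw [h, h1, Matrix.conjTranspose_zero, zero_mul]
    exact map_zero (tauL n)

/-- A continuous linear projection onto the tangent space. -/
noncomputable def projCl0 (n : ℕ) : Op n →L[ℝ] cl0 n := (exists_projection (cl0 n)).choose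

theorem projCl0_apply (x : cl0 n) : projCl0 n (x : Op n) = x :=
  (exists_projection (cl0 n)).choose_spec x

/-- The operator `U ↦ - div((Γ(ρ), ρ) # ∇U)` on the tangent space. -/
noncomputable def metricOp (x : cl0 n) : cl0 n →L[ℝ] cl0 n :=
  (projCl0 n).comp ((velocityCLM x).comp (cl0 n).subtypeL)

theorem coe_metricOp (x U : cl0 n) : (metricOp x U : Op n) = velocityCLM x (U : Op n) :=
  congrArg Subtype.val (projCl0_apply ⟨_, velocityCLM_mem x U⟩)

theorem velocity_eq_metricOp {x : cl0 n} (hx : x ∈ posSet n) (U : cl0 n) :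
    velocity (1 + (x : Op n)) (U : Op n) = metricOp x U := by
  rw [velocity_eq hx, coe_metricOp]

theorem contDiffOn_metricOp : ContDiffOn ℝ 1 (metricOp (n := n)) (posSet n) := by
  have h1 := ((gradingCLM n).contDiff.comp_contDiffOn contDiffOn_logDensity).expMean
    (contDiffOn_logDensity (n := n))
  have h2 : ContDiffOn ℝ 1 (velocityCLM (n := n)) (posSet n) :=
    ContDiffOn.sum fun i _ => contDiffOn_const.clm_comp (h1.clm_comp contDiffOn_const)
  exact contDiffOn_const.clm_comp (h2.clm_comp contDiffOn_const)

/-- The inner product `⟨A, B⟩ = τ(A B)` on the tangent space. -/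
noncomputable def tauForm (n : ℕ) : cl0 n →L[ℝ] cl0 n →L[ℝ] ℝ :=
  (ContinuousLinearMap.compL ℝ (cl0 n) (Op n) ℝ (tauRe n)).comp
    ((ContinuousLinearMap.mul ℝ (Op n)).bilinearComp (cl0 n).subtypeL (cl0 n).subtypeL)

theorem tauForm_apply (A B : cl0 n) : tauForm n A B = (tau ((A : Op n) * (B : Op n))).re := rfl

theorem tau_mul_metricOp (x U W : cl0 n) : tau ((U : Op n) * (metricOp x W : Op n)) =
    ∑ i, tau ((pderiv i (U : Op n))ᴴ *
      expMean (grading (logDensity x)) (logDensity x) (pderiv i (W : Op n))) := by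
  rw [coe_metricOp]
  simp only [velocityCLM, _root_.sum_apply, ContinuousLinearMap.comp_apply, pderivAdjCLM_apply,
    pderivCLM_apply, Finset.mul_sum, tau_sum]
  refine Finset.sum_congr rfl fun i _ => ?_
  rw [tau_mul_pderivAdj, U.2.2.1]

theorem innerRho_eq {x : cl0 n} (hx : x ∈ posSet n) (U W : cl0 n) :
    innerRho (1 + (x : Op n)) (grad (U : Op n)) (grad (W : Op n)) =
      tau ((U : Op n) * (metricOp x W : Op n)) := by
  rw [tau_mul_metricOp]
  simp only [innerRho, weight_eq_expMean hx, grad]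

theorem tauForm_metricOp_comm (x U W : cl0 n) :
    tauForm n U (metricOp x W) = tauForm n W (metricOp x U) := by
  rw [tauForm_apply, tauForm_apply, tau_mul_metricOp, tau_mul_metricOp, Complex.re_sum,
    Complex.re_sum]
  refine Finset.sum_congr rfl fun i _ => ?_
  have hs := isSelfAdjoint_logDensity x
  have hg : IsSelfAdjoint (grading (logDensity x)) := hs.map (gradingHom n)
  have h := tau_conjTranspose ((pderiv i (W : Op n))ᴴ *
    expMean (grading (logDensity x)) (logDensity x) (pderiv i (U : Op n)))
  rw [Matrix.conjTranspose_mul, conjTranspose_expMean hg hs, Matrix.conjTranspose_conjTranspose,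
    tau_mul_comm, tau_mul_expMean] at h
  rw [h]
  simp

/-- The Dirichlet form `∑ᵢ ⟨∇ᵢ U, ∇ᵢ U⟩`. -/
noncomputable def dirichlet (U : cl0 n) : ℝ :=
  ∑ i, tauRe n ((pderiv i (U : Op n))ᴴ * pderiv i (U : Op n))

theorem mul_dirichlet_le {x : cl0 n} {c : ℝ} (hc : 0 < c)
    (hx : algebraMap ℝ (Op n) c ≤ 1 + (x : Op n)) (U : cl0 n) :
    c * dirichlet U ≤ tauForm n U (metricOp x U) := by
  rw [tauForm_apply, tau_mul_metricOp, Complex.re_sum, dirichlet, Finset.mul_sum]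
  refine Finset.sum_le_sum fun i _ => ?_
  rw [logDensity, grading_log (isSelfAdjoint_one_add x)]
  exact tauRe_conj_expMean_ge hc (algebraMap_le_grading hx) hx _

theorem eq_zero_of_tauRe_star_mul_self {C : Op n} (h : tauRe n (Cᴴ * C) = 0) : C = 0 := by
  have h3 : tau (Cᴴ * C) = 0 := by
    refine Complex.ext h ?_
    have h4 := tau_conjTranspose (Cᴴ * C)
    rw [Matrix.conjTranspose_mul, Matrix.conjTranspose_conjTranspose] at h4
    exact Complex.conj_eq_iff_im.1 h4.symm
  exact eq_zero_of_tau_mul_star (by rwa [tau_mul_comm])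

theorem dirichlet_pos {U : cl0 n} (hU : U ≠ 0) : 0 < dirichlet U := by
  refine lt_of_le_of_ne (Finset.sum_nonneg fun i _ => tauRe_star_mul_self_nonneg _) fun h => hU ?_
  have h1 := (Finset.sum_eq_zero_iff_of_nonneg
    fun i _ => tauRe_star_mul_self_nonneg (pderiv i (U : Op n))).1 h.symm
  exact Subtype.ext (eq_zero_of_pderiv_eq_zero U.2.1
    (fun i => eq_zero_of_tauRe_star_mul_self (h1 i (Finset.mem_univ i))) U.2.2.2)

theorem exists_dirichlet_ge (n : ℕ) : ∃ c > 0, ∀ U : cl0 n, c * ‖U‖ ^ 2 ≤ dirichlet U := by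
  refine exists_pos_mul_sq_norm_le ?_ ?_ fun v => dirichlet_pos
  · refine continuous_finsetSum _ fun i _ => (tauRe n).continuous.comp ?_
    have h : Continuous fun U : cl0 n => pderiv i (U : Op n) :=
      (pderivCLM i).continuous.comp continuous_subtype_val
    exact (continuous_star.comp h).mul h
  · intro c v
    simp only [dirichlet, Finset.mul_sum]
    refine Finset.sum_congr rfl fun i _ => ?_
    have e : pderiv i ((c • v : cl0 n) : Op n) = c • pderiv i (v : Op n) :=
      map_smul (pderivCLM i) c (v : Op n)
    rw [e, Matrix.conjTranspose_smul, smul_mul_smul_comm, map_smul]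
    simp [pow_two]

theorem isUnit_metricOp {x : cl0 n} (hx : x ∈ posSet n) : IsUnit (metricOp x) := by
  obtain ⟨c, hc, h⟩ := hx
  refine ContinuousLinearMap.isUnit_of_injective fun U hU => ?_
  by_contra hne
  have h1 := mul_dirichlet_le hc h U
  rw [hU, map_zero] at h1
  exact absurd (mul_pos hc (dirichlet_pos hne)) (not_lt.2 h1)

/-- The metric tensor in the chart `ρ = 1 + x`. -/
noncomputable def metricTensor (x : cl0 n) : cl0 n →L[ℝ] cl0 n →L[ℝ] ℝ :=
  (tauForm n).comp (Ring.inverse (metricOp x))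

theorem contDiffOn_metricTensor : ContDiffOn ℝ 1 (metricTensor (n := n)) (posSet n) := by
  exact contDiffOn_const.clm_comp
    (contDiffOn_metricOp.clm_ringInverse fun x hx => isUnit_metricOp hx)

theorem metricOp_inverse {x : cl0 n} (hx : x ∈ posSet n) (v : cl0 n) :
    metricOp x (Ring.inverse (metricOp x) v) = v := by
  have := Ring.mul_inverse_cancel _ (isUnit_metricOp hx)
  simpa using congrArg (fun f : cl0 n →L[ℝ] cl0 n => f v) this

theorem inverse_metricOp {x : cl0 n} (hx : x ∈ posSet n) (v : cl0 n) :
    Ring.inverse (metricOp x) (metricOp x v) = v := by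
  have := Ring.inverse_mul_cancel _ (isUnit_metricOp hx)
  simpa using congrArg (fun f : cl0 n →L[ℝ] cl0 n => f v) this

theorem metricTensor_metricOp {x : cl0 n} (hx : x ∈ posSet n) (U w : cl0 n) :
    metricTensor x (metricOp x U) w = tauForm n U w := by
  rw [metricTensor, ContinuousLinearMap.comp_apply, inverse_metricOp hx]

theorem metricTensor_symm {x : cl0 n} (hx : x ∈ posSet n) (v w : cl0 n) :
    metricTensor x v w = metricTensor x w v := by
  obtain ⟨U, rfl⟩ : ∃ U, metricOp x U = v := ⟨_, metricOp_inverse hx v⟩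
  obtain ⟨W, rfl⟩ : ∃ W, metricOp x W = w := ⟨_, metricOp_inverse hx w⟩
  rw [metricTensor_metricOp hx, metricTensor_metricOp hx, tauForm_metricOp_comm]

theorem metricTensor_pos {x : cl0 n} (hx : x ∈ posSet n) {v : cl0 n} (hv : v ≠ 0) :
    0 < metricTensor x v v := by
  obtain ⟨U, rfl⟩ : ∃ U, metricOp x U = v := ⟨_, metricOp_inverse hx v⟩
  have hU : U ≠ 0 := by rintro rfl; simp at hv
  obtain ⟨c, hc, h⟩ := id hx
  rw [metricTensor_metricOp hx]
  exact (mul_pos hc (dirichlet_pos hU)).trans_le (mul_dirichlet_le hc h U)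

theorem metricTensor_nonneg {x : cl0 n} (hx : x ∈ posSet n) (v : cl0 n) :
    0 ≤ metricTensor x v v := by
  rcases eq_or_ne v 0 with rfl | hv
  · simp
  · exact (metricTensor_pos hx hv).le

/-- The metric tensor blows up at most like the inverse of the distance to the boundary. -/
theorem exists_metricTensor_le (n : ℕ) : ∃ C : ℝ, 0 ≤ C ∧ ∀ x ∈ posSet n, ∀ v,
    ∀ ε ∈ Ioc (0 : ℝ) 1, metricTensor ((1 - ε) • x) v v ≤ C / ε * ‖v‖ ^ 2 := by
  obtain ⟨c, hc, hD⟩ := exists_dirichlet_ge n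
  -- For `v = metricOp _ U` the value `G` of the tensor satisfies `ε c ‖U‖² ≤ G ≤ ‖tauForm n‖ ‖U‖
  -- ‖v‖`. Eliminating `‖U‖` gives the constant.
  refine ⟨‖tauForm n‖ ^ 2 / c, by positivity, fun x hx v ε hε => ?_⟩
  have hx' := smul_mem_posSet (nonneg_of_mem_posSet hx) hε.1 hε.2
  obtain ⟨U, rfl⟩ : ∃ U, metricOp ((1 - ε) • x) U = v := ⟨_, metricOp_inverse hx' v⟩
  rw [metricTensor_metricOp hx']
  have h1 := mul_dirichlet_le hε.1 (algebraMap_le_one_add_smul (nonneg_of_mem_posSet hx) hε.2) U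
  set v := metricOp ((1 - ε) • x) U
  set G := tauForm n U v
  have h2 : G ≤ ‖tauForm n‖ * ‖U‖ * ‖v‖ := (le_abs_self _).trans ((tauForm n).le_opNorm₂ U v)
  have h3 : ε * (c * ‖U‖ ^ 2) ≤ G := (mul_le_mul_of_nonneg_left (hD U) hε.1.le).trans h1
  have hε0 := hε.1
  have hG0 : 0 ≤ G := le_trans (by positivity) h3
  rcases hG0.eq_or_lt with h0 | hG
  · rw [← h0]; positivity
  have h4 : G ^ 2 ≤ (‖tauForm n‖ * ‖v‖) ^ 2 * ‖U‖ ^ 2 := by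
    calc G ^ 2 ≤ (‖tauForm n‖ * ‖U‖ * ‖v‖) ^ 2 := pow_le_pow_left₀ hG0 h2 2
      _ = _ := by ring
  have h5 : ‖U‖ ^ 2 ≤ G / (ε * c) := by
    rw [le_div_iff₀ (by positivity)]; linarith
  have h6 : G * G ≤ ((‖tauForm n‖ * ‖v‖) ^ 2 / (ε * c)) * G := by
    calc G * G = G ^ 2 := by ring
      _ ≤ (‖tauForm n‖ * ‖v‖) ^ 2 * (G / (ε * c)) :=
          h4.trans (mul_le_mul_of_nonneg_left h5 (by positivity))
      _ = _ := by ring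
  refine (le_of_mul_le_mul_right h6 hG).trans (le_of_eq ?_)
  field_simp

/-! ### The metric of the statement -/

/-- Invertibility of `metricOp x` leaves exactly one candidate to the choice operator. -/
theorem potential_eq {x : cl0 n} (hx : x ∈ posSet n) (v : cl0 n) :
    potential (1 + (x : Op n)) (v : Op n) = Ring.inverse (metricOp x) v := by
  have hiff : ∀ U : Op n, (U ∈ Cl0 n ∧
      (v : Op n) + dive (weight (1 + (x : Op n)) (grad U)) = 0) ↔
        U = Ring.inverse (metricOp x) v := by
    intro U
    have hvel : ∀ U : cl0 n, dive (weight (1 + (x : Op n)) (grad (U : Op n))) =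
        -(metricOp x U : Op n) := fun U => by
      rw [← velocity_eq_metricOp hx, velocity, neg_neg]
    constructor
    · rintro ⟨hU, h⟩
      have h1 := hvel ⟨U, hU⟩
      simp only at h1
      rw [h1, ← sub_eq_add_neg, sub_eq_zero] at h
      have h2 : v = metricOp x ⟨U, hU⟩ := Subtype.ext h
      rw [h2, inverse_metricOp hx]
    · rintro rfl
      refine ⟨(Ring.inverse (metricOp x) v).2, ?_⟩
      rw [hvel, metricOp_inverse hx, add_neg_cancel]
  exact (hiff _).1 (Classical.epsilon_spec (p := fun U : Op n => U ∈ Cl0 n ∧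
    (v : Op n) + dive (weight (1 + (x : Op n)) (grad U)) = 0) ⟨_, (hiff _).2 rfl⟩)

theorem metric_eq {x : cl0 n} (hx : x ∈ posSet n) (v w : cl0 n) :
    metric (1 + (x : Op n)) (v : Op n) (w : Op n) = metricTensor x v w := by
  rw [metric, potential_eq hx, potential_eq hx, innerRho_eq hx, metricOp_inverse hx]
  rfl

/-! ### The Fermi number operator -/

/-- The number operator `∑ᵢ ∇ᵢ* ∇ᵢ` on the tangent space. -/
noncomputable def numberOp (n : ℕ) : cl0 n →L[ℝ] cl0 n := metricOp 0

theorem expMean_self_one (a : Op n) : expMean a a 1 = NormedSpace.exp a := by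
  let _ : NormedAlgebra ℚ (Op n) := .restrictScalars ℚ ℝ _
  rw [NormedSpace.expMean_apply]
  have : ∀ s : ℝ, NormedSpace.exp ((1 - s) • a) * 1 * NormedSpace.exp (s • a) =
      NormedSpace.exp a := fun s => by
    rw [mul_one, ← NormedSpace.exp_add_of_commute
      (((Commute.refl a).smul_left _).smul_right _), ← add_smul, sub_add_cancel, one_smul]
  simp only [this]
  simp

theorem coe_numberOp (x : cl0 n) :
    (numberOp n x : Op n) = ∑ i, pderivAdj i (pderiv i (x : Op n)) := by
  have h0 : logDensity (0 : cl0 n) = 0 := by simp [logDensity]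
  have h1 : grading (0 : Op n) = 0 := map_zero (gradingHom n)
  rw [numberOp, coe_metricOp]
  simp only [velocityCLM, _root_.sum_apply, ContinuousLinearMap.comp_apply, pderivAdjCLM_apply,
    pderivCLM_apply, h0, h1, NormedSpace.expMean_apply]
  simp

theorem pderiv_one (i : Fin n) : pderiv i (1 : Op n) = 0 := by simp [pderiv, grading_one]

theorem pderiv_one_add (i : Fin n) (A : Op n) : pderiv i (1 + A) = pderiv i A := by
  rw [show pderiv i (1 + A) = pderiv i 1 + pderiv i A from map_add (pderivL i) 1 A, pderiv_one,
    zero_add]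

/-- The set of densities bounded from below by `c`. -/
def lowerSet (n : ℕ) (c : ℝ) : Set (cl0 n) := {x | algebraMap ℝ (Op n) c ≤ 1 + (x : Op n)}

theorem convex_lowerSet (c : ℝ) : Convex ℝ (lowerSet n c) := by
  rintro x hx y hy a b ha hb hab
  have hx' : algebraMap ℝ (Op n) c ≤ 1 + (x : Op n) := hx
  have hy' : algebraMap ℝ (Op n) c ≤ 1 + (y : Op n) := hy
  have h := add_nonneg (smul_nonneg ha (sub_nonneg.2 hx')) (smul_nonneg hb (sub_nonneg.2 hy'))
  change algebraMap ℝ (Op n) c ≤ 1 + ((a • x + b • y : cl0 n) : Op n)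
  rw [← sub_nonneg]
  convert h using 1
  have e : (1 : Op n) - algebraMap ℝ (Op n) c =
      a • (1 - algebraMap ℝ (Op n) c) + b • (1 - algebraMap ℝ (Op n) c) := by
    rw [← add_smul, hab, one_smul]
  rw [add_sub_right_comm, e, Submodule.coe_add, Submodule.coe_smul, Submodule.coe_smul]
  module

theorem isClosed_lowerSet (c : ℝ) : IsClosed (lowerSet n c) :=
  isClosed_le continuous_const (by fun_prop)

/-- On the density `1 + x` this operator is the average over `i` of `A ↦ Qᵢ Γ(A) Qᵢ`, and each of
these conjugations keeps a scalar lower bound. -/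
theorem mean_mem_lowerSet (hn : n ≠ 0) {c : ℝ} {x : cl0 n} (hx : x ∈ lowerSet n c) :
    (1 - (2 / n : ℝ) • numberOp n) x ∈ lowerSet n c := by
  have hn' : (n : ℝ) ≠ 0 := by exact_mod_cast hn
  have e : 1 + (((1 - (2 / n : ℝ) • numberOp n) x : cl0 n) : Op n) - algebraMap ℝ (Op n) c =
      (n : ℝ)⁻¹ • ∑ i, gen i * grading (1 + (x : Op n) - algebraMap ℝ (Op n) c) * gen i := by
    have e1 : ∀ i : Fin n, gen i * grading (1 + (x : Op n) - algebraMap ℝ (Op n) c) * gen i =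
        (1 + (x : Op n) - algebraMap ℝ (Op n) c) -
          (2 : ℝ) • pderivAdj i (pderiv i (x : Op n)) := fun i => by
      have h1 := pderivAdj_pderiv i (1 + (x : Op n) - algebraMap ℝ (Op n) c)
      have h2 : pderiv i (1 + (x : Op n) - algebraMap ℝ (Op n) c) = pderiv i (x : Op n) := by
        rw [algebraMap_eq_coe_smul, show ∀ A : Op n, pderiv i (A - (c : ℂ) • 1) =
          pderiv i A - (c : ℂ) • pderiv i 1 from fun A => by
            change pderivL i _ = pderivL i _ - _ • pderivL i _
            rw [map_sub, map_smul], pderiv_one_add, pderiv_one, smul_zero, sub_zero]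
      rw [h2] at h1
      have h3 : (2 : ℝ) • pderivAdj i (pderiv i (x : Op n)) =
          (2 : ℂ) • pderivAdj i (pderiv i (x : Op n)) := by
        rw [← Complex.coe_smul]; norm_num
      rw [h3, h1, smul_smul]
      norm_num
    rw [Finset.sum_congr rfl fun i _ => e1 i, Finset.sum_sub_distrib, Finset.sum_const,
      Finset.card_univ, Fintype.card_fin, ← Finset.smul_sum, _root_.sub_apply, one_apply_eq_self, _root_.smul_apply, Submodule.coe_sub,
      Submodule.coe_smul, coe_numberOp, smul_sub, ← Nat.cast_smul_eq_nsmul ℝ, smul_smul, smul_smul,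
      inv_mul_cancel₀ hn', one_smul, inv_mul_eq_div]
    abel
  change algebraMap ℝ (Op n) c ≤ 1 + (((1 - (2 / n : ℝ) • numberOp n) x : cl0 n) : Op n)
  rw [← sub_nonneg, e]
  refine smul_nonneg (by positivity) (Finset.sum_nonneg fun i _ => ?_)
  have h := algebraMap_le_grading hx
  have h2 : grading (algebraMap ℝ (Op n) c) = algebraMap ℝ (Op n) c := by
    rw [algebraMap_eq_coe_smul, grading_smul, grading_one]
  have h3 : 0 ≤ grading (1 + (x : Op n) - algebraMap ℝ (Op n) c) := by
    rw [grading_sub, h2]; exact sub_nonneg.2 h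
  simpa [Matrix.star_eq_conjTranspose, conjTranspose_gen] using
    star_left_conjugate_nonneg h3 (gen i)

theorem flow_mem_lowerSet {c t : ℝ} (ht : 0 ≤ t) {x : cl0 n} (hx : x ∈ lowerSet n c) :
    flow (numberOp n) t x ∈ lowerSet n c := by
  rcases eq_or_ne n 0 with rfl | hn
  -- Without generators the factor `2 / n` is meaningless, but the flow is trivial.
  · have : numberOp 0 = 0 := by
      ext x : 2
      rw [coe_numberOp]
      simp
    simpa [flow, this] using hx
  · have hn' : (n : ℝ) ≠ 0 := by exact_mod_cast hn
    have h := flow_mem_of_convex (convex_lowerSet c) (isClosed_lowerSet c)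
      (fun x => mean_mem_lowerSet hn) (s := n / 2 * t) (by positivity) hx
    have e : flow (numberOp n) t =
        flow (1 - (1 - (2 / n : ℝ) • numberOp n)) (n / 2 * t) := by
      rw [flow, flow, sub_sub_cancel, smul_neg, smul_neg, smul_smul]
      congr 3
      field_simp
    rwa [e]

theorem flow_mem_posSet {t : ℝ} (ht : 0 ≤ t) {x : cl0 n} (hx : x ∈ posSet n) :
    flow (numberOp n) t x ∈ posSet n := by
  obtain ⟨c, hc, h⟩ := hx
  exact ⟨c, hc, flow_mem_lowerSet ht h⟩

theorem mem_lowerSet_zero {x : cl0 n} : x ∈ lowerSet n 0 ↔ 0 ≤ 1 + (x : Op n) := by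
  simp [lowerSet]

/-! ### The entropy -/

/-- The trace-free part of the logarithm of a density. -/
noncomputable def logPotential (x : cl0 n) : cl0 n :=
  ⟨logDensity x - algebraMap ℝ (Op n) (tauRe n (logDensity x)),
    sub_mem (logDensity_mem_Cl x) (algebraMap_mem_Cl _),
    (isSelfAdjoint_logDensity x).sub (IsSelfAdjoint.algebraMap _ (IsSelfAdjoint.all _)), by
      have h := tau_conjTranspose (logDensity x)
      rw [show (logDensity x)ᴴ = logDensity x from isSelfAdjoint_logDensity x] at h
      rw [tau_sub, algebraMap_eq_coe_smul, tau_smul, tau_one, mul_one, sub_eq_zero, tauRe_apply]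
      exact (Complex.conj_eq_iff_re.1 h.symm).symm⟩

/-- The chain rule: `∇ᵢ log ρ` is, up to the factor `-1/2`, the twisted commutator of `log ρ` with
`Qᵢ`, so Duhamel's formula with `C = Qᵢ` gives `(Γ(ρ), ρ) # ∇ᵢ log ρ = ∇ᵢ ρ`. Hence the gradient of
the entropy is the linear field `N`. -/
theorem metricOp_logPotential {x : cl0 n} (hx : x ∈ posSet n) :
    metricOp x (logPotential x) = numberOp n x := by
  have hexp := exp_logDensity hx
  obtain ⟨c, hc, h⟩ := hx
  have hexpg : NormedSpace.exp (grading (logDensity x)) = grading (1 + (x : Op n)) := by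
    rw [logDensity, grading_log (isSelfAdjoint_one_add x)]
    exact exp_log_of_algebraMap_le hc (algebraMap_le_grading h)
  have half : ∀ A : Op n, (2⁻¹ : ℂ) • A = (2⁻¹ : ℝ) • A := fun A => by
    rw [← Complex.coe_smul]; norm_num
  refine Subtype.ext ?_
  rw [coe_metricOp, coe_numberOp]
  simp only [velocityCLM, _root_.sum_apply, ContinuousLinearMap.comp_apply, pderivAdjCLM_apply,
    pderivCLM_apply]
  refine Finset.sum_congr rfl fun i _ => ?_
  congr 1
  have e1 : pderiv i (logPotential x : Op n) = -(2⁻¹ : ℝ) •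
      (grading (logDensity x) * gen i - gen i * logDensity x) := by
    have : pderiv i (logPotential x : Op n) = pderiv i (logDensity x) := by
      change pderivL i (logDensity x - algebraMap ℝ (Op n) (tauRe n (logDensity x))) = _
      rw [map_sub, algebraMap_eq_coe_smul, map_smul]
      change _ - _ • pderiv i 1 = _
      rw [pderiv_one, smul_zero, sub_zero]
      rfl
    rw [this, pderiv, half, neg_smul, ← smul_neg, neg_sub]
  rw [e1, map_smul, NormedSpace.expMean_mul_sub_mul, hexp, hexpg, ← pderiv_one_add, pderiv,
    half, neg_smul, ← smul_neg, neg_sub]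

theorem entropy_eq {x : cl0 n} (hx : x ∈ posSet n) :
    entropy (1 + (x : Op n)) = tauRe n ((1 + (x : Op n)) * logDensity x) := by
  obtain ⟨c, hc, h⟩ := hx
  have hlog : ContinuousOn Real.log (spectrum ℝ (1 + (x : Op n))) :=
    Real.continuousOn_log.mono fun r hr => (hc.trans_le (le_of_mem_spectrum h hr)).ne'
  rw [entropy, cfc_mul (fun r : ℝ => r) Real.log _ continuousOn_id hlog,
    cfc_id' ℝ (1 + (x : Op n)) (isSelfAdjoint_one_add x)]
  rfl

/-- The mean of `log ρ` with itself is symmetric for the trace, maps `1` to `ρ` and maps `D log ρ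
[v]` to `v`. So this trace is `τ(v) = 0`, and the derivative of `τ(ρ log ρ)` is `τ(v log ρ)`. -/
theorem tauRe_mul_logSlope {x : cl0 n} (hx : x ∈ posSet n) (v : cl0 n) :
    tauRe n ((1 + (x : Op n)) * logSlope (x, x) v) = 0 := by
  set C := logSlope (x, x) v with hC
  have h1 : expMean (logDensity x) (logDensity x) C = (v : Op n) := by
    have hu := Ring.mul_inverse_cancel _ (isUnit_expMean_logDensity hx hx)
    simpa [hC, logSlope] using congrArg (fun f : Op n →L[ℝ] Op n => f (v : Op n)) hu
  have h2 := tau_mul_expMean (logDensity x) (logDensity x) 1 C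
  rw [one_mul, h1, expMean_self_one, exp_logDensity hx, v.2.2.2, tau_mul_comm] at h2
  rw [tauRe_apply, ← h2, Complex.zero_re]

theorem hasFDerivAt_entropy {x : cl0 n} (hx : x ∈ posSet n) :
    HasFDerivAt (fun x : cl0 n => entropy (1 + (x : Op n)))
      (metricTensor x (numberOp n x)) x := by
  have h1 : HasFDerivAt (fun x : cl0 n => 1 + (x : Op n)) (cl0 n).subtypeL x :=
    ((cl0 n).subtypeL.hasFDerivAt).const_add 1
  have h2 := (tauRe n).hasFDerivAt.comp x (h1.mul' (hasFDerivAt_logDensity hx))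
  have h3 := h2.congr_of_eventuallyEq (f₁ := fun x : cl0 n => entropy (1 + (x : Op n)))
    (Filter.eventuallyEq_of_mem (isOpen_posSet.mem_nhds hx) fun y hy => entropy_eq hy)
  refine h3.congr_fderiv ?_
  ext v
  rw [← metricOp_logPotential hx, metricTensor_metricOp hx]
  have e : (tau ((logPotential x : Op n) * (v : Op n))).re =
      tauRe n ((v : Op n) * logDensity x) := by
    have : (logPotential x : Op n) =
      logDensity x - algebraMap ℝ (Op n) (tauRe n (logDensity x)) := rfl
    rw [this, sub_mul, tau_sub, algebraMap_eq_coe_smul, smul_mul_assoc, one_mul, tau_smul,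
      v.2.2.2, mul_zero, sub_zero, tau_mul_comm, tauRe_apply]
  have h4 := tauRe_mul_logSlope hx v
  rw [tauForm_apply, e]
  simp [h4]

theorem exists_abs_entropy_le (n : ℕ) :
    ∃ B, ∀ x : cl0 n, 0 ≤ 1 + (x : Op n) → |entropy (1 + (x : Op n))| ≤ B := by
  obtain ⟨C, hC⟩ := (isCompact_Icc (a := (0 : ℝ)) (b := 2 ^ n)).exists_bound_of_continuousOn
    Real.continuous_mul_log.continuousOn
  have hC0 : 0 ≤ C := (norm_nonneg _).trans (hC 0 ⟨le_rfl, by positivity⟩)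
  refine ⟨‖tauRe n‖ * C, fun x hx => ?_⟩
  rw [entropy, ← tauRe_apply, ← Real.norm_eq_abs]
  exact ((tauRe n).le_opNorm _).trans (mul_le_mul_of_nonneg_left
    (norm_cfc_le hC0 fun r hr => hC r (spectrum_le_of_density hx hr)) (norm_nonneg _))

theorem continuousOn_entropy :
    ContinuousOn (fun x : cl0 n => entropy (1 + (x : Op n))) (lowerSet n 0) := by
  have h : ContinuousOn (fun x : cl0 n => cfc (fun r : ℝ => r * Real.log r) (1 + (x : Op n)))
      (lowerSet n 0) :=
    ContinuousOn.cfc' (isCompact_Icc (a := (0 : ℝ)) (b := 2 ^ n)) _ (by fun_prop)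
      (fun x hx => spectrum_le_of_density (mem_lowerSet_zero.1 hx))
      (fun x _ => isSelfAdjoint_one_add x) Real.continuous_mul_log.continuousOn
  exact (tauRe n).continuous.comp_continuousOn h

/-! ### The Riemannian Hessian of the entropy -/

theorem one_add_add_smul (x v : cl0 n) (t : ℝ) :
    1 + (x : Op n) + (t : ℂ) • (v : Op n) = 1 + ((x + t • v : cl0 n) : Op n) := by
  rw [Submodule.coe_add, Submodule.coe_smul, Complex.coe_smul, add_assoc]

theorem eventually_add_smul_mem {x : cl0 n} (hx : x ∈ posSet n) (v : cl0 n) :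
    ∀ᶠ t : ℝ in 𝓝 0, x + t • v ∈ posSet n := by
  have h : Continuous fun t : ℝ => x + t • v := by fun_prop
  exact h.continuousAt.eventually (isOpen_posSet.mem_nhds (by simpa using hx))

theorem hasFDerivAt_metricTensor {x : cl0 n} (hx : x ∈ posSet n) :
    HasFDerivAt (metricTensor (n := n)) (fderiv ℝ metricTensor x) x :=
  ((contDiffOn_metricTensor.contDiffAt (isOpen_posSet.mem_nhds hx)).differentiableAt
    (by norm_num)).hasFDerivAt

theorem hasDerivAt_metricTensor_line {x : cl0 n} (hx : x ∈ posSet n) (v a b : cl0 n) :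
    HasDerivAt (fun t : ℝ => metricTensor (x + t • v) a b) (fderiv ℝ metricTensor x v a b) 0 := by
  have h : HasDerivAt (fun t : ℝ => metricTensor (x + t • v)) (fderiv ℝ metricTensor x v) 0 :=
    HasFDerivAt.hasDerivAt_add_smul (W := cl0 n →L[ℝ] cl0 n →L[ℝ] ℝ) (hasFDerivAt_metricTensor hx) v
  simpa using (h.clm_apply (hasDerivAt_const (0 : ℝ) a)).clm_apply (hasDerivAt_const (0 : ℝ) b)

theorem fderiv_metricTensor_symm {x : cl0 n} (hx : x ∈ posSet n) (v a b : cl0 n) :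
    fderiv ℝ metricTensor x v a b = fderiv ℝ metricTensor x v b a := by
  refine (hasDerivAt_metricTensor_line hx v a b).unique
    ((hasDerivAt_metricTensor_line hx v b a).congr_of_eventuallyEq ?_)
  filter_upwards [eventually_add_smul_mem hx v] with t ht using metricTensor_symm ht a b

theorem deriv_metric_line {x : cl0 n} (hx : x ∈ posSet n) (v a b : cl0 n) :
    deriv (fun t : ℝ => metric (1 + (x : Op n) + (t : ℂ) • (v : Op n)) (a : Op n) (b : Op n)) 0 =
      fderiv ℝ metricTensor x v a b := by
  refine ((hasDerivAt_metricTensor_line hx v a b).congr_of_eventuallyEq ?_).deriv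
  filter_upwards [eventually_add_smul_mem hx v] with t ht
  rw [one_add_add_smul, metric_eq ht]

theorem exists_metricTensor_eq {x : cl0 n} (hx : x ∈ posSet n) (l : cl0 n →ₗ[ℝ] ℝ) :
    ∃ a, ∀ w, metricTensor x a w = l w := by
  let G : cl0 n →ₗ[ℝ] Module.Dual ℝ (cl0 n) :=
    { toFun := fun a => (metricTensor x a : cl0 n →ₗ[ℝ] ℝ)
      map_add' := fun a b => by ext; simp
      map_smul' := fun c a => by ext; simp }
  have hinj : Function.Injective G := by
    refine (injective_iff_map_eq_zero G).2 fun a ha => ?_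
    by_contra hne
    have h : metricTensor x a a = 0 := LinearMap.congr_fun ha a
    exact (metricTensor_pos hx hne).ne' h
  obtain ⟨a, ha⟩ := (LinearMap.injective_iff_surjective_of_finrank_eq_finrank
    (Subspace.dual_finrank_eq (K := ℝ) (V := cl0 n)).symm).1 hinj l
  exact ⟨a, fun w => LinearMap.congr_fun ha w⟩

/-- Nondegeneracy of the tensor provides a solution of the defining equation, so the choice operator
returns one. -/
theorem exists_christoffel_eq {x : cl0 n} (hx : x ∈ posSet n) (v : cl0 n) :
    ∃ a : cl0 n, christoffel (1 + (x : Op n)) (v : Op n) = a ∧ ∀ w, metricTensor x a w =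
      fderiv ℝ metricTensor x v v w - fderiv ℝ metricTensor x w v v / 2 := by
  have key : ∃ a : Op n, a ∈ Cl0 n ∧ ∀ w ∈ Cl0 n, metric (1 + (x : Op n)) a w =
      deriv (fun t : ℝ => metric (1 + (x : Op n) + (t : ℂ) • (v : Op n)) (v : Op n) w) 0 -
      deriv (fun t : ℝ => metric (1 + (x : Op n) + (t : ℂ) • w) (v : Op n) (v : Op n)) 0 / 2 := by
    obtain ⟨a, ha⟩ := exists_metricTensor_eq hx
      { toFun := fun w => fderiv ℝ metricTensor x v v w - fderiv ℝ metricTensor x w v v / 2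
        map_add' := fun a b => by simp; ring
        map_smul' := fun c a => by simp; ring }
    refine ⟨a, a.2, fun w hw => ?_⟩
    rw [deriv_metric_line hx v v ⟨w, hw⟩, deriv_metric_line hx ⟨w, hw⟩ v v,
      metric_eq hx a ⟨w, hw⟩]
    exact ha ⟨w, hw⟩
  obtain ⟨h1, h2⟩ := Classical.epsilon_spec key
  refine ⟨⟨_, h1⟩, rfl, fun w => ?_⟩
  rw [← deriv_metric_line hx v v w, ← deriv_metric_line hx w v v, ← metric_eq hx]
  exact h2 w w.2

theorem hasDerivAt_entropy_line {x : cl0 n} (hx : x ∈ posSet n) (v : cl0 n) :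
    HasDerivAt (fun t : ℝ => entropy (1 + (x : Op n) + (t : ℂ) • (v : Op n)))
      (metricTensor x (numberOp n x) v) 0 := by
  have h := (hasFDerivAt_entropy hx).hasDerivAt_add_smul v
  simpa only [one_add_add_smul] using h

/-- Since `DS = g(Nx, ·)`, the second derivative is `D_v g(Nx, v) + g(Nv, v)`. The Christoffel term
subtracts `D_v g(v, Nx) - ½ D_{Nx} g(v, v)`, and the derivatives in the direction `v` cancel. -/
theorem hessian_entropy {x : cl0 n} (hx : x ∈ posSet n) (v : cl0 n) :
    hessian entropy (1 + (x : Op n)) (v : Op n) = metricTensor x (numberOp n v) v +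
      fderiv ℝ metricTensor x (numberOp n x) v v / 2 := by
  obtain ⟨a, ha, hga⟩ := exists_christoffel_eq hx v
  have h1 : ∀ t : ℝ, x + t • v ∈ posSet n →
      HasDerivAt (fun t : ℝ => entropy (1 + (x : Op n) + (t : ℂ) • (v : Op n)))
        (metricTensor (x + t • v) (numberOp n (x + t • v)) v) t := fun t ht => by
    have hl : HasDerivAt (fun t : ℝ => x + t • v) v t := by
      simpa using ((hasDerivAt_id t).smul_const v).const_add x
    have := (hasFDerivAt_entropy ht).comp_hasDerivAt t hl
    simpa only [one_add_add_smul, Function.comp_def] using this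
  have h2 : HasDerivAt (fun t : ℝ => metricTensor (x + t • v) (numberOp n (x + t • v)) v)
      (fderiv ℝ metricTensor x v (numberOp n x) v + metricTensor x (numberOp n v) v) 0 := by
    have hg : HasDerivAt (fun t : ℝ => metricTensor (x + t • v)) (fderiv ℝ metricTensor x v) 0 :=
      HasFDerivAt.hasDerivAt_add_smul (W := cl0 n →L[ℝ] cl0 n →L[ℝ] ℝ) (hasFDerivAt_metricTensor hx) v
    have hN : HasDerivAt (fun t : ℝ => numberOp n (x + t • v)) (numberOp n v) 0 :=
      ((numberOp n).hasFDerivAt (x := x)).hasDerivAt_add_smul v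
    simpa using (hg.clm_apply hN).clm_apply (hasDerivAt_const (0 : ℝ) v)
  have h3 : deriv (fun t : ℝ => entropy (1 + (x : Op n) + (t : ℂ) • (v : Op n))) =ᶠ[𝓝 0]
      fun t : ℝ => metricTensor (x + t • v) (numberOp n (x + t • v)) v := by
    filter_upwards [eventually_add_smul_mem hx v] with t ht using (h1 t ht).deriv
  rw [hessian, iteratedDeriv_succ, iteratedDeriv_one, h3.deriv_eq, h2.deriv, ha,
    (hasDerivAt_entropy_line hx a).deriv, metricTensor_symm hx (numberOp n x) a, hga,
    fderiv_metricTensor_symm hx v v]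
  ring

theorem normRho_grad_sq {x : cl0 n} (hx : x ∈ posSet n) (U : cl0 n) :
    normRho (1 + (x : Op n)) (grad (U : Op n)) ^ 2 =
      metricTensor x (metricOp x U) (metricOp x U) := by
  have h : (innerRho (1 + (x : Op n)) (grad (U : Op n)) (grad (U : Op n))).re =
      metricTensor x (metricOp x U) (metricOp x U) := by
    rw [innerRho_eq hx, metricTensor_metricOp hx, tauForm_apply]
  rw [normRho, h, Real.sq_sqrt (metricTensor_nonneg hx _)]

/-- A lower bound of the Hessian of the entropy makes the Ornstein-Uhlenbeck semigroup a
`κ`-convex gradient flow. -/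
theorem exists_convexFlow {κ : ℝ} (hHess : ∀ ρ ∈ densityPos n, ∀ U ∈ Cl0 n,
    κ * normRho ρ (grad U) ^ 2 ≤ hessEntropy ρ U) :
    ∃ B, ConvexFlow (metricTensor (n := n)) (posSet n) (numberOp n)
      (fun x : cl0 n => entropy (1 + (x : Op n))) κ B := by
  obtain ⟨B, hB⟩ := exists_abs_entropy_le n
  refine ⟨B, isOpen_posSet, convex_posSet, contDiffOn_metricTensor,
    fun x hx => metricTensor_symm hx, fun x hx => metricTensor_nonneg hx,
    fun x hx t ht => flow_mem_posSet ht hx, fun x hx => hasFDerivAt_entropy hx, fun x hx v => ?_,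
    fun x hx => hB x (nonneg_of_mem_posSet hx)⟩
  obtain ⟨U, rfl⟩ : ∃ U, metricOp x U = v := ⟨_, metricOp_inverse hx v⟩
  have h := hHess _ (mem_densityPos_iff.2 ⟨x, hx, rfl⟩) U U.2
  rwa [normRho_grad_sq hx, hessEntropy, velocity_eq_metricOp hx, hessian_entropy hx] at h

/-! ### The Riemannian distance in the affine chart -/

theorem contDiffOn_of_entries {k : WithTop ℕ∞} {γ : ℝ → Op n} {s : Set ℝ}
    (h : ∀ i j, ContDiffOn ℝ k (fun t => γ t i j) s) : ContDiffOn ℝ k γ s := by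
  let L : ((Fin n → Fin 2) → (Fin n → Fin 2) → ℂ) →L[ℝ] Op n :=
    LinearMap.toContinuousLinearMap (Matrix.ofLinearEquiv ℝ).toLinearMap
  exact L.contDiff.comp_contDiffOn (contDiffOn_pi.2 fun i => contDiffOn_pi.2 fun j => h i j)

/-- The entries of a matrix as continuous linear maps. -/
noncomputable def entryCLM (i j : Fin n → Fin 2) : Op n →L[ℝ] ℂ :=
  LinearMap.toContinuousLinearMap (Matrix.entryLinearMap ℝ ℂ i j)

theorem curveDeriv_eq {γ : ℝ → Op n} {η : ℝ → cl0 n} {t : ℝ}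
    (h : ∀ᶠ r in 𝓝 t, γ r = 1 + (η r : Op n)) (hη : DifferentiableAt ℝ η t) :
    curveDeriv γ t = ((deriv η t : cl0 n) : Op n) := by
  ext i j
  have h1 := (((entryCLM i j).comp (cl0 n).subtypeL).hasFDerivAt.comp_hasDerivAt t
    hη.hasDerivAt).const_add ((1 : Op n) i j)
  refine (h1.congr_of_eventuallyEq ?_).deriv
  filter_upwards [h] with r hr
  rw [hr]
  rfl

theorem arclength_eq {γ : ℝ → Op n} {η : ℝ → cl0 n}
    (h : ∀ t ∈ Ioo (0 : ℝ) 1, γ t = 1 + (η t : Op n)) (hM : ∀ t ∈ Ioo (0 : ℝ) 1, η t ∈ posSet n)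
    (hη : ContDiffOn ℝ ∞ η (Ioo 0 1)) :
    arclength γ = ∫⁻ t in Ioo (0 : ℝ) 1, ENNReal.ofReal (speed metricTensor η t) := by
  refine setLIntegral_congr_fun measurableSet_Ioo fun t ht => ?_
  have hd : DifferentiableAt ℝ η t :=
    (hη.differentiableOn (by norm_num)).differentiableAt (isOpen_Ioo.mem_nhds ht)
  rw [curveDeriv_eq (eventually_of_mem (isOpen_Ioo.mem_nhds ht) h) hd, h t ht,
    metric_eq (hM t ht), speed]

/-- The affine chart `ρ ↦ ρ - 1`. -/
noncomputable def chart (ρ : Op n) : cl0 n := projCl0 n (ρ - 1)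

theorem chart_one_add (x : cl0 n) : chart (1 + (x : Op n)) = x := by
  rw [chart, add_sub_cancel_left, projCl0_apply]

theorem continuous_chart : Continuous (chart (n := n)) :=
  (projCl0 n).continuous.comp (continuous_id.sub continuous_const)

theorem chart_mem_posSet {ρ : Op n} (h : ρ ∈ densityPos n) :
    chart ρ ∈ posSet n ∧ ρ = 1 + (chart ρ : Op n) := by
  obtain ⟨x, hx, rfl⟩ := mem_densityPos_iff.1 h
  rw [chart_one_add]
  exact ⟨hx, rfl⟩

/-- The bounds on the metric tensor under which its distance extends to the closure. -/
theorem exists_bounds (n : ℕ) : ∃ C R : ℝ, 0 ≤ C ∧ (∀ x ∈ posSet n, ∀ v,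
    ∀ ε ∈ Ioc (0 : ℝ) 1, metricTensor ((1 - ε) • x) v v ≤ C / ε * ‖v‖ ^ 2) ∧
    ∀ x ∈ posSet n, ‖x‖ ≤ R := by
  obtain ⟨C, hC, h⟩ := exists_metricTensor_le n
  exact ⟨C, 2 ^ n + 1, hC, h, fun x hx => norm_le_of_density (nonneg_of_mem_posSet hx)⟩

/-- Flat curves are among the admissible ones. Conversely, an admissible curve, smooth only in the
open interval, is no shorter than `rdist` because `rdist` is continuous at its endpoints. -/
theorem distPos_eq {x y : cl0 n} (hx : x ∈ posSet n) (hy : y ∈ posSet n) :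
    distPos (1 + (x : Op n)) (1 + (y : Op n)) = rdist metricTensor (posSet n) x y := by
  have hg := (contDiffOn_metricTensor (n := n)).continuousOn
  obtain ⟨C, R, hC, hgC, hR⟩ := exists_bounds n
  have h1 : ⨅ γ ∈ couplings (1 + (x : Op n)) (1 + (y : Op n)), arclength γ =
      ENNReal.ofReal (rdist metricTensor (posSet n) x y) := by
    refine le_antisymm ?_ (le_iInf₂ fun γ hγ => ?_)
    · refine ENNReal.le_of_forall_pos_le_add fun ε hε _ => ?_
      obtain ⟨η, hη, hlt⟩ := exists_flatCurve_lt convex_posSet hx hy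
        (lt_add_of_pos_right (rdist metricTensor (posSet n) x y) (NNReal.coe_pos.2 hε))
      have hcont : Continuous fun t => 1 + (η t : Op n) :=
        continuous_const.add (continuous_subtype_val.comp hη.smooth.continuous)
      have hmem : (fun t => 1 + (η t : Op n)) ∈
          couplings (1 + (x : Op n)) (1 + (y : Op n)) := by
        refine ⟨fun t _ => mem_densityPos_iff.2 ⟨η t, hη.mem t, rfl⟩, hcont.continuousOn,
          fun i j => ?_, by simp only [hη.left 0 le_rfl], by simp only [hη.right 1 le_rfl]⟩
        have : ContDiff ℝ ∞ fun t => (1 : Op n) i j + (entryCLM i j).comp (cl0 n).subtypeL (η t) :=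
          contDiff_const.add (((entryCLM i j).comp (cl0 n).subtypeL).contDiff.comp hη.smooth)
        exact this.contDiffOn
      refine (iInf₂_le _ hmem).trans ?_
      rw [arclength_eq (fun t _ => rfl) (fun t _ => hη.mem t) hη.smooth.contDiffOn]
      have hsc := hη.continuous_speed hg
      have hint : IntegrableOn (speed metricTensor η) (Ioo 0 1) :=
        (hsc.continuousOn.integrableOn_Icc (a := 0) (b := 1)).mono_set Ioo_subset_Icc_self
      rw [← ofReal_integral_eq_lintegral_ofReal hint
        (Eventually.of_forall fun t => speed_nonneg η t), ← integral_Ioc_eq_integral_Ioo,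
        ← intervalIntegral.integral_of_le zero_le_one, ← ENNReal.ofReal_coe_nnreal,
        ← ENNReal.ofReal_add (rdist_nonneg _ _) ε.coe_nonneg]
      exact ENNReal.ofReal_le_ofReal hlt.le
    · obtain ⟨hM, hc, hs, h0, h1⟩ := hγ
      have hη : ContDiffOn ℝ ∞ (fun t => chart (γ t)) (Ioo 0 1) :=
        (projCl0 n).contDiff.comp_contDiffOn ((contDiffOn_of_entries hs).sub contDiffOn_const)
      rw [arclength_eq (fun t ht => (chart_mem_posSet (hM t (Ioo_subset_Icc_self ht))).2)
        (fun t ht => (chart_mem_posSet (hM t (Ioo_subset_Icc_self ht))).1) hη]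
      have := ofReal_rdist_le_lintegral_speed hg convex_posSet zero_mem_posSet hC hgC hR
        (fun t ht => (chart_mem_posSet (hM t ht)).1) (continuous_chart.comp_continuousOn hc) hη
      simpa only [Function.comp_apply, h0, h1, chart_one_add] using this
  rw [distPos, h1, ENNReal.toReal_ofReal (rdist_nonneg _ _)]

theorem tendsto_shrink (x : cl0 n) : Tendsto (fun ε : ℝ => (1 - ε) • x) (𝓝[>] 0) (𝓝 x) := by
  have : Continuous fun ε : ℝ => (1 - ε) • x := by fun_prop
  simpa using (this.tendsto 0).mono_left nhdsWithin_le_nhds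

theorem eventually_shrink_mem {x : cl0 n} (hx : x ∈ lowerSet n 0) :
    ∀ᶠ ε : ℝ in 𝓝[>] 0, (1 - ε) • x ∈ posSet n := by
  filter_upwards [Ioo_mem_nhdsGT (zero_lt_one' ℝ)] with ε hε
  exact smul_mem_posSet (mem_lowerSet_zero.1 hx) hε.1 hε.2.le

theorem tendsto_shrink_prod {x y : cl0 n} (hx : x ∈ lowerSet n 0) (hy : y ∈ lowerSet n 0) :
    Tendsto (fun ε : ℝ => ((1 - ε) • x, (1 - ε) • y)) (𝓝[>] 0)
      (𝓝[posSet n ×ˢ posSet n] (x, y)) :=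
  tendsto_nhdsWithin_iff.2 ⟨(tendsto_shrink x).prodMk_nhds (tendsto_shrink y), by
    filter_upwards [eventually_shrink_mem hx, eventually_shrink_mem hy] with ε h1 h2 using ⟨h1, h2⟩⟩

theorem mem_closure_densityPos {x : cl0 n} (hx : x ∈ lowerSet n 0) :
    1 + (x : Op n) ∈ closure (densityPos n) := by
  have hc : Continuous fun p : cl0 n => 1 + (p : Op n) := by fun_prop
  refine mem_closure_of_tendsto ((hc.tendsto x).comp (tendsto_shrink x)) ?_
  filter_upwards [eventually_shrink_mem hx] with ε h1
  exact mem_densityPos_iff.2 ⟨_, h1, rfl⟩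

/-- The limit must exist along all interior pairs, not just along one sequence, for `extendFrom` to
return it. -/
theorem distance_eq_of_tendsto {x y : cl0 n} (hx : x ∈ lowerSet n 0) (hy : y ∈ lowerSet n 0)
    {l : ℝ} (hl : Tendsto (fun p : cl0 n × cl0 n => rdist metricTensor (posSet n) p.1 p.2)
      (𝓝[posSet n ×ˢ posSet n] (x, y)) (𝓝 l)) :
    distance (1 + (x : Op n)) (1 + (y : Op n)) = l := by
  refine extendFrom_eq_of_tendsto (φ := fun p : Op n × Op n => (chart p.1, chart p.2))
    (B := posSet n ×ˢ posSet n) (r := fun p => rdist metricTensor (posSet n) p.1 p.2)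
    ?_ ?_ ?_ ?_ ?_
  · rw [closure_prod_eq]
    exact ⟨mem_closure_densityPos hx, mem_closure_densityPos hy⟩
  · exact ((continuous_chart.comp continuous_fst).prodMk
      (continuous_chart.comp continuous_snd)).continuousAt
  · exact fun p hp => ⟨(chart_mem_posSet hp.1).1, (chart_mem_posSet hp.2).1⟩
  · intro p hp
    obtain ⟨h1, e1⟩ := chart_mem_posSet hp.1
    obtain ⟨h2, e2⟩ := chart_mem_posSet hp.2
    rw [← distPos_eq h1 h2, ← e1, ← e2]
  · simpa only [chart_one_add] using hl

theorem exists_tendsto_rdist_metricTensor {x y : cl0 n} (hx : x ∈ lowerSet n 0)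
    (hy : y ∈ lowerSet n 0) :
    ∃ l, Tendsto (fun p : cl0 n × cl0 n => rdist metricTensor (posSet n) p.1 p.2)
      (𝓝[posSet n ×ˢ posSet n] (x, y)) (𝓝 l) := by
  obtain ⟨C, R, hC, hgC, hR⟩ := exists_bounds n
  have hne : (𝓝[posSet n ×ˢ posSet n] (x, y)).NeBot := (tendsto_shrink_prod hx hy).neBot
  exact exists_tendsto_rdist (contDiffOn_metricTensor (n := n)).continuousOn
    convex_posSet zero_mem_posSet hC hgC hR (mem_closure_iff_nhdsWithin_neBot.2 hne)

/-- The distance of densities is the limit of the distances in the interior. -/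
theorem tendsto_rdist_distance {x y : cl0 n} (hx : x ∈ lowerSet n 0) (hy : y ∈ lowerSet n 0) :
    Tendsto (fun ε : ℝ => rdist metricTensor (posSet n) ((1 - ε) • x) ((1 - ε) • y)) (𝓝[>] 0)
      (𝓝 (distance (1 + (x : Op n)) (1 + (y : Op n)))) := by
  obtain ⟨l, hl⟩ := exists_tendsto_rdist_metricTensor hx hy
  have h := tendsto_uncurry_comp (r := rdist metricTensor (posSet n)) hl
    (tendsto_shrink_prod hx hy)
  rwa [← distance_eq_of_tendsto hx hy hl] at h

theorem distance_nonneg {x y : cl0 n} (hx : x ∈ lowerSet n 0) (hy : y ∈ lowerSet n 0) :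
    0 ≤ distance (1 + (x : Op n)) (1 + (y : Op n)) :=
  ge_of_tendsto' (tendsto_rdist_distance hx hy) fun _ => rdist_nonneg _ _

theorem distance_comm {x y : cl0 n} (hx : x ∈ lowerSet n 0) (hy : y ∈ lowerSet n 0) :
    distance (1 + (x : Op n)) (1 + (y : Op n)) = distance (1 + (y : Op n)) (1 + (x : Op n)) := by
  refine tendsto_nhds_unique_of_eventuallyEq (tendsto_rdist_distance hx hy)
    (tendsto_rdist_distance hy hx) ?_
  filter_upwards [eventually_shrink_mem hx, eventually_shrink_mem hy] with ε h1 h2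
  exact rdist_comm convex_posSet h1 h2

theorem distance_triangle {x y z : cl0 n} (hx : x ∈ lowerSet n 0) (hy : y ∈ lowerSet n 0)
    (hz : z ∈ lowerSet n 0) : distance (1 + (x : Op n)) (1 + (z : Op n)) ≤
      distance (1 + (x : Op n)) (1 + (y : Op n)) + distance (1 + (y : Op n)) (1 + (z : Op n)) := by
  refine le_of_tendsto_of_tendsto (tendsto_rdist_distance hx hz)
    ((tendsto_rdist_distance hx hy).add (tendsto_rdist_distance hy hz)) ?_
  filter_upwards [eventually_shrink_mem hx, eventually_shrink_mem hy, eventually_shrink_mem hz]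
    with ε h1 h2 h3
  exact rdist_triangle (contDiffOn_metricTensor (n := n)).continuousOn convex_posSet h1 h2 h3

theorem tendsto_entropy_shrink {x : cl0 n} (hx : x ∈ lowerSet n 0) :
    Tendsto (fun ε : ℝ => entropy (1 + (((1 - ε) • x : cl0 n) : Op n))) (𝓝[>] 0)
      (𝓝 (entropy (1 + (x : Op n)))) := by
  refine (continuousOn_entropy x hx).tendsto.comp
    (tendsto_nhdsWithin_iff.2 ⟨tendsto_shrink x, ?_⟩)
  filter_upwards [eventually_shrink_mem hx] with ε h1
  exact mem_lowerSet_zero.2 (nonneg_of_mem_posSet h1)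

/-- The discrete evolution variational inequality for densities. -/
theorem sq_distance_flow_le {κ B : ℝ}
    (h : ConvexFlow (metricTensor (n := n)) (posSet n) (numberOp n)
      (fun x : cl0 n => entropy (1 + (x : Op n))) κ B)
    {x y : cl0 n} (hx : x ∈ lowerSet n 0) (hy : y ∈ lowerSet n 0) {T : ℝ} (hT0 : 0 ≤ T)
    (hT : 2 * |κ| * T ≤ 1) :
    distance (1 + (y : Op n)) (1 + (flow (numberOp n) T x : Op n)) ^ 2 ≤
      (distance (1 + (y : Op n)) (1 + (x : Op n)) ^ 2 +
        2 * T * (entropy (1 + (y : Op n)) - entropy (1 + (flow (numberOp n) T x : Op n))) +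
        24 * |κ| * B * T ^ 2) * (1 - κ * T + 4 * κ ^ 2 * T ^ 2) := by
  have hxT := flow_mem_lowerSet hT0 hx
  refine le_of_tendsto_of_tendsto ((tendsto_rdist_distance hy hxT).pow 2)
    (((((tendsto_rdist_distance hy hx).pow 2).add
      (((tendsto_entropy_shrink hy).sub (tendsto_entropy_shrink hxT)).const_mul (2 * T))).add_const
        (24 * |κ| * B * T ^ 2)).mul_const (1 - κ * T + 4 * κ ^ 2 * T ^ 2)) ?_
  filter_upwards [eventually_shrink_mem hx, eventually_shrink_mem hy] with ε h1 h2
  have := h.sq_rdist_flow_le h1 h2 hT0 hT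
  -- The flow is linear, so it commutes with shrinking towards the identity density.
  rwa [map_smul] at this

theorem exists_lowerSet_of_density {ρ : Op n} (h : ρ ∈ density n) :
    ∃ x ∈ lowerSet n 0, ρ = 1 + (x : Op n) := by
  obtain ⟨x, hx, h⟩ := mem_density_iff.1 h
  exact ⟨x, mem_lowerSet_zero.2 hx, h⟩

theorem tendsto_entropy_flow {x : cl0 n} (hx : x ∈ lowerSet n 0) :
    Tendsto (fun s : ℝ => entropy (1 + (flow (numberOp n) s x : Op n))) (𝓝[>] 0)
      (𝓝 (entropy (1 + (x : Op n)))) := by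
  refine (continuousOn_entropy x hx).tendsto.comp (tendsto_nhdsWithin_iff.2 ⟨?_, ?_⟩)
  · have h : Continuous fun s : ℝ => flow (numberOp n) s x :=
      (contDiff_flow (numberOp n)).continuous.clm_apply continuous_const
    have h2 := (h.tendsto 0).mono_left (nhdsWithin_le_nhds (s := Ioi 0))
    rwa [flow_zero, one_apply_eq_self] at h2
  · filter_upwards [self_mem_nhdsWithin] with s hs using flow_mem_lowerSet (le_of_lt hs) hx

end FermiClifford

theorem proposition5p9 (n : ℕ) (κ : ℝ)
    (hHess : ∀ ρ ∈ FermiClifford.densityPos n, ∀ U ∈ FermiClifford.Cl0 n,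
      κ * FermiClifford.normRho ρ (FermiClifford.grad U) ^ 2 ≤ FermiClifford.hessEntropy ρ U)
    (u : ℝ → FermiClifford.Op n) (hu : FermiClifford.IsGeodesic u)
    (t : ℝ) (ht : t ∈ Set.Icc (0 : ℝ) 1) :
    FermiClifford.entropy (u t) ≤
      (1 - t) * FermiClifford.entropy (u 0) + t * FermiClifford.entropy (u 1) -
        κ / 2 * t * (1 - t) * FermiClifford.distance (u 0) (u 1) ^ 2 := by
  open FermiClifford LocalMetric in
  obtain ⟨hud, hgeo⟩ := hu
  have m0 : (0 : ℝ) ∈ Icc (0 : ℝ) 1 := left_mem_Icc.2 zero_le_one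
  have m1 : (1 : ℝ) ∈ Icc (0 : ℝ) 1 := right_mem_Icc.2 zero_le_one
  obtain ⟨B, hF⟩ := exists_convexFlow hHess
  have d0 := hgeo 0 m0 t ht
  have d1 := hgeo 1 m1 t ht
  obtain ⟨x, hx, ex⟩ := exists_lowerSet_of_density (hud t ht)
  obtain ⟨y, hy, ey⟩ := exists_lowerSet_of_density (hud 0 m0)
  obtain ⟨z, hz, ez⟩ := exists_lowerSet_of_density (hud 1 m1)
  rw [ey, ez, ex] at d0 d1
  rw [ex, ey, ez]
  set d := distance (1 + (y : Op n)) (1 + (z : Op n)) with hd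
  have hd0 : 0 ≤ d := distance_nonneg hy hz
  rw [sub_zero, abs_of_nonneg ht.1] at d0
  rw [abs_of_nonpos (by linarith [ht.2]), neg_sub] at d1
  set Sy := entropy (1 + (y : Op n))
  set Sz := entropy (1 + (z : Op n))
  -- `Δ h` is the convexity defect of the entropy when the intermediate point has moved by the flow
  -- for the time `h`.
  set Δ : ℝ → ℝ := fun h => (1 - t) * Sy + t * Sz -
    entropy (1 + (flow (numberOp n) h x : Op n)) with hΔ
  set q := t * (1 - t) * d ^ 2 with hq
  have key : ∀ᶠ h : ℝ in 𝓝[>] 0, 0 ≤ q * (-κ + 4 * κ ^ 2 * h) +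
      (2 * Δ h + 24 * |κ| * B * h) * (1 - κ * h + 4 * κ ^ 2 * h ^ 2) := by
    have hsmall : ∀ᶠ h : ℝ in 𝓝[>] 0, 2 * |κ| * h < 1 := by
      have hc : Continuous fun h : ℝ => 2 * |κ| * h := by fun_prop
      exact ((hc.tendsto' 0 0 (by simp)).mono_left nhdsWithin_le_nhds).eventually_lt_const one_pos
    filter_upwards [hsmall, self_mem_nhdsWithin] with h hh (h0 : 0 < h)
    have e0 := sq_distance_flow_le hF hx hy h0.le hh.le
    have e1 := sq_distance_flow_le hF hx hz h0.le hh.le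
    have hxh := flow_mem_lowerSet h0.le hx
    have htri := distance_triangle hy hxh hz
    rw [distance_comm hxh hz] at htri
    rw [d0] at e0
    rw [d1] at e1
    set a := distance (1 + (y : Op n)) (1 + (flow (numberOp n) h x : Op n))
    set b := distance (1 + (z : Op n)) (1 + (flow (numberOp n) h x : Op n))
    have hdab : d ^ 2 ≤ (a + b) ^ 2 := pow_le_pow_left₀ hd0 htri 2
    -- The difference of the two sides is `((1 - t) a - t b)²`. At `h = 0` the distances are `t d`
    -- and `(1 - t) d`, and equality holds with common value `q`; hence the zeroth order terms
    -- cancel below.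
    have hconv : t * (1 - t) * (a + b) ^ 2 ≤ (1 - t) * a ^ 2 + t * b ^ 2 := by
      nlinarith [sq_nonneg ((1 - t) * a - t * b)]
    have ht' : 0 ≤ t * (1 - t) := mul_nonneg ht.1 (by linarith [ht.2])
    have f0 := mul_le_mul_of_nonneg_left e0 (by linarith [ht.2] : 0 ≤ 1 - t)
    have f1 := mul_le_mul_of_nonneg_left e1 ht.1
    have f2 := mul_le_mul_of_nonneg_left hdab ht'
    have hle : q ≤ (q + 2 * h * Δ h + 24 * |κ| * B * h ^ 2) *
        (1 - κ * h + 4 * κ ^ 2 * h ^ 2) := by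
      refine (f2.trans (hconv.trans (add_le_add f0 f1))).trans (le_of_eq ?_)
      simp only [hq, hΔ]
      ring
    -- Subtracting `q` from `hle` leaves a multiple of `h`. Dividing by `h` and letting `h → 0`
    -- leaves `0 ≤ -κ q + 2 Δ`, with `Δ` taken at the unmoved point.
    refine nonneg_of_mul_nonneg_right (a := h) ?_ h0
    have e : h * (q * (-κ + 4 * κ ^ 2 * h) +
        (2 * Δ h + 24 * |κ| * B * h) * (1 - κ * h + 4 * κ ^ 2 * h ^ 2)) =
        (q + 2 * h * Δ h + 24 * |κ| * B * h ^ 2) * (1 - κ * h + 4 * κ ^ 2 * h ^ 2) - q := by ring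
    rw [e]
    exact sub_nonneg.2 hle
  have hΔlim : Tendsto Δ (𝓝[>] 0) (𝓝 ((1 - t) * Sy + t * Sz - entropy (1 + (x : Op n)))) :=
    (tendsto_entropy_flow hx).const_sub _
  have hpoly : ∀ f : ℝ → ℝ, Continuous f → Tendsto f (𝓝[>] 0) (𝓝 (f 0)) := fun f hf =>
    (hf.tendsto 0).mono_left nhdsWithin_le_nhds
  have hlim := ((hpoly (fun h => q * (-κ + 4 * κ ^ 2 * h)) (by fun_prop)).add
    (((hΔlim.const_mul 2).add (hpoly (fun h => 24 * |κ| * B * h) (by fun_prop))).mul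
      (hpoly (fun h => 1 - κ * h + 4 * κ ^ 2 * h ^ 2) (by fun_prop))))
  have hfin := ge_of_tendsto hlim key
  simp only [mul_zero, add_zero, sub_zero, mul_one, ne_eq, OfNat.ofNat_ne_zero, not_false_eq_true,
    zero_pow] at hfin
  rw [show κ / 2 * t * (1 - t) * d ^ 2 = κ / 2 * q by rw [hq]; ring]
  linarith
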